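/- Let $d\ge 2$ be an integer. A foliation $\mathcal F$ of degree $d$ on $\mathbb P^2_{\mathbb C}$ is given, up to multiplication by a non-zero constant, by a $1$-form $a\,\mathrm dx+b\,\mathrm dy+c\,\mathrm dz$, where $a,b,c\in\mathbb C[x,y,z]$ are homogeneous of degree $d+1$, have no common factor and satisfy $xa+yb+zc=0$. Thus the set $\mathbf F(d)$ of these foliations is a Zariski open subset of a complex projective space, and it carries the induced Zariski topology. The group $\mathrm{Aut}(\mathbb P^2_{\mathbb C})=\mathrm{PGL}_3(\mathbb C)$ acts on $\mathbf F(d)$ by pullback; let $$\mathcal O(\mathcal F)=\{\varphi^*\mathcal F \mid \varphi\in\mathrm{PGL}_3(\mathbb C)\},\qquad \mathrm{Iso}(\mathcal F)=\{\varphi\in\mathrm{PGL}_3(\mathbb C) \mid \varphi^*\mathcal F=\mathcal F\}$$ be the orbit and the isotropy group of $\mathcal F$; dimensions are complex dimensions. Let $\mathcal F_1^d$ and $\mathcal F_2^d$ be the foliations of degree $d$ defined in the affine chart $z=1$ by $$\omega_1^d=y^d\,\mathrm dx+x^d(x\,\mathrm dy-y\,\mathrm dx),\qquad \omega_2^d=x^d\,\mathrm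 dx+y^d(x\,\mathrm dy-y\,\mathrm dx).$$ 1. If $\mathcal F\in\mathbf F(d)$ and $\dim\mathrm{Iso}(\mathcal F)=2$, then $\mathcal F\in\mathcal O(\mathcal F_1^d)\cup\mathcal O(\mathcal F_2^d)$; that is, $\mathcal F$ is linearly conjugate to $\mathcal F_1^d$ or to $\mathcal F_2^d$. 2. Every orbit in $\mathbf F(d)$ has dimension at least $6$, and $\mathcal O(\mathcal F_1^d)$ and $\mathcal O(\mathcal F_2^d)$ are exactly the orbits of dimension $6$; these two orbits are distinct. 3. The orbits $\mathcal O(\mathcal F_1^d)$ and $\mathcal O(\mathcal F_2^d)$ are closed in $\mathbf F(d)$. 4. In the affine chart $z=1$, $$\mathrm{Iso}(\mathcal F_1^d)=\left\{\left(\frac{\alpha^{d-1}x}{1+\beta x},\frac{\alpha^{d}y}{1+\beta x}\right)\ \Big|\ \alpha\in\mathbb C^*,\ \beta\in\mathbb C\right\},$$ $$\mathrm{Iso}(\mathcal F_2^d)=\left\{\left(\frac{\alpha^{d+1}x}{1+\beta x},\frac{\alpha^{d}y}{1+\beta x}\right)\ \Big|\ \alpha\in\mathbb C^*,\ \beta\in\mathbb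 C\right\},$$ and these two groups are not conjugate in $\mathrm{PGL}_3(\mathbb C)$. -/

import Mathlib

open scoped LinearAlgebra.Projectivization MatrixGroups

noncomputable section

namespace PlaneFoliation

open MvPolynomial

/-! ### Homogeneous 1-forms on `ℂ³` and their pullbacks -/

/-- Polynomials in the homogeneous coordinates `x = X 0`, `y = X 1`, `z = X 2`. -/
abbrev Poly : Type := MvPolynomial (Fin 3) ℂ

/-- The vector space of 1-forms `a dx + b dy + c dz`, written as `![a, b, c]`, whose coefficients
are homogeneous of degree `d + 1` and satisfy the Euler condition `x a + y b + z c = 0`. -/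
def formSpace (d : ℕ) : Submodule ℂ (Fin 3 → Poly) where
  carrier := {ω | (∀ i, (ω i).IsHomogeneous (d + 1)) ∧ ∑ i, X i * ω i = 0}
  zero_mem' := ⟨fun _ => isHomogeneous_zero _ _ _, by simp⟩
  add_mem' := fun {ω η} hω hη => ⟨fun i => (hω.1 i).add (hη.1 i), by
    simp only [Pi.add_apply, mul_add, Finset.sum_add_distrib, hω.2, hη.2, add_zero]⟩
  smul_mem' := fun c ω hω => ⟨fun i => by
    simpa [MvPolynomial.smul_eq_C_mul] using (isHomogeneous_C (Fin 3) c).mul (hω.1 i), by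
    simp only [Pi.smul_apply, mul_smul_comm, ← Finset.smul_sum, hω.2, smul_zero]⟩

/-- The linear substitution `p ↦ p ∘ M`, where `M` maps a column vector `v` to `M v`. -/
def subst (M : Matrix (Fin 3) (Fin 3) ℂ) : Poly →ₐ[ℂ] Poly :=
  aeval fun i => ∑ j, C (M i j) * X j

/-- The pullback of the 1-form `∑ i, ω i dxᵢ` under the linear map `v ↦ M v`:
`∑ i, (ω i ∘ M) d(∑ j, M i j xⱼ) = ∑ j, (∑ i, M i j (ω i ∘ M)) dxⱼ`. -/
def pullFun (M : Matrix (Fin 3) (Fin 3) ℂ) (ω : Fin 3 → Poly) : Fin 3 → Poly :=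
  fun j => ∑ i, C (M i j) * subst M (ω i)

lemma subst_X (M : Matrix (Fin 3) (Fin 3) ℂ) (i : Fin 3) :
    subst M (X i) = ∑ j, C (M i j) * X j := by simp [subst]

lemma subst_C (M : Matrix (Fin 3) (Fin 3) ℂ) (c : ℂ) : subst M (C c) = C c := by simp [subst]

lemma subst_one (p : Poly) : subst 1 p = p := by
  have : subst 1 = AlgHom.id ℂ Poly := by
    apply MvPolynomial.algHom_ext
    intro i
    simp [subst_X, Matrix.one_apply, apply_ite C]
  simp [this]

lemma subst_mul (M N : Matrix (Fin 3) (Fin 3) ℂ) (p : Poly) :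
    subst (M * N) p = subst N (subst M p) := by
  have : subst (M * N) = (subst N).comp (subst M) := by
    apply MvPolynomial.algHom_ext
    intro i
    simp only [AlgHom.comp_apply, subst_X, map_sum, map_mul, subst_C, Matrix.mul_apply,
      Finset.sum_mul, Finset.mul_sum]
    rw [Finset.sum_comm]
    simp only [mul_assoc]
  simp [this]

lemma pullFun_one (ω : Fin 3 → Poly) : pullFun 1 ω = ω := by
  funext j
  simp [pullFun, subst_one, Matrix.one_apply, apply_ite C]

lemma pullFun_mul (M N : Matrix (Fin 3) (Fin 3) ℂ) (ω : Fin 3 → Poly) :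
    pullFun (M * N) ω = pullFun N (pullFun M ω) := by
  funext j
  simp only [pullFun, subst_mul, map_sum, map_mul, subst_C, Matrix.mul_apply,
    Finset.sum_mul, Finset.mul_sum]
  rw [Finset.sum_comm]
  refine Finset.sum_congr rfl fun k _ => Finset.sum_congr rfl fun i _ => ?_
  ring

lemma subst_isHomogeneous (M : Matrix (Fin 3) (Fin 3) ℂ) {p : Poly} {n : ℕ}
    (hp : p.IsHomogeneous n) : (subst M p).IsHomogeneous n := by
  have := hp.aeval (fun i => ∑ j, C (M i j) * X j : Fin 3 → Poly) (n := 1) fun i =>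
    IsHomogeneous.sum _ _ _ fun j _ => by
      simpa using (isHomogeneous_C (Fin 3) (M i j)).mul (isHomogeneous_X ℂ j)
  simpa [subst] using this

lemma pullFun_mem {d : ℕ} (M : Matrix (Fin 3) (Fin 3) ℂ) {ω : Fin 3 → Poly}
    (hω : ω ∈ formSpace d) : pullFun M ω ∈ formSpace d := by
  refine ⟨fun j => IsHomogeneous.sum _ _ _ fun i _ => by
    simpa using (isHomogeneous_C (Fin 3) (M i j)).mul (subst_isHomogeneous M (hω.1 i)), ?_⟩
  have h := congrArg (subst M) hω.2
  simp only [map_sum, map_mul, subst_X, map_zero, Finset.sum_mul] at h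
  rw [Finset.sum_comm] at h
  rw [← h]
  simp only [pullFun, Finset.mul_sum]
  refine Finset.sum_congr rfl fun k _ => Finset.sum_congr rfl fun i _ => ?_
  ring

/-- The pullback of 1-forms under the linear map `v ↦ M v`, as a linear map of `formSpace d`. -/
def pull (d : ℕ) (M : Matrix (Fin 3) (Fin 3) ℂ) : formSpace d →ₗ[ℂ] formSpace d where
  toFun ω := ⟨pullFun M ω, pullFun_mem M ω.2⟩
  map_add' ω η := by
    ext1
    funext j
    simp [pullFun, mul_add, Finset.sum_add_distrib]
  map_smul' c ω := by
    ext1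
    funext j
    simp [pullFun, Finset.smul_sum]

/-- `GL₃(ℂ)` acts linearly on 1-forms by `g • ω = (g⁻¹)^* ω`. -/
instance instActionForms (d : ℕ) : DistribMulAction (GL (Fin 3) ℂ) (formSpace d) where
  smul g ω := pull d (g⁻¹).1 ω
  one_smul ω := by
    refine Subtype.ext ?_
    change pullFun ((1 : GL (Fin 3) ℂ)⁻¹).1 ω = ω
    simpa using pullFun_one (ω : Fin 3 → Poly)
  mul_smul g h ω := by
    refine Subtype.ext ?_
    change pullFun ((g * h)⁻¹).1 ω = pullFun (g⁻¹).1 (pullFun (h⁻¹).1 ω)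
    rw [← pullFun_mul, mul_inv_rev]
    rfl
  smul_zero g := map_zero (pull d (g⁻¹).1)
  smul_add g := map_add (pull d (g⁻¹).1)

lemma coe_smul_form {d : ℕ} (g : GL (Fin 3) ℂ) (ω : formSpace d) :
    ((g • ω : formSpace d) : Fin 3 → Poly) = pullFun (g⁻¹).1 ω := rfl

instance instCommForms (d : ℕ) : SMulCommClass (GL (Fin 3) ℂ) ℂ (formSpace d) where
  smul_comm g c ω := map_smul (pull d (g⁻¹).1) c ω

/-! ### The space of foliations of degree `d` and the action of `PGL₃(ℂ)` -/

/-- The coefficients of the 1-form have no common factor. -/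
def Saturated (ω : Fin 3 → Poly) : Prop := ∀ q : Poly, (∀ i, q ∣ ω i) → IsUnit q

lemma Saturated.smul {ω : Fin 3 → Poly} (h : Saturated ω) {c : ℂ} (hc : c ≠ 0) :
    Saturated (c • ω) := by
  intro q hq
  refine h q fun i => ?_
  have := (hq i).mul_left (C c⁻¹)
  rwa [Pi.smul_apply, smul_eq_C_mul, ← mul_assoc, ← C_mul, inv_mul_cancel₀ hc, C_1, one_mul]
    at this

lemma Saturated.pullFun {ω : Fin 3 → Poly} (h : Saturated ω) (g : GL (Fin 3) ℂ) :
    Saturated (pullFun g.1 ω) := by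
  intro q hq
  have h1 : IsUnit (subst (g⁻¹).1 q) := by
    refine h _ fun i => ?_
    have : ω i = PlaneFoliation.pullFun (g⁻¹).1 (PlaneFoliation.pullFun g.1 ω) i := by
      rw [← pullFun_mul, ← Units.val_mul, mul_inv_cancel, Units.val_one, pullFun_one]
    rw [this]
    exact Finset.dvd_sum fun j _ => ((map_dvd (subst (g⁻¹).1) (hq j)).mul_left _)
  have h2 := h1.map (subst g.1)
  rwa [← subst_mul, ← Units.val_mul, inv_mul_cancel, Units.val_one, subst_one] at h2

/-- The point `[ω]` of the projective space of 1-forms is represented by a saturated form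
(equivalently, all its representatives are saturated). -/
def IsFol {d : ℕ} (p : ℙ ℂ (formSpace d)) : Prop := Saturated (p.rep : Fin 3 → Poly)

lemma isFol_mk {d : ℕ} {ω : formSpace d} (h0 : ω ≠ 0) :
    IsFol (Projectivization.mk ℂ ω h0) ↔ Saturated (ω : Fin 3 → Poly) := by
  obtain ⟨c, hc⟩ := Projectivization.exists_smul_eq_mk_rep ℂ ω h0
  unfold IsFol
  rw [← hc]
  constructor
  · intro h
    have := h.smul (c := ((c⁻¹ : ℂˣ) : ℂ)) (c⁻¹).ne_zero
    simpa [Units.smul_def, smul_smul] using this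
  · intro h
    exact h.smul c.ne_zero

lemma Saturated.ne_zero {d : ℕ} {ω : formSpace d} (h : Saturated (ω : Fin 3 → Poly)) :
    ω ≠ 0 := by
  rintro rfl
  exact not_isUnit_zero (h 0 fun i => by simp)

/-- `Foliation d` is the set `F(d)` of foliations of degree `d` on the complex projective plane,
as a subset of the projective space of `formSpace d`. -/
def Foliation (d : ℕ) : Type := {p : ℙ ℂ (formSpace d) // IsFol p}

/-- The foliation defined by a homogeneous 1-form without common factor. -/
def Foliation.ofForm {d : ℕ} (ω : formSpace d) (h : Saturated (ω : Fin 3 → Poly)) :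
    Foliation d := ⟨Projectivization.mk ℂ ω h.ne_zero, (isFol_mk _).2 h⟩

lemma IsFol.smul {d : ℕ} {p : ℙ ℂ (formSpace d)} (h : IsFol p) (g : GL (Fin 3) ℂ) :
    IsFol (g • p) := by
  induction p using Projectivization.ind with
  | h ω h0 =>
    rw [Projectivization.smul_mk, isFol_mk]
    exact ((isFol_mk h0).1 h).pullFun g⁻¹

/-- `GL₃(ℂ)` acts on `F(d)` by `g • F = (g⁻¹)^* F`. -/
instance instActionGL (d : ℕ) : MulAction (GL (Fin 3) ℂ) (Foliation d) where
  smul g F := ⟨g • F.1, F.2.smul g⟩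
  one_smul F := Subtype.ext (one_smul _ F.1)
  mul_smul g h F := Subtype.ext (mul_smul g h F.1)

lemma val_smul {d : ℕ} (g : GL (Fin 3) ℂ) (F : Foliation d) : (g • F).1 = g • F.1 := rfl

lemma pullFun_scalar {d : ℕ} (c : ℂ) {ω : Fin 3 → Poly} (hω : ω ∈ formSpace d) :
    pullFun (Matrix.scalar (Fin 3) c) ω = c ^ (d + 2) • ω := by
  have key : ∀ (n : ℕ) (p : Poly), p.IsHomogeneous n →
      subst (Matrix.scalar (Fin 3) c) p = c ^ n • p := by
    intro n p hp
    have h1 : (fun i => ∑ j, C (Matrix.scalar (Fin 3) c i j) * X j : Fin 3 → Poly) =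
        fun i => C c * X i := by
      funext i
      simp [Matrix.diagonal_apply, apply_ite C]
    rw [subst, h1]
    conv_lhs => rw [p.as_sum]
    conv_rhs => rw [p.as_sum]
    rw [map_sum, Finset.smul_sum]
    refine Finset.sum_congr rfl fun m hm => ?_
    have hdeg : ∑ i ∈ m.support, m i = n := by
      have := hp (mem_support_iff.1 hm)
      rw [Finsupp.weight_apply, Finsupp.sum] at this
      simpa only [Pi.one_apply, smul_eq_mul, mul_one] using this
    rw [aeval_monomial, Finsupp.prod]
    simp only [mul_pow, Finset.prod_mul_distrib, Finset.prod_pow_eq_pow_sum, hdeg]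
    rw [monomial_eq, Finsupp.prod, smul_eq_C_mul, C_pow, algebraMap_eq]
    ring
  funext j
  simp only [pullFun, key _ _ (hω.1 _), Pi.smul_apply]
  simp [Matrix.diagonal_apply, smul_eq_C_mul, apply_ite C]
  ring

lemma scalar_smul {d : ℕ} (u : ℂˣ) (F : Foliation d) :
    Matrix.GeneralLinearGroup.scalar (Fin 3) u • F = F := by
  refine Subtype.ext ?_
  rw [val_smul]
  generalize F.1 = p
  induction p using Projectivization.ind with
  | h ω h0 =>
    rw [Projectivization.smul_mk, Projectivization.mk_eq_mk_iff]
    refine ⟨u⁻¹ ^ (d + 2), Subtype.ext ?_⟩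
    rw [coe_smul_form, ← map_inv]
    have := pullFun_scalar ((u⁻¹ : ℂˣ) : ℂ) ω.2
    rw [← Matrix.GeneralLinearGroup.coe_scalar] at this
    rw [this]
    simp [Units.smul_def]

/-- The action of `Aut(ℙ²) = PGL₃(ℂ)` on `F(d)` by `φ • F = (φ⁻¹)^* F`, where `φ = [g]` acts on
`ℙ²` by `[v] ↦ [g v]`. Since `φ` and `φ⁻¹` run through the same group, the orbit
`{φ^* F | φ}` of `F` is `MulAction.orbit`, and the isotropy group `{φ | φ^* F = F}` is
`MulAction.stabilizer`. -/
instance instActionPGL (d : ℕ) : MulAction (PGL(3, ℂ)) (Foliation d) :=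
  Matrix.ProjGenLinGroup.mulActionOfGL scalar_smul

/-- The orbit of a foliation under `Aut(ℙ²)`. -/
abbrev orbit {d : ℕ} (F : Foliation d) : Set (Foliation d) := MulAction.orbit (PGL(3, ℂ)) F

/-- The isotropy group of a foliation. -/
abbrev Iso {d : ℕ} (F : Foliation d) : Subgroup (PGL(3, ℂ)) :=
  MulAction.stabilizer (PGL(3, ℂ)) F

/-! ### Zariski topology and dimension in a complex projective space -/

section ProjectiveSpace

variable {E : Type*} [AddCommGroup E] [Module ℂ E]

/-- A subset of `ℙ(E)` is Zariski closed if it is the set of common zeros of a family of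
homogeneous polynomials in the linear forms on `E`. -/
def IsZariskiClosed (Z : Set (ℙ ℂ E)) : Prop :=
  ∃ T : Set (MvPolynomial (Module.Dual ℂ E) ℂ),
    (∀ P ∈ T, ∃ n, P.IsHomogeneous n) ∧
    ∀ p : ℙ ℂ E, p ∈ Z ↔ ∀ P ∈ T, eval (fun ℓ : Module.Dual ℂ E => ℓ p.rep) P = 0

/-- `S ⊆ ℙ(E)` contains an immersed complex manifold of dimension `k`: there is a holomorphic
immersion `u ↦ [f u]` from a non-empty open subset of `ℂᵏ` to `ℙ(E)` with values in `S`.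
Holomorphy and derivatives of the lift `f` are read through the linear forms on `E`. The tangent
space of `ℙ(E)` at `[f u]` is `E / ℂ f u`, so `u ↦ [f u]` is an immersion at `u` if and only if
the derivative of `f` at `u` sends no non-zero vector into `ℂ f u`. -/
def ContainsManifold (S : Set (ℙ ℂ E)) (k : ℕ) : Prop :=
  ∃ (U : Set (Fin k → ℂ)) (f : (Fin k → ℂ) → E), IsOpen U ∧ U.Nonempty ∧
    (∀ ℓ : Module.Dual ℂ E, DifferentiableOn ℂ (fun u => ℓ (f u)) U) ∧
    (∀ u ∈ U, ∃ h : f u ≠ 0, Projectivization.mk ℂ (f u) h ∈ S) ∧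
    ∀ u ∈ U, ∀ (v : Fin k → ℂ) (c : ℂ),
      (∀ ℓ : Module.Dual ℂ E, fderiv ℂ (fun w => ℓ (f w)) u v = c * ℓ (f u)) → v = 0

/-- The dimension of a non-empty constructible subset of `ℙ(E)`: the largest dimension of a
complex manifold contained in it. -/
def projDim (S : Set (ℙ ℂ E)) : ℕ∞ := ⨆ (k : ℕ) (_ : ContainsManifold S k), (k : ℕ∞)

end ProjectiveSpace

/-- A set of foliations is closed in `F(d)`, with the Zariski topology induced from the
projective space of 1-forms. -/
def IsClosedInFol {d : ℕ} (A : Set (Foliation d)) : Prop :=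
  ∃ Z : Set (ℙ ℂ (formSpace d)), IsZariskiClosed Z ∧ ∀ F : Foliation d, F ∈ A ↔ F.1 ∈ Z

/-- The dimension of the orbit of `F`, as a subset of the projective space of 1-forms. -/
def orbitDim {d : ℕ} (F : Foliation d) : ℕ∞ := projDim {p | ∃ G ∈ orbit F, G.1 = p}

/-- The dimension of an algebraic subgroup of `PGL₃(ℂ)`, where `PGL₃(ℂ)` is viewed as an open
subset of the projective space of `3 × 3` matrices. -/
def groupDim (H : Subgroup (PGL(3, ℂ))) : ℕ∞ :=
  projDim {p : ℙ ℂ (Matrix (Fin 3) (Fin 3) ℂ) |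
    ∃ g : GL (Fin 3) ℂ, Matrix.ProjGenLinGroup.mk g ∈ H ∧
      p = Projectivization.mk ℂ (g : Matrix (Fin 3) (Fin 3) ℂ) g.ne_zero}

/-! ### The foliations `F₁` and `F₂` -/

lemma saturated_of_X_pow {ω : Fin 3 → Poly} {i : Fin 3} {n : ℕ} (v : Fin 3 → ℂ) (hv : v 0 = 0)
    (h1 : ω i ∣ X 0 ^ n) (j : Fin 3) (h2 : eval v (ω j) ≠ 0) : Saturated ω := by
  intro q hq
  obtain ⟨k, -, hk⟩ := (dvd_prime_pow (X_prime (R := ℂ) (i := (0 : Fin 3))) n).1 ((hq i).trans h1)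
  rcases Nat.eq_zero_or_pos k with rfl | hpos
  · exact associated_one_iff_isUnit.1 (by simpa using hk)
  · exfalso
    have h3 : (X 0 : Poly) ∣ ω j := (dvd_pow_self _ hpos.ne').trans (hk.symm.dvd.trans (hq j))
    obtain ⟨r, hr⟩ := h3
    exact h2 (by simp [hr, hv])

lemma isHomogeneous_mul_X_pow (i j : Fin 3) (d : ℕ) :
    (X i ^ d * X j : Poly).IsHomogeneous (d + 1) := by
  simpa using ((isHomogeneous_X ℂ i).pow d).mul (isHomogeneous_X ℂ j)

/-- The homogenization
`(y^d z - x^d y) dx + x^(d+1) dy - y^d x dz` of `y^d dx + x^d (x dy - y dx)`. -/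
def form₁ (d : ℕ) : formSpace d :=
  ⟨![X 1 ^ d * X 2 - X 0 ^ d * X 1, X 0 ^ d * X 0, -(X 1 ^ d * X 0)], by
    refine ⟨fun i => ?_, ?_⟩
    · fin_cases i
      · exact (isHomogeneous_mul_X_pow 1 2 d).sub (isHomogeneous_mul_X_pow 0 1 d)
      · exact isHomogeneous_mul_X_pow 0 0 d
      · exact (isHomogeneous_mul_X_pow 1 0 d).neg
    · simp [Fin.sum_univ_three]
      ring⟩

/-- The homogenization
`(x^d z - y^(d+1)) dx + y^d x dy - x^(d+1) dz` of `x^d dx + y^d (x dy - y dx)`. -/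
def form₂ (d : ℕ) : formSpace d :=
  ⟨![X 0 ^ d * X 2 - X 1 ^ d * X 1, X 1 ^ d * X 0, -(X 0 ^ d * X 0)], by
    refine ⟨fun i => ?_, ?_⟩
    · fin_cases i
      · exact (isHomogeneous_mul_X_pow 0 2 d).sub (isHomogeneous_mul_X_pow 1 1 d)
      · exact isHomogeneous_mul_X_pow 1 0 d
      · exact (isHomogeneous_mul_X_pow 0 0 d).neg
    · simp [Fin.sum_univ_three]
      ring⟩

lemma form₁_saturated (d : ℕ) : Saturated (form₁ d : Fin 3 → Poly) := by
  refine saturated_of_X_pow (i := 1) (n := d + 1) ![0, 1, 2] rfl ?_ 0 ?_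
  · simp [form₁, pow_succ]
  · rcases Nat.eq_zero_or_pos d with rfl | h
    · simp [form₁]
      norm_num
    · simp [form₁, h.ne']

lemma form₂_saturated (d : ℕ) : Saturated (form₂ d : Fin 3 → Poly) := by
  refine saturated_of_X_pow (i := 2) (n := d + 1) ![0, 1, 0] rfl ?_ 0 ?_
  · simp [form₂, pow_succ]
  · simp [form₂]

/-- The foliation defined in the affine chart `z = 1` by `y^d dx + x^d (x dy - y dx)`. -/
def F₁ (d : ℕ) : Foliation d := Foliation.ofForm (form₁ d) (form₁_saturated d)

/-- The foliation defined in the affine chart `z = 1` by `x^d dx + y^d (x dy - y dx)`. -/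
def F₂ (d : ℕ) : Foliation d := Foliation.ofForm (form₂ d) (form₂_saturated d)

/-- `φ` is the projective transformation given in the affine chart `z = 1` by
`(x, y) ↦ (a x / (1 + β x), b y / (1 + β x))`, that is, `[x : y : z] ↦ [a x : b y : z + β x]`. -/
def IsAffineMap (φ : PGL(3, ℂ)) (a b β : ℂ) : Prop :=
  ∃ g : GL (Fin 3) ℂ, (g : Matrix (Fin 3) (Fin 3) ℂ) = !![a, 0, 0; 0, b, 0; β, 0, 1] ∧
    φ = Matrix.ProjGenLinGroup.mk g

end PlaneFoliation

end

/-!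
# Foliations of the projective plane with an isotropy group of dimension two

Everything is read off the infinitesimal isotropy. A matrix `A` is regarded as the linear vector
field `v ↦ A v` on `ℂ³`, and `annih ω` is the Lie algebra of those `A` with vanishing Lie derivative
`lie A ω`. The radial field acts on forms of degree `d` by the scalar `d + 2`, so `annih ω` is
isomorphic to the Lie algebra of the isotropy group of the foliation in `PGL₃(ℂ)`. Contraction of
`ω` with a non-radial linear field is never zero, because a saturated form of degree `d ≥ 2` cannot
be proportional to a non-zero form of degree one (`exists_eq_smul_one_of_con_eq_zero`).

*Classification* (`isConjModel_of_two_le_finrank`). If `annih ω` has dimension at least two, it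
contains independent `D`, `N` with `[D, N] = l N`. For `l ≠ 0` the field `N` is nilpotent. Rank two
is impossible by a parity argument with weights (`not_shift_and_diagonal_mem_annih`). If `N` has
rank one, it becomes `x ∂/∂z`, the form becomes `g (z dx - x dz) + k (x dy - y dx)` with `g`, `k`
binary forms in `x`, `y`, and the second field forces `g`, `k` to be monomials after a linear change
of coordinates; being coprime, they are `x ^ d` and `y ^ d` in one of the two orders
(`isConjModel_of_lowerLeft`). For `l = 0` the two contractions are first integrals of both fields,
which forces the two fields and the radial one to be dependent at each point
(`det_eq_zero_of_commute`); then some combination of them is again nilpotent of rank one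
(`isConjModel_of_commute`).

*The models.* The annihilators of `form₁ d` and `form₂ d` are spanned by a diagonal field and
`x ∂/∂z`. An element of the isotropy group normalizes the annihilator, which leaves only
`(a x : b y : z + β x)` (`entries_of_pullFun_eq`), and a comparison of coefficients gives the two
groups. They are not conjugate, since `diag(1, ζ, 1)`, with `ζ` a primitive root of unity of order
`d + 1`, is in the second group and has eigenvalues which do not occur in the first
(`eigenvalues_ne`).

*Closedness.* By the classification the union of the two orbits is the set where the minors of size
`8` of `A ↦ lie A ω` vanish. The orbits are separated by the conjugation invariant quadratic form
`traceForm` on the annihilator, and Cramer's rule (`cramerMat`) describes the elements of the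
annihilator by polynomials in `ω`, so that the vanishing of `traceForm` on the annihilator is a
polynomial condition (`isClosedInFol_of_traceForm`).

*Dimensions.* Differentiating along a manifold in the isotropy group bounds its dimension by that of
the annihilator (`le_finrank_annih_of_containsManifold`). In the other direction, `u ↦ M(u)^* ω`,
for an affine family of matrices `M(u)` transversal to the isotropy, is a manifold of dimension
`8 - dim (annih ω)` in the orbit (`containsManifold_orbit`). The upper bound `6` for the two models
is the delicate point, since a manifold in the orbit comes without a lift to the group. Along it the
minors of size `8` vanish, and their derivative shows that each tangent vector is infinitesimally
fixed by the annihilator, modulo the tangent space `{lie A ω}` (`lieForm_mem_range_of_curve`). For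
the two models such vectors belong to the tangent space (`IsRigid`): the torus reduces them to forms
of weight zero, of which there are very few.
-/

noncomputable section

namespace PlaneFoliation

open MvPolynomial

/-! ### Linear vector fields and Lie derivatives of 1-forms -/

/-- Complex `3 × 3` matrices, read as linear vector fields `v ↦ A v` on `ℂ³`. -/
abbrev Mat : Type := Matrix (Fin 3) (Fin 3) ℂ

/-- The `k`-th coordinate of `A v`, as a linear form in `v`. -/
def linForm (A : Mat) (k : Fin 3) : Poly := ∑ l, C (A k l) * X l

/-- The derivation of the polynomial ring along the linear vector field `v ↦ A v`. -/
def vf (A : Mat) : Derivation ℂ Poly Poly := mkDerivation ℂ (linForm A)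

lemma linForm_isHomogeneous (A : Mat) (k : Fin 3) : (linForm A k).IsHomogeneous 1 :=
  IsHomogeneous.sum _ _ _ fun j _ => by
    simpa using (isHomogeneous_C (Fin 3) (A k j)).mul (isHomogeneous_X ℂ j)

lemma linForm_mul (A B : Mat) (k : Fin 3) :
    linForm (A * B) k = ∑ l, C (A k l) * linForm B l := by
  simp only [linForm, Matrix.mul_apply, map_sum, C_mul, Finset.sum_mul, Finset.mul_sum]
  rw [Finset.sum_comm]
  simp only [mul_assoc]

lemma linForm_add (A B : Mat) (k : Fin 3) : linForm (A + B) k = linForm A k + linForm B k := by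
  simp [linForm, add_mul, Finset.sum_add_distrib]

lemma linForm_smul (c : ℂ) (A : Mat) (k : Fin 3) : linForm (c • A) k = C c * linForm A k := by
  simp [linForm, Finset.mul_sum, mul_assoc]

lemma linForm_one (k : Fin 3) : linForm 1 k = X k := by
  simp [linForm, Matrix.one_apply, apply_ite C]

lemma vf_X (A : Mat) (k : Fin 3) : vf A (X k) = linForm A k := mkDerivation_X _ _ _

lemma vf_C (A : Mat) (c : ℂ) : vf A (C c) = 0 := derivation_C _ _

lemma vf_mul (A : Mat) (p q : Poly) : vf A (p * q) = vf A p * q + p * vf A q := by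
  rw [Derivation.leibniz]
  simp only [smul_eq_mul]
  ring

lemma vf_apply (A : Mat) (p : Poly) : vf A p = ∑ k, linForm A k * pderiv k p := by
  have h : vf A = ∑ k, linForm A k • pderiv k := by
    refine derivation_ext fun i => ?_
    fin_cases i <;> simp [vf_X, Fin.sum_univ_three]
  simp [h, Fin.sum_univ_three]

lemma vf_add (A B : Mat) (p : Poly) : vf (A + B) p = vf A p + vf B p := by
  simp only [vf_apply, linForm_add, add_mul, Finset.sum_add_distrib]

lemma vf_smul (c : ℂ) (A : Mat) (p : Poly) : vf (c • A) p = C c * vf A p := by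
  simp only [vf_apply, linForm_smul, Finset.mul_sum, mul_assoc]

lemma vf_one {p : Poly} {n : ℕ} (hp : p.IsHomogeneous n) : vf 1 p = C (n : ℂ) * p := by
  simp only [vf_apply, linForm_one]
  rw [hp.sum_X_mul_pderiv]
  simp

lemma vf_isHomogeneous (A : Mat) {p : Poly} {n : ℕ} (hp : p.IsHomogeneous n) :
    (vf A p).IsHomogeneous n := by
  rcases Nat.eq_zero_or_pos n with rfl | hn
  · rw [← totalDegree_zero_iff_isHomogeneous, totalDegree_eq_zero_iff_eq_C] at hp
    rw [hp, vf_C]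
    exact isHomogeneous_zero _ _ _
  · rw [vf_apply]
    refine IsHomogeneous.sum _ _ _ fun k _ => ?_
    have := (linForm_isHomogeneous A k).mul (hp.pderiv (i := k))
    rwa [show 1 + (n - 1) = n by omega] at this

lemma vf_comm (A B : Mat) (p : Poly) :
    vf A (vf B p) - vf B (vf A p) = vf (B * A - A * B) p := by
  have h : ⁅vf A, vf B⁆ = vf (B * A - A * B) := by
    refine derivation_ext fun i => ?_
    rw [Derivation.commutator_apply, vf_X, vf_X, vf_X, sub_eq_add_neg (B * A), linForm_add,
      ← neg_one_smul ℂ (A * B), linForm_smul, linForm_mul, linForm_mul]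
    simp [linForm, vf_X, sub_eq_add_neg]
  rw [← h, Derivation.commutator_apply]

/-- The Lie derivative of the 1-form `∑ j, ω j dxⱼ` along the linear vector field `v ↦ A v`. -/
def lie (A : Mat) (ω : Fin 3 → Poly) : Fin 3 → Poly :=
  fun j => ∑ i, C (A i j) * ω i + vf A (ω j)

/-- The Lie derivative along linear vector fields, as a linear map in the vector field. -/
def lieLeft (ω : Fin 3 → Poly) : Mat →ₗ[ℂ] (Fin 3 → Poly) where
  toFun A := lie A ω
  map_add' A B := by
    funext j
    simp only [lie, vf_add, Matrix.add_apply, C_add, add_mul, Finset.sum_add_distrib, Pi.add_apply]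
    ring
  map_smul' c A := by
    funext j
    simp only [lie, vf_smul, Matrix.smul_apply, smul_eq_mul, C_mul, Pi.smul_apply,
      RingHom.id_apply, smul_eq_C_mul, mul_add, Finset.mul_sum, mul_assoc]

/-- The Lie algebra of the linear vector fields `A` which annihilate the 1-form `ω`. -/
def annih (ω : Fin 3 → Poly) : Submodule ℂ Mat := LinearMap.ker (lieLeft ω)

lemma mem_annih {ω : Fin 3 → Poly} {A : Mat} : A ∈ annih ω ↔ lie A ω = 0 := Iff.rfl

lemma lie_add_left (A B : Mat) (ω : Fin 3 → Poly) : lie (A + B) ω = lie A ω + lie B ω :=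
  (lieLeft ω).map_add A B

lemma lie_smul_left (c : ℂ) (A : Mat) (ω : Fin 3 → Poly) : lie (c • A) ω = c • lie A ω :=
  (lieLeft ω).map_smul c A

/-- The Lie derivative along a linear vector field, as an endomorphism of the space of forms. -/
def lieRight (A : Mat) : (Fin 3 → Poly) →ₗ[ℂ] (Fin 3 → Poly) where
  toFun ω := lie A ω
  map_add' ω η := by
    funext j
    simp only [lie, map_add, Pi.add_apply, mul_add, Finset.sum_add_distrib]
    ring
  map_smul' c ω := by
    funext j
    simp only [lie, Pi.smul_apply, smul_eq_C_mul, vf_mul, vf_C, RingHom.id_apply, mul_add,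
      Finset.mul_sum]
    rw [zero_mul, zero_add]
    congr 1
    exact Finset.sum_congr rfl fun i _ => by ring

lemma lie_smul (A : Mat) (c : ℂ) (ω : Fin 3 → Poly) : lie A (c • ω) = c • lie A ω :=
  (lieRight A).map_smul c ω

lemma lie_zero (A : Mat) : lie A 0 = 0 := (lieRight A).map_zero

/-- Euler's relation: the radial field acts on `formSpace d` by a scalar, which is `d + 2` since
`dx`, `dy`, `dz` have weight one. -/
lemma lie_one {d : ℕ} {ω : Fin 3 → Poly} (hω : ω ∈ formSpace d) :
    lie 1 ω = ((d : ℂ) + 2) • ω := by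
  funext j
  rw [lie, vf_one (hω.1 j), Pi.smul_apply, smul_eq_C_mul]
  rw [show (C ((d : ℂ) + 2) : Poly) = C ((d + 1 : ℕ) : ℂ) + 1 by
    rw [← C_1, ← C_add]
    push_cast
    ring_nf]
  simp [Matrix.one_apply, apply_ite C]
  ring

/-- The Lie derivative is an anti-representation of the Lie algebra of matrices, since the bracket
of the vector fields `A`, `B` is the vector field of `B A - A B`. -/
lemma lie_comm (A B : Mat) (ω : Fin 3 → Poly) :
    lie A (lie B ω) - lie B (lie A ω) = lie (B * A - A * B) ω := by
  funext j
  have h := vf_comm A B (ω j)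
  simp only [lie, Pi.sub_apply, map_add, vf_mul, vf_C, ← h, Fin.sum_univ_three,
    Matrix.sub_apply, Matrix.mul_apply, C_sub, C_mul]
  ring

lemma commutator_mem_annih {ω : Fin 3 → Poly} {A B : Mat} (hA : A ∈ annih ω) (hB : B ∈ annih ω) :
    A * B - B * A ∈ annih ω := by
  rw [mem_annih] at *
  rw [← lie_comm, hA, hB, lie_zero, lie_zero, sub_zero]

lemma lie_mem {d : ℕ} (A : Mat) {ω : Fin 3 → Poly} (hω : ω ∈ formSpace d) :
    lie A ω ∈ formSpace d := by
  refine ⟨fun j => ?_, ?_⟩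
  · refine (IsHomogeneous.sum _ _ _ fun i _ => ?_).add (vf_isHomogeneous A (hω.1 j))
    simpa using (isHomogeneous_C (Fin 3) (A i j)).mul (hω.1 i)
  · have h := congrArg (vf A) hω.2
    simp only [Fin.sum_univ_three, map_add, vf_mul, map_zero, vf_X, linForm] at h
    simp only [lie, Fin.sum_univ_three]
    rw [← h]
    ring

/-! ### Compatibility with linear substitutions -/

lemma subst_linForm (P A : Mat) (i : Fin 3) : subst P (linForm A i) = linForm (A * P) i := by
  rw [linForm_mul]
  simp only [linForm, map_sum, map_mul, subst_C, subst_X]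

lemma vf_subst {P A A' : Mat} (h : P * A' = A * P) (p : Poly) :
    vf A' (subst P p) = subst P (vf A p) := by
  induction p using MvPolynomial.induction_on with
  | C a => rw [subst_C, vf_C, vf_C, map_zero]
  | add p q hp hq => simp only [map_add, hp, hq]
  | mul_X p i hp =>
    rw [map_mul, vf_mul, vf_mul, map_add, map_mul, map_mul, hp, vf_X, subst_linForm, ← h,
      linForm_mul]
    simp only [subst_X, map_sum, vf_mul, vf_C, vf_X, zero_mul, zero_add]

/-- Naturality of the Lie derivative. The relation `P A' = A P` says that `v ↦ P v` relates the
vector fields of `A'` and `A`; it makes sense without an inverse of `P`. -/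
lemma lie_pullFun {P A A' : Mat} (h : P * A' = A * P) (ω : Fin 3 → Poly) :
    lie A' (pullFun P ω) = pullFun P (lie A ω) := by
  funext j
  have h' : ∀ k, P k 0 * A' 0 j + P k 1 * A' 1 j + P k 2 * A' 2 j =
      A k 0 * P 0 j + A k 1 * P 1 j + A k 2 * P 2 j := fun k => by
    have := congrFun (congrFun h k) j
    simpa only [Matrix.mul_apply, Fin.sum_univ_three] using this
  have e : ∀ k, C (P k 0) * C (A' 0 j) + C (P k 1) * C (A' 1 j) + C (P k 2) * C (A' 2 j) =
      (C (A k 0) * C (P 0 j) + C (A k 1) * C (P 1 j) + C (A k 2) * C (P 2 j) : Poly) := fun k => by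
    simp only [← C_mul, ← C_add, h' k]
  simp only [lie, pullFun, vf_mul, vf_C, vf_subst h, map_add, map_mul, subst_C,
    Fin.sum_univ_three]
  linear_combination subst P (ω 0) * e 0 + subst P (ω 1) * e 1 + subst P (ω 2) * e 2

lemma pullFun_smul (P : Mat) (c : ℂ) (ω : Fin 3 → Poly) :
    pullFun P (c • ω) = c • pullFun P ω := by
  funext j
  simp [pullFun, Finset.smul_sum]

lemma pullFun_zero (P : Mat) : pullFun P 0 = 0 := by
  funext j
  simp [pullFun]

/-- Multiplication of 1-forms by a non-zero constant does not change the annihilator. -/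
lemma annih_smul {c : ℂ} (hc : c ≠ 0) (ω : Fin 3 → Poly) : annih (c • ω) = annih ω := by
  ext A
  rw [mem_annih, mem_annih, lie_smul, smul_eq_zero_iff_right hc]

lemma mem_annih_pullFun {P A A' : Mat} (h : P * A' = A * P) {ω : Fin 3 → Poly}
    (hA : A ∈ annih ω) : A' ∈ annih (pullFun P ω) := by
  rw [mem_annih] at *
  rw [lie_pullFun h, hA, pullFun_zero]

/-- The annihilator of the pullback under `P` is the conjugate by `P⁻¹` of the annihilator. -/
lemma mem_annih_pullFun_iff {P A A' : Mat} (hP : IsUnit P) (h : P * A' = A * P)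
    {ω : Fin 3 → Poly} : A' ∈ annih (pullFun P ω) ↔ A ∈ annih ω := by
  refine ⟨fun hA => ?_, mem_annih_pullFun h⟩
  obtain ⟨P, rfl⟩ := hP
  have h' : (P⁻¹).1 * A = A' * (P⁻¹).1 := by
    calc (P⁻¹).1 * A = (P⁻¹).1 * (A * P.1) * (P⁻¹).1 := by simp [mul_assoc]
      _ = A' * (P⁻¹).1 := by simp [← h, ← mul_assoc]
  have := mem_annih_pullFun h' hA
  rwa [← pullFun_mul, ← Units.val_mul, mul_inv_cancel, Units.val_one, pullFun_one] at this

/-! ### Contraction with linear vector fields -/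

/-- The contraction `ω(A v)` of a 1-form with the linear vector field `v ↦ A v`. -/
def con (A : Mat) (ω : Fin 3 → Poly) : Poly := ∑ k, ω k * linForm A k

lemma con_add (A B : Mat) (ω : Fin 3 → Poly) : con (A + B) ω = con A ω + con B ω := by
  simp [con, linForm_add, mul_add, Finset.sum_add_distrib]

lemma con_smul (c : ℂ) (A : Mat) (ω : Fin 3 → Poly) : con (c • A) ω = C c * con A ω := by
  simp only [con, linForm_smul, Finset.mul_sum]
  exact Finset.sum_congr rfl fun i _ => by ring

lemma con_sub_smul (c : ℂ) (A B : Mat) (ω : Fin 3 → Poly) :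
    con (A - c • B) ω = con A ω - C c * con B ω := by
  rw [sub_eq_add_neg, ← neg_smul, con_add, con_smul, C_neg, neg_mul, sub_eq_add_neg]

lemma con_isHomogeneous {d : ℕ} (A : Mat) {ω : Fin 3 → Poly} (hω : ω ∈ formSpace d) :
    (con A ω).IsHomogeneous (d + 2) :=
  IsHomogeneous.sum _ _ _ fun k _ => (hω.1 k).mul (linForm_isHomogeneous A k)

/-- The Leibniz rule `L_A (ω(B)) = (L_A ω)(B) + ω([A, B])`, when the first term vanishes. The
bracket of the vector fields is the field of `B A - A B`. -/
lemma vf_con {A : Mat} {ω : Fin 3 → Poly} (hA : A ∈ annih ω) (B : Mat) :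
    vf A (con B ω) = con (B * A - A * B) ω := by
  have h : ∀ k, vf A (ω k) = -(∑ i, C (A i k) * ω i) := fun k =>
    eq_neg_of_add_eq_zero_right (congrFun (mem_annih.1 hA) k)
  rw [← one_smul ℂ (A * B), con_sub_smul]
  simp only [con, linForm_mul, Fin.sum_univ_three, map_add, vf_mul, h]
  simp only [linForm, Fin.sum_univ_three, map_add, vf_mul, vf_C, vf_X, C_1]
  ring

/-! ### Saturated forms -/

/-- If `p` divides all the `ω j * q`, then it divides `q`, as the `ω j` have greatest common divisor
one. -/
lemma Saturated.dvd_of_dvd_mul {ω : Fin 3 → Poly} (h : Saturated ω) {p q : Poly}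
    (hpq : ∀ j, p ∣ ω j * q) : p ∣ q := by
  classical
  let _ : GCDMonoid Poly := UniqueFactorizationMonoid.toGCDMonoid Poly
  have hu : IsUnit (gcd (ω 0) (gcd (ω 1) (ω 2))) := by
    refine h _ fun i => ?_
    fin_cases i
    · exact gcd_dvd_left _ _
    · exact (gcd_dvd_right _ _).trans (gcd_dvd_left _ _)
    · exact (gcd_dvd_right _ _).trans (gcd_dvd_right _ _)
  have h1 : p ∣ gcd (ω 0 * q) (gcd (ω 1) (ω 2) * q) :=
    dvd_gcd (hpq 0) ((dvd_gcd (hpq 1) (hpq 2)).trans (gcd_mul_right' q _ _).dvd)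
  exact (hu.dvd_mul_left).1 (h1.trans (gcd_mul_right' q _ _).dvd)

lemma eval_linForm (A : Mat) (k : Fin 3) (v : Fin 3 → ℂ) :
    eval v (linForm A k) = ∑ l, A k l * v l := by
  simp [linForm]

/-- A saturated form of degree at least `2` is not proportional to one of degree `1`. Hence no
linear vector field other than the multiples of the radial one is tangent to the foliation. -/
lemma exists_eq_smul_one_of_con_eq_zero {d : ℕ} (hd : 2 ≤ d) {ω : Fin 3 → Poly}
    (hω : ω ∈ formSpace d) (hs : Saturated ω) {A : Mat} (hA : con A ω = 0) :
    ∃ c : ℂ, A = c • (1 : Mat) := by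
  -- `w = v × A v`, so that `ω × w = 0`
  set w : Fin 3 → Poly := ![X 1 * linForm A 2 - X 2 * linForm A 1,
    X 2 * linForm A 0 - X 0 * linForm A 2, X 0 * linForm A 1 - X 1 * linForm A 0] with hw
  have h1 : X 0 * ω 0 + X 1 * ω 1 + X 2 * ω 2 = 0 := by
    simpa [Fin.sum_univ_three] using hω.2
  have h2 : ω 0 * linForm A 0 + ω 1 * linForm A 1 + ω 2 * linForm A 2 = 0 := by
    simpa [con, Fin.sum_univ_three] using hA
  have h01 : ω 0 * w 1 = ω 1 * w 0 := by
    simp only [hw, Matrix.cons_val]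
    linear_combination X 2 * h2 - linForm A 2 * h1
  have h02 : ω 0 * w 2 = ω 2 * w 0 := by
    simp only [hw, Matrix.cons_val]
    linear_combination -X 1 * h2 + linForm A 1 * h1
  have h12 : ω 1 * w 2 = ω 2 * w 1 := by
    simp only [hw, Matrix.cons_val]
    linear_combination X 0 * h2 - linForm A 0 * h1
  have hww : ∀ i j, ω i * w j = ω j * w i := by
    intro i j
    fin_cases i <;> fin_cases j <;> simp [h01, h02, h12]
  have hX : ∀ i j, (X i * linForm A j : Poly).IsHomogeneous 2 := fun i j =>
    (isHomogeneous_X ℂ i).mul (linForm_isHomogeneous A j)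
  have hwhom : ∀ i, (w i).IsHomogeneous 2 := by
    intro i
    fin_cases i <;> exact (hX _ _).sub (hX _ _)
  have hw0 : ∀ i, w i = 0 := by
    intro i
    by_contra hne
    have hdvd : ω i ∣ w i := hs.dvd_of_dvd_mul fun j => ⟨w j, (hww i j).symm⟩
    have hne' : ω i ≠ 0 := fun h0 => hne (by simpa [h0] using hdvd)
    have := totalDegree_le_of_dvd_of_isDomain hdvd hne
    rw [(hω.1 i).totalDegree hne', (hwhom i).totalDegree hne] at this
    omega
  have ev : ∀ (v : Fin 3 → ℂ) i, eval v (w i) = 0 := fun v i => by rw [hw0 i, map_zero]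
  have e0 := ev ![1, 0, 0]
  have e1 := ev ![0, 1, 0]
  have e2 := ev ![0, 0, 1]
  have f1 := ev ![1, 1, 0] 2
  have f2 := ev ![1, 0, 1] 1
  have a0 := e0 1
  have a1 := e0 2
  have a2 := e1 0
  have a3 := e1 2
  have a4 := e2 0
  have a5 := e2 1
  simp [hw, eval_linForm, Fin.sum_univ_three] at a0 a1 a2 a3 a4 a5 f1 f2
  refine ⟨A 0 0, ?_⟩
  have b1 : A 1 1 = A 0 0 := by linear_combination f1 - a1 + a3
  have b2 : A 2 2 = A 0 0 := by linear_combination -f2 - a0 + a5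
  ext i j
  fin_cases i <;> fin_cases j <;> simp [*]

lemma eq_zero_of_smul_one_mem_annih {d : ℕ} {ω : Fin 3 → Poly} (hω : ω ∈ formSpace d) (h0 : ω ≠ 0)
    {c : ℂ} (hc : c • (1 : Mat) ∈ annih ω) : c = 0 := by
  rw [mem_annih, lie_smul_left, lie_one hω, smul_smul, smul_eq_zero_iff_left h0] at hc
  refine (mul_eq_zero.1 hc).resolve_right ?_
  exact_mod_cast (by omega : d + 2 ≠ 0)

lemma Saturated.ne_zero' {ω : Fin 3 → Poly} (h : Saturated ω) : ω ≠ 0 := by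
  rintro rfl
  exact not_isUnit_zero (h 0 fun i => by simp)

lemma con_ne_zero {d : ℕ} (hd : 2 ≤ d) {ω : Fin 3 → Poly} (hω : ω ∈ formSpace d)
    (hs : Saturated ω) {A : Mat} (hA : A ∈ annih ω) (h0 : A ≠ 0) : con A ω ≠ 0 := by
  intro hc
  obtain ⟨c, rfl⟩ := exists_eq_smul_one_of_con_eq_zero hd hω hs hc
  exact h0 (by rw [eq_zero_of_smul_one_mem_annih hω hs.ne_zero' hA, zero_smul])

/-! ### Polynomial lemmas -/

lemma eq_zero_of_pow_X_dvd {p : Poly} (i : Fin 3) (h : ∀ n : ℕ, X i ^ n ∣ p) : p = 0 := by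
  by_contra h0
  have := totalDegree_le_of_dvd_of_isDomain (h (p.totalDegree + 1)) h0
  rw [totalDegree_X_pow] at this
  omega

/-- For `i ≠ j` the operator `X i ∂/∂X j` is locally nilpotent, so that its sum with a non-zero
constant is injective: a solution is divisible by all powers of `X i`. -/
lemma eq_zero_of_add_X_mul_pderiv {i j : Fin 3} (hij : i ≠ j) {c b : ℂ} (hc : c ≠ 0) {p : Poly}
    (h : C c * p + C b * X i * pderiv j p = 0) : p = 0 := by
  refine eq_zero_of_pow_X_dvd i fun n => ?_
  induction n with
  | zero => simp
  | succ n ih =>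
    obtain ⟨q, rfl⟩ := ih
    have hcc : (C c⁻¹ * C c : Poly) = 1 := by rw [← C_mul, inv_mul_cancel₀ hc, C_1]
    have hd : pderiv j (X i ^ n * q : Poly) = X i ^ n * pderiv j q := by
      rw [pderiv_mul, pderiv_pow, pderiv_X_of_ne hij]
      ring
    rw [hd] at h
    refine ⟨-(C c⁻¹ * C b * pderiv j q), ?_⟩
    linear_combination C c⁻¹ * h - X i ^ n * q * hcc

lemma coeff_X_mul_pderiv (p : Poly) (i : Fin 3) (m : Fin 3 →₀ ℕ) :
    coeff m (X i * pderiv i p) = m i * coeff m p := by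
  classical
  induction p using MvPolynomial.induction_on' with
  | add p q hp hq => simp [hp, hq, mul_add]
  | monomial n a =>
    rw [X_mul_pderiv_monomial, coeff_smul, coeff_monomial, nsmul_eq_mul]
    split_ifs with h
    · rw [h]
    · simp

lemma sum_eq_of_coeff_ne_zero {p : Poly} {n : ℕ} (hp : p.IsHomogeneous n) {m : Fin 3 →₀ ℕ}
    (hm : coeff m p ≠ 0) : m 0 + m 1 + m 2 = n := by
  have := hp hm
  rw [Finsupp.weight_apply, Finsupp.sum_fintype _ _ (by simp)] at this
  simpa [Fin.sum_univ_three] using this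

lemma isHomogeneous_of_mul_X {p : Poly} {n : ℕ} (i : Fin 3) (h : (p * X i).IsHomogeneous (n + 1)) :
    p.IsHomogeneous n := by
  intro m hm
  have := h (d := m + Finsupp.single i 1) (by rwa [coeff_mul_X])
  rw [map_add, Finsupp.weight_single] at this
  simpa using this

/-- An eigenvector of the derivation `a x ∂/∂x + b y ∂/∂y`, where `a ≠ b`, among the binary forms
in `x`, `y`, is a monomial. -/
lemma exists_eq_monomial {d : ℕ} {p : Poly} (hp : p.IsHomogeneous d) (h2 : pderiv 2 p = 0)
    {a b s : ℂ} (hab : a ≠ b)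
    (h : C a * (X 0 * pderiv 0 p) + C b * (X 1 * pderiv 1 p) = C s * p) :
    ∃ (c : ℂ) (i j : ℕ), i + j = d ∧ p = C c * (X 0 ^ i * X 1 ^ j) := by
  by_cases h0 : p = 0
  · exact ⟨0, 0, d, by simp, by simp [h0]⟩
  have key : ∀ m, coeff m p ≠ 0 → m 2 = 0 ∧ m 0 + m 1 = d ∧ a * m 0 + b * m 1 = s := by
    intro m hm
    have e1 : m 2 = 0 := by
      have := coeff_X_mul_pderiv p 2 m
      rw [h2, mul_zero, coeff_zero, eq_comm, mul_eq_zero] at this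
      exact_mod_cast this.resolve_right hm
    refine ⟨e1, by simpa [e1] using sum_eq_of_coeff_ne_zero hp hm, ?_⟩
    have := congrArg (coeff m) h
    rw [coeff_add, coeff_C_mul, coeff_C_mul, coeff_C_mul, coeff_X_mul_pderiv,
      coeff_X_mul_pderiv] at this
    exact mul_right_cancel₀ hm (by linear_combination this)
  obtain ⟨m, hm⟩ := ne_zero_iff.1 h0
  obtain ⟨m2, md, ms⟩ := key m hm
  refine ⟨coeff m p, m 0, m 1, md, ?_⟩
  have hmon : p = monomial m (coeff m p) := by
    ext n
    rw [coeff_monomial]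
    split_ifs with hmn
    · rw [hmn]
    · by_contra hn
      obtain ⟨n2, nd, ns⟩ := key n hn
      have hmd : (m 0 : ℂ) + m 1 = d := by exact_mod_cast md
      have hnd : (n 0 : ℂ) + n 1 = d := by exact_mod_cast nd
      have h3 : (a - b) * ((n 0 : ℂ) - m 0) = 0 := by
        linear_combination ns - ms - b * hnd + b * hmd
      have h4 : n 0 = m 0 := by
        exact_mod_cast sub_eq_zero.1 ((mul_eq_zero.1 h3).resolve_left (sub_ne_zero.2 hab))
      refine hmn (Finsupp.ext fun i => ?_)
      fin_cases i
      · exact h4.symm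
      · change m 1 = n 1
        omega
      · change m 2 = n 2
        omega
  conv_lhs => rw [hmon]
  rw [monomial_eq, Finsupp.prod_fintype _ _ (by simp)]
  simp [Fin.prod_univ_three, m2]

/-! ### Forms invariant under a nilpotent vector field of rank one -/

/-- The linear vector field `x ∂/∂z`. -/
def lowerLeft : Mat := !![0, 0, 0; 0, 0, 0; 1, 0, 0]

/-- The 1-form `g (z dx - x dz) + k (x dy - y dx)`. -/
def twoForm (g k : Poly) : Fin 3 → Poly := ![g * X 2 - k * X 1, k * X 0, -(g * X 0)]

lemma lie_lowerLeft (ω : Fin 3 → Poly) : lie lowerLeft ω =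
    ![ω 2 + X 0 * pderiv 2 (ω 0), X 0 * pderiv 2 (ω 1), X 0 * pderiv 2 (ω 2)] := by
  funext j
  fin_cases j <;> simp [lie, vf_apply, linForm, lowerLeft, Fin.sum_univ_three]

/-- The forms annihilated by `x ∂/∂z`: the coefficients `g` and `k` do not depend on `z`. -/
lemma exists_eq_twoForm {d : ℕ} {ω : Fin 3 → Poly} (hω : ω ∈ formSpace d)
    (h : lowerLeft ∈ annih ω) : ∃ g k : Poly, g.IsHomogeneous d ∧ k.IsHomogeneous d ∧
      pderiv 2 g = 0 ∧ pderiv 2 k = 0 ∧ ω = twoForm g k := by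
  rw [mem_annih, lie_lowerLeft] at h
  have hX : (X 0 : Poly) ≠ 0 := X_ne_zero 0
  have h0 : ω 2 + X 0 * pderiv 2 (ω 0) = 0 := by simpa using congrFun h 0
  have h1 : pderiv 2 (ω 1) = 0 := by simpa using congrFun h 1
  have h2 : pderiv 2 (ω 2) = 0 := by simpa using congrFun h 2
  have he : X 0 * ω 0 + X 1 * ω 1 + X 2 * ω 2 = 0 := by
    simpa [Fin.sum_univ_three] using hω.2
  set g := pderiv 2 (ω 0)
  have hdvd : (X 0 : Poly) ∣ ω 1 := by
    have : (X 0 : Poly) ∣ X 1 * ω 1 := ⟨X 2 * g - ω 0, by linear_combination he - X 2 * h0⟩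
    refine ((X_prime (R := ℂ) (i := (0 : Fin 3))).dvd_or_dvd this).resolve_left fun h => ?_
    exact absurd (X_dvd_X.1 h) (by decide)
  obtain ⟨k, hk⟩ := hdvd
  have hω0 : ω 0 = g * X 2 - k * X 1 := by
    refine mul_left_cancel₀ hX ?_
    linear_combination he - X 2 * h0 - X 1 * hk
  refine ⟨g, k, ?_, ?_, ?_, ?_, ?_⟩
  · simpa using (hω.1 0).pderiv (i := 2)
  · refine isHomogeneous_of_mul_X 0 ?_
    rw [mul_comm, ← hk]
    exact hω.1 1
  · have : ω 2 = -(X 0 * g) := by linear_combination h0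
    rw [this, map_neg, neg_eq_zero, pderiv_mul, pderiv_X_of_ne (by decide), zero_mul,
      zero_add] at h2
    exact (mul_eq_zero.1 h2).resolve_left hX
  · rw [hk, pderiv_mul, pderiv_X_of_ne (by decide), zero_mul, zero_add] at h1
    exact (mul_eq_zero.1 h1).resolve_left hX
  · funext j
    fin_cases j
    · simpa [twoForm] using hω0
    · simp [twoForm, hk, mul_comm]
    · simp only [twoForm]
      change ω 2 = -(g * X 0)
      linear_combination h0

lemma twoForm_dvd {q g k : Poly} (hg : q ∣ g) (hk : q ∣ k) (i : Fin 3) : q ∣ twoForm g k i := by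
  fin_cases i
  · exact dvd_sub (hg.mul_right _) (hk.mul_right _)
  · exact hk.mul_right _
  · exact (hg.mul_right _).neg_right

lemma not_isUnit_X (i : Fin 3) : ¬ IsUnit (X i : Poly) := (X_prime (R := ℂ) (i := i)).not_isUnit

/-- The two components of the equation `lie A ω = 0` for `ω = g (z dx - x dz) + k (x dy - y dx)`
and a lower triangular `A`. -/
lemma lie_twoForm {g k : Poly} {A : Mat} (h01 : A 0 1 = 0) (h02 : A 0 2 = 0) (h12 : A 1 2 = 0)
    (h : A ∈ annih (twoForm g k)) :
    vf A g + C (A 0 0 + A 2 2) * g = 0 ∧ vf A k + C (A 0 0 + A 1 1) * k = C (A 2 1) * g := by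
  rw [mem_annih] at h
  have hX : (X 0 : Poly) ≠ 0 := X_ne_zero 0
  have hl : linForm A 0 = C (A 0 0) * X 0 := by simp [linForm, Fin.sum_univ_three, h01, h02]
  have h1 := congrFun h 1
  have h2 := congrFun h 2
  simp only [lie, Fin.sum_univ_three, h01, h02, h12, C_0, twoForm, Matrix.cons_val, Pi.zero_apply,
    map_neg, vf_mul, vf_X, hl] at h1 h2
  constructor <;> refine mul_left_cancel₀ hX ?_ <;> rw [C_add]
  · linear_combination -h2
  · linear_combination h1

/-- `ω` is linearly conjugate, up to a non-zero factor, to one of the forms `form₁ d`, `form₂ d`. -/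
def IsConjModel (d : ℕ) (ω : Fin 3 → Poly) : Prop :=
  ∃ (P : Mat) (c : ℂ), IsUnit P ∧ c ≠ 0 ∧
    (ω = c • pullFun P (form₁ d) ∨ ω = c • pullFun P (form₂ d))

lemma IsConjModel.of_pullFun {d : ℕ} {P : Mat} (hP : IsUnit P) {ω : Fin 3 → Poly}
    (h : IsConjModel d (pullFun P ω)) : IsConjModel d ω := by
  obtain ⟨P, rfl⟩ := hP
  obtain ⟨R, c, hR, hc, h⟩ := h
  have hω : ω = pullFun (P⁻¹).1 (pullFun P.1 ω) := by
    rw [← pullFun_mul, ← Units.val_mul, mul_inv_cancel, Units.val_one, pullFun_one]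
  refine ⟨R * (P⁻¹).1, c, hR.mul (P⁻¹).isUnit, hc, ?_⟩
  rw [pullFun_mul, pullFun_mul, ← pullFun_smul _ _ (pullFun R (form₁ d)),
    ← pullFun_smul _ _ (pullFun R (form₂ d))]
  exact h.imp (fun h => by rwa [← h]) (fun h => by rwa [← h])

/-- The form is `e` times the pullback of `form₁ d` under the substitution `z ↦ (c z - α y) / e`. -/
lemma isConjModel_twoForm₁ (d : ℕ) {c e : ℂ} (hc : c ≠ 0) (he : e ≠ 0) (α : ℂ) :
    IsConjModel d (twoForm (C c * X 1 ^ d) (C α * X 1 ^ d + C e * X 0 ^ d)) := by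
  refine ⟨!![1, 0, 0; 0, 1, 0; 0, -α / e, c / e], e, ?_, he, Or.inl ?_⟩
  · rw [Matrix.isUnit_iff_isUnit_det]
    simp [Matrix.det_fin_three, hc, he]
  · have e1 : (C e * C (-α / e) : Poly) = -C α := by
      rw [← C_mul, ← C_neg]
      congr 1
      field_simp
    have e2 : (C e * C (c / e) : Poly) = C c := by
      rw [← C_mul]
      congr 1
      field_simp
    funext j
    rw [Pi.smul_apply, smul_eq_C_mul]
    fin_cases j <;>
      simp only [twoForm, pullFun, form₁, Fin.sum_univ_three, map_sub, map_mul, map_pow, map_neg,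
        subst_X, Matrix.of_apply, Matrix.cons_val, Fin.isValue, Fin.zero_eta, Fin.mk_one,
        Fin.reduceFinMk, C_0, C_1]
    · linear_combination -(X 1 ^ d * X 1) * e1 - (X 1 ^ d * X 2) * e2
    · linear_combination (X 1 ^ d * X 0) * e1
    · linear_combination (X 1 ^ d * X 0) * e2

/-- The form is `e` times the pullback of `form₂ d` under the substitution `z ↦ (c z - α y) / e`. -/
lemma isConjModel_twoForm₂ (d : ℕ) {c e : ℂ} (hc : c ≠ 0) (he : e ≠ 0) (α : ℂ) :
    IsConjModel d (twoForm (C c * X 0 ^ d) (C α * X 0 ^ d + C e * X 1 ^ d)) := by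
  refine ⟨!![1, 0, 0; 0, 1, 0; 0, -α / e, c / e], e, ?_, he, Or.inr ?_⟩
  · rw [Matrix.isUnit_iff_isUnit_det]
    simp [Matrix.det_fin_three, hc, he]
  · have e1 : (C e * C (-α / e) : Poly) = -C α := by
      rw [← C_mul, ← C_neg]
      congr 1
      field_simp
    have e2 : (C e * C (c / e) : Poly) = C c := by
      rw [← C_mul]
      congr 1
      field_simp
    funext j
    rw [Pi.smul_apply, smul_eq_C_mul]
    fin_cases j <;>
      simp only [twoForm, pullFun, form₂, Fin.sum_univ_three, map_sub, map_mul, map_pow, map_neg,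
        subst_X, Matrix.of_apply, Matrix.cons_val, Fin.isValue, Fin.zero_eta, Fin.mk_one,
        Fin.reduceFinMk, C_0, C_1]
    · linear_combination -(X 0 ^ d * X 1) * e1 - (X 0 ^ d * X 2) * e2
    · linear_combination (X 0 ^ d * X 0) * e1
    · linear_combination (X 0 ^ d * X 0) * e2

lemma vf_of_pderiv_two {A : Mat} (h01 : A 0 1 = 0) (h02 : A 0 2 = 0) (h12 : A 1 2 = 0) {p : Poly}
    (hp : pderiv 2 p = 0) : vf A p = C (A 0 0) * (X 0 * pderiv 0 p) +
      C (A 1 1) * (X 1 * pderiv 1 p) + C (A 1 0) * X 0 * pderiv 1 p := by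
  simp only [vf_apply, linForm, Fin.sum_univ_three, h01, h02, h12, hp, C_0]
  ring

lemma euler_of_pderiv_two {d : ℕ} {p : Poly} (h : p.IsHomogeneous d) (hp : pderiv 2 p = 0) :
    X 0 * pderiv 0 p + X 1 * pderiv 1 p = C (d : ℂ) * p := by
  have := h.sum_X_mul_pderiv
  rw [Fin.sum_univ_three, hp, mul_zero, add_zero] at this
  rw [this]
  simp

lemma X_zero_dvd_of_dvd_pderiv {d : ℕ} (hd : d ≠ 0) {p : Poly} (h : p.IsHomogeneous d)
    (hp : pderiv 2 p = 0) (h1 : X 0 ∣ pderiv 1 p) : X 0 ∣ p := by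
  have h2 : X 0 ∣ C (d : ℂ) * p := by
    rw [← euler_of_pderiv_two h hp]
    exact (Dvd.intro _ rfl).add (h1.mul_left _)
  refine (IsUnit.dvd_mul_left ?_).1 h2
  exact (isUnit_iff_ne_zero.2 (Nat.cast_ne_zero.2 hd)).map C

lemma not_dvd_of_saturated_twoForm {d : ℕ} (hd : d ≠ 0) {g k q : Poly} (hq : q.IsHomogeneous d)
    (hs : Saturated (twoForm g k)) (hg : q ∣ g) (hk : q ∣ k) : False := by
  have hu := hs q (twoForm_dvd hg hk)
  have h1 := hq.totalDegree hu.ne_zero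
  obtain ⟨r, hr⟩ := hu.exists_right_inv
  have h2 := totalDegree_le_of_dvd_of_isDomain ⟨r, hr.symm⟩ one_ne_zero
  rw [totalDegree_one] at h2
  omega

/-- The case of a diagonal action on the `(x, y)`-plane with distinct eigenvalues: both coefficients
of the form are monomials after a change of the coordinate `z`. -/
lemma isConjModel_twoForm_of_ne {d : ℕ} (hd : 2 ≤ d) {g k : Poly} (hg : g.IsHomogeneous d)
    (hk : k.IsHomogeneous d) (hg2 : pderiv 2 g = 0) (hk2 : pderiv 2 k = 0)
    (hs : Saturated (twoForm g k)) {A : Mat} (h01 : A 0 1 = 0) (h02 : A 0 2 = 0) (h12 : A 1 2 = 0)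
    (h10 : A 1 0 = 0) (hA : A ∈ annih (twoForm g k)) (hne : A 0 0 ≠ A 1 1) :
    IsConjModel d (twoForm g k) := by
  obtain ⟨E1, E2⟩ := lie_twoForm h01 h02 h12 hA
  rw [vf_of_pderiv_two h01 h02 h12 hg2, h10, C_0] at E1
  rw [vf_of_pderiv_two h01 h02 h12 hk2, h10, C_0] at E2
  have E1' : C (A 0 0) * (X 0 * pderiv 0 g) + C (A 1 1) * (X 1 * pderiv 1 g) =
      C (-(A 0 0 + A 2 2)) * g := by
    rw [C_neg]
    linear_combination E1
  obtain ⟨α, hα⟩ : ∃ α : ℂ,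
      C (A 0 0) * (X 0 * pderiv 0 (k - C α * g)) + C (A 1 1) * (X 1 * pderiv 1 (k - C α * g)) =
        C (-(A 0 0 + A 1 1)) * (k - C α * g) := by
    by_cases h : A 1 1 = A 2 2
    · refine ⟨0, ?_⟩
      have h0 : C (A 2 1) * g = 0 := by
        -- resonance: the operator acting on `k` is diagonal and vanishes on the monomials of `g`
        ext m
        rw [coeff_zero, coeff_C_mul]
        by_contra hm
        have hm' := right_ne_zero_of_mul hm
        have e1 := congrArg (coeff m) E1'
        have e2 := congrArg (coeff m) E2
        simp only [coeff_add, coeff_C_mul, coeff_X_mul_pderiv, zero_mul, add_zero] at e1 e2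
        have e3 : A 0 0 * (m 0) + A 1 1 * (m 1) = -(A 0 0 + A 1 1) :=
          mul_right_cancel₀ hm' (by rw [h]; rw [h] at e1; linear_combination e1)
        exact hm (by linear_combination -e2 + coeff m k * e3)
      rw [h0] at E2
      simp only [C_0, zero_mul, sub_zero, C_neg]
      linear_combination E2
    · refine ⟨A 2 1 / (A 1 1 - A 2 2), ?_⟩
      have h0 : (C (A 2 1 / (A 1 1 - A 2 2)) * (C (A 1 1) - C (A 2 2)) : Poly) = C (A 2 1) := by
        rw [← C_sub, ← C_mul, div_mul_cancel₀ _ (sub_ne_zero.2 h)]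
      rw [map_sub, map_sub, pderiv_C_mul, pderiv_C_mul, C_neg, C_add]
      rw [C_add] at E1 E2
      linear_combination E2 - C (A 2 1 / (A 1 1 - A 2 2)) * E1 - g * h0
  obtain ⟨c, i, j, hij, hgm⟩ := exists_eq_monomial hg hg2 hne E1'
  obtain ⟨e, i', j', hij', hkm⟩ := exists_eq_monomial (p := k - C α * g)
    (hk.sub (by simpa using (isHomogeneous_C (Fin 3) α).mul hg))
    (by rw [map_sub, pderiv_C_mul, hg2, hk2, mul_zero, sub_zero]) hne hα
  have hkk : k = C α * g + C e * (X 0 ^ i' * X 1 ^ j') := by linear_combination hkm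
  have key : ∀ l : Fin 3, X l ∣ g → X l ∣ C e * (X 0 ^ i' * X 1 ^ j' : Poly) → False := by
    intro l h1 h2
    refine not_isUnit_X l (hs _ (twoForm_dvd h1 ?_))
    rw [hkk]
    exact (h1.mul_left _).add h2
  have d0 : ∀ (a : ℂ) (m n : ℕ), m ≠ 0 → (X 0 : Poly) ∣ C a * (X 0 ^ m * X 1 ^ n) :=
    fun a m n h => ((dvd_pow_self _ h).mul_right _).mul_left _
  have d1 : ∀ (a : ℂ) (m n : ℕ), n ≠ 0 → (X 1 : Poly) ∣ C a * (X 0 ^ m * X 1 ^ n) :=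
    fun a m n h => ((dvd_pow_self _ h).mul_left _).mul_left _
  have hc : c ≠ 0 := by
    rintro rfl
    have hg0 : g = 0 := by simpa using hgm
    by_cases hi : i' = 0
    · exact key 1 (hg0 ▸ dvd_zero _) (d1 _ _ _ (by omega))
    · exact key 0 (hg0 ▸ dvd_zero _) (d0 _ _ _ hi)
  have he : e ≠ 0 := by
    rintro rfl
    by_cases hi : i = 0
    · exact key 1 (hgm ▸ d1 _ _ _ (by omega)) (by simp)
    · exact key 0 (hgm ▸ d0 _ _ _ hi) (by simp)
  have k0 : i = 0 ∨ i' = 0 := by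
    by_contra h
    push Not at h
    exact key 0 (hgm ▸ d0 _ _ _ h.1) (d0 _ _ _ h.2)
  have k1 : j = 0 ∨ j' = 0 := by
    by_contra h
    push Not at h
    exact key 1 (hgm ▸ d1 _ _ _ h.1) (d1 _ _ _ h.2)
  rcases k0 with hi | hi
  · obtain rfl : j = d := by omega
    obtain rfl : j' = 0 := by omega
    obtain rfl : i' = j := by omega
    have := isConjModel_twoForm₁ i' hc he (α * c)
    rw [hi, pow_zero, one_mul] at hgm
    rw [pow_zero, mul_one, hgm, ← mul_assoc, ← C_mul] at hkk
    rwa [hgm, hkk]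
  · obtain rfl : j' = d := by omega
    obtain rfl : j = 0 := by omega
    obtain rfl : i = j' := by omega
    have := isConjModel_twoForm₂ i hc he (α * c)
    rw [pow_zero, mul_one] at hgm
    rw [hi, pow_zero, one_mul, hgm, ← mul_assoc, ← C_mul] at hkk
    rwa [hgm, hkk]

/-- If the eigenvalues on the `(x, y)`-plane coincide, then `A = 0`: otherwise `g` would divide `k`
or `x` would divide both. -/
lemma eq_zero_of_mem_annih_twoForm {d : ℕ} (hd : 2 ≤ d) {g k : Poly} (hg : g.IsHomogeneous d)
    (hk : k.IsHomogeneous d) (hg2 : pderiv 2 g = 0) (hk2 : pderiv 2 k = 0)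
    (hs : Saturated (twoForm g k)) {A : Mat} (h01 : A 0 1 = 0) (h02 : A 0 2 = 0) (h12 : A 1 2 = 0)
    (h20 : A 2 0 = 0) (hA : A ∈ annih (twoForm g k)) (heq : A 1 1 = A 0 0) : A = 0 := by
  have hd0 : d ≠ 0 := by omega
  obtain ⟨E1, E2⟩ := lie_twoForm h01 h02 h12 hA
  rw [vf_of_pderiv_two h01 h02 h12 hg2, heq] at E1
  rw [vf_of_pderiv_two h01 h02 h12 hk2, heq] at E2
  have eg := euler_of_pderiv_two hg hg2
  have ek := euler_of_pderiv_two hk hk2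
  have hg0 : g ≠ 0 := fun h0 =>
    not_dvd_of_saturated_twoForm hd0 hk hs (h0 ▸ dvd_zero k) dvd_rfl
  have hgk : ¬ g ∣ k := not_dvd_of_saturated_twoForm hd0 hg hs dvd_rfl
  have F1 : C (d * A 0 0 + A 0 0 + A 2 2) * g + C (A 1 0) * X 0 * pderiv 1 g = 0 := by
    simp only [C_add, C_mul] at E1 ⊢
    linear_combination E1 - C (A 0 0) * eg
  have F2 : C ((d + 2) * A 0 0) * k + C (A 1 0) * X 0 * pderiv 1 k = C (A 2 1) * g := by
    have : (C 2 : Poly) = 1 + 1 := by rw [← C_1, ← C_add]; norm_num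
    simp only [C_add, C_mul, this] at E2 ⊢
    linear_combination E2 - C (A 0 0) * ek
  -- the eigenvalue on `k` vanishes, since otherwise `k` would be a multiple of `g`
  have ha : (pderiv 1 g = 0 ∨ A 1 0 = 0) → A 0 0 = 0 := by
    intro h1
    by_contra ha
    have hne : ((d : ℂ) + 2) * A 0 0 ≠ 0 :=
      mul_ne_zero (by exact_mod_cast (by omega : d + 2 ≠ 0)) ha
    have h0 : (C ((d + 2) * A 0 0) * C (A 2 1 / ((d + 2) * A 0 0)) : Poly) = C (A 2 1) := by
      rw [← C_mul, mul_div_cancel₀ _ hne]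
    have h2 : C (A 1 0) * pderiv 1 g = 0 := by
      rcases h1 with h1 | h1 <;> simp [h1]
    have := eq_zero_of_add_X_mul_pderiv (i := 0) (j := 1) (by decide) hne (b := A 1 0)
      (p := k - C (A 2 1 / ((d + 2) * A 0 0)) * g) (by
        rw [map_sub, pderiv_C_mul]
        linear_combination F2 - g * h0 - C (A 2 1 / ((d + 2) * A 0 0)) * X 0 * h2)
    exact hgk ⟨_, (sub_eq_zero.1 this).trans (mul_comm _ _)⟩
  by_cases h10 : A 1 0 = 0
  · have h00 := ha (Or.inr h10)
    have h22 : A 2 2 = 0 := by simpa [h10, h00, hg0] using F1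
    have h21 : A 2 1 = 0 := by
      have : C (A 2 1) * g = 0 := by
        rw [← F2]
        simp [h10, h00]
      simpa [hg0] using this
    ext i j
    fin_cases i <;> fin_cases j <;> simp [*]
  · exfalso
    have hC : (C (A 1 0) : Poly) ≠ 0 := by simpa using h10
    have hX : (X 0 : Poly) ≠ 0 := X_ne_zero 0
    have hsum : (d : ℂ) * A 0 0 + A 0 0 + A 2 2 = 0 := by
      by_contra h
      exact hg0 (eq_zero_of_add_X_mul_pderiv (by decide) h F1)
    have hg1 : pderiv 1 g = 0 := by simpa [hsum, h10] using F1
    have h00 := ha (Or.inl hg1)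
    obtain ⟨g', hg'⟩ := X_zero_dvd_of_dvd_pderiv hd0 hg hg2 (hg1 ▸ dvd_zero _)
    have hg'h : g'.IsHomogeneous (d - 1) := by
      refine isHomogeneous_of_mul_X 0 ?_
      rwa [mul_comm, ← hg', Nat.sub_add_cancel (by omega)]
    have hg'2 : pderiv 2 g' = 0 := by
      simpa [hg', pderiv_mul, pderiv_X_of_ne] using hg2
    have hg'1 : pderiv 1 g' = 0 := by
      simpa [hg', pderiv_mul, pderiv_X_of_ne] using hg1
    have h3 := X_zero_dvd_of_dvd_pderiv (by omega) hg'h hg'2 (hg'1 ▸ dvd_zero _)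
    have h4 : C (A 1 0) * pderiv 1 k = C (A 2 1) * g' := by
      refine mul_left_cancel₀ hX ?_
      rw [h00, mul_zero, C_0] at F2
      linear_combination F2 + C (A 2 1) * hg'
    have h5 : X 0 ∣ pderiv 1 k := by
      have : X 0 ∣ C (A 1 0) * pderiv 1 k := h4 ▸ h3.mul_left _
      exact (IsUnit.dvd_mul_left ((isUnit_iff_ne_zero.2 h10).map C)).1 this
    exact not_isUnit_X 0 (hs _ (twoForm_dvd ⟨g', hg'⟩ (X_zero_dvd_of_dvd_pderiv hd0 hk hk2 h5)))

lemma sub_smul_mem_annih {ω : Fin 3 → Poly} {A B : Mat} (hA : A ∈ annih ω) (hB : B ∈ annih ω)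
    (t : ℂ) : A - t • B ∈ annih ω := sub_mem hA (Submodule.smul_mem _ _ hB)

/-- The case of `x ∂/∂z` and a second field `A` which is lower triangular, that is, which normalizes
`x ∂/∂z`. -/
lemma isConjModel_of_lowerLeft {d : ℕ} (hd : 2 ≤ d) {ω : Fin 3 → Poly} (hω : ω ∈ formSpace d)
    (hs : Saturated ω) (hN : lowerLeft ∈ annih ω) {A : Mat} (hA : A ∈ annih ω) (h01 : A 0 1 = 0)
    (h02 : A 0 2 = 0) (h12 : A 1 2 = 0) (hne : ∀ t : ℂ, A ≠ t • lowerLeft) :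
    IsConjModel d ω := by
  have hB := sub_smul_mem_annih hA hN (A 2 0)
  set B := A - A 2 0 • lowerLeft with hBdef
  have hB0 : B ≠ 0 := sub_ne_zero.2 (hne _)
  have b : B = !![A 0 0, 0, 0; A 1 0, A 1 1, 0; 0, A 2 1, A 2 2] := by
    ext i j
    fin_cases i <;> fin_cases j <;> simp [lowerLeft, *]
  by_cases heq : A 1 1 = A 0 0
  · obtain ⟨g, k, hg, hk, hg2, hk2, rfl⟩ := exists_eq_twoForm hω hN
    exact absurd (eq_zero_of_mem_annih_twoForm hd hg hk hg2 hk2 hs (by simp [b]) (by simp [b])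
      (by simp [b]) (by simp [b]) hB (by simpa [b] using heq)) hB0
  · -- a shear in the `(x, y)`-plane diagonalizes the action on it
    set s := A 1 0 / (A 0 0 - A 1 1) with hsdef
    have hsub : A 0 0 - A 1 1 ≠ 0 := sub_ne_zero.2 fun h => heq h.symm
    have hs' : s * (A 0 0 - A 1 1) = A 1 0 := div_mul_cancel₀ _ hsub
    set P : Mat := !![1, 0, 0; s, 1, 0; 0, 0, 1] with hP
    have hPu : IsUnit P := by
      rw [Matrix.isUnit_iff_isUnit_det]
      simp [hP, Matrix.det_fin_three]
    refine IsConjModel.of_pullFun hPu ?_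
    have hs2 : Saturated (pullFun P ω) := by
      obtain ⟨P', hP'⟩ := hPu
      rw [← hP']
      exact hs.pullFun P'
    have hN' : lowerLeft ∈ annih (pullFun P ω) := by
      refine mem_annih_pullFun ?_ hN
      ext i j
      fin_cases i <;> fin_cases j <;> simp [hP, lowerLeft, Matrix.mul_apply, Fin.sum_univ_three]
    have hB' : !![A 0 0, 0, 0; 0, A 1 1, 0; A 2 1 * s, A 2 1, A 2 2] ∈ annih (pullFun P ω) := by
      refine mem_annih_pullFun ?_ hB
      ext i j
      fin_cases i <;> fin_cases j <;>
        simp [hP, b, Matrix.mul_apply, Fin.sum_univ_three]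
      linear_combination hs'
    obtain ⟨g, k, hg, hk, hg2, hk2, he⟩ := exists_eq_twoForm (pullFun_mem P hω) hN'
    rw [he] at hs2 hB' ⊢
    exact isConjModel_twoForm_of_ne hd hg hk hg2 hk2 hs2 (by simp) (by simp) (by simp) (by simp)
      hB' (by simpa using fun h => heq h.symm)

/-! ### Normal forms of matrices -/

/-- The matrix with columns `u`, `v`, `w`. -/
def ofCols (u v w : Fin 3 → ℂ) : Mat := Matrix.of fun i j => ![u, v, w] j i

lemma ofCols_mulVec (u v w x : Fin 3 → ℂ) :
    (ofCols u v w).mulVec x = x 0 • u + x 1 • v + x 2 • w := by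
  funext i
  simp [ofCols, Matrix.mulVec, dotProduct, Fin.sum_univ_three]
  ring

lemma isUnit_of_mulVec_eq_zero {P : Mat} (h : ∀ x, P.mulVec x = 0 → x = 0) : IsUnit P := by
  rw [← Matrix.mulVec_injective_iff_isUnit]
  intro x y hxy
  have := h (x - y) (by rw [Matrix.mulVec_sub]; exact sub_eq_zero.2 hxy)
  exact sub_eq_zero.1 this

lemma eq_of_mulVec_eq {A B : Mat} (h : ∀ v, A.mulVec v = B.mulVec v) : A = B :=
  Matrix.toLin'.injective (LinearMap.ext fun v => by simpa using h v)

lemma exists_conj {P : Mat} (hP : IsUnit P) (A : Mat) : ∃ A' : Mat, P * A' = A * P := by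
  obtain ⟨P, rfl⟩ := hP
  exact ⟨(P⁻¹).1 * (A * P.1), by simp [← mul_assoc]⟩

lemma exists_mulVec_ne_zero {A : Mat} (hA : A ≠ 0) : ∃ v, A.mulVec v ≠ 0 := by
  by_contra! h
  exact hA (eq_of_mulVec_eq fun v => by rw [h v, Matrix.zero_mulVec])

/-- A non-zero matrix of square zero is conjugate to `lowerLeft`. -/
lemma exists_conj_lowerLeft {N : Mat} (h0 : N ≠ 0) (h2 : N * N = 0) :
    ∃ P : Mat, IsUnit P ∧ P * lowerLeft = N * P := by
  obtain ⟨v, hv⟩ := exists_mulVec_ne_zero h0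
  have hNN : ∀ x, N.mulVec (N.mulVec x) = 0 := fun x => by
    rw [Matrix.mulVec_mulVec, h2, Matrix.zero_mulVec]
  have hle : LinearMap.range N.mulVecLin ≤ LinearMap.ker N.mulVecLin := by
    rintro _ ⟨x, rfl⟩
    exact hNN x
  have hlt : Submodule.span ℂ {N.mulVec v} < LinearMap.ker N.mulVecLin := by
    refine lt_of_le_of_ne ?_ fun heq => ?_
    · rw [Submodule.span_singleton_le_iff_mem]
      exact hNN v
    · have h3 := LinearMap.finrank_range_add_finrank_ker N.mulVecLin
      have h4 := Submodule.finrank_mono hle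
      rw [Module.finrank_fin_fun] at h3
      rw [← heq, finrank_span_singleton hv] at h3 h4
      omega
  obtain ⟨e, he, hne⟩ := SetLike.exists_of_lt hlt
  have he : N.mulVec e = 0 := he
  refine ⟨ofCols v e (N.mulVec v), isUnit_of_mulVec_eq_zero fun x hx => ?_, ?_⟩
  · rw [ofCols_mulVec] at hx
    have h5 := congrArg N.mulVec hx
    simp only [Matrix.mulVec_add, Matrix.mulVec_smul, he, hNN, smul_zero, add_zero,
      Matrix.mulVec_zero, smul_eq_zero, hv, or_false] at h5
    rw [h5, zero_smul, zero_add] at hx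
    have h6 : x 1 = 0 := by
      by_contra h6
      refine hne (Submodule.mem_span_singleton.2 ⟨-(x 1)⁻¹ * x 2, ?_⟩)
      rw [neg_mul, neg_smul, mul_smul, ← smul_neg, ← eq_neg_of_add_eq_zero_left hx, smul_smul,
        inv_mul_cancel₀ h6, one_smul]
    rw [h6, zero_smul, zero_add, smul_eq_zero_iff_left hv] at hx
    funext i
    fin_cases i <;> assumption
  · refine eq_of_mulVec_eq fun x => ?_
    rw [← Matrix.mulVec_mulVec, ← Matrix.mulVec_mulVec, ofCols_mulVec, ofCols_mulVec]
    simp [Matrix.mulVec_add, Matrix.mulVec_smul, he, hNN]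
    simp [lowerLeft, Matrix.mulVec, dotProduct, Fin.sum_univ_three]

/-- The linear vector field `x ∂/∂y + y ∂/∂z`. -/
def shift : Mat := !![0, 0, 0; 1, 0, 0; 0, 1, 0]

/-- A nilpotent matrix of rank `2` is conjugate to `shift`. -/
lemma exists_conj_shift {N : Mat} (h2 : N * N ≠ 0) (h3 : N * N * N = 0) :
    ∃ P : Mat, IsUnit P ∧ P * shift = N * P := by
  obtain ⟨v, hv⟩ := exists_mulVec_ne_zero h2
  rw [← Matrix.mulVec_mulVec] at hv
  have hNN : ∀ x, N.mulVec (N.mulVec (N.mulVec x)) = 0 := fun x => by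
    rw [Matrix.mulVec_mulVec, Matrix.mulVec_mulVec, h3, Matrix.zero_mulVec]
  refine ⟨ofCols v (N.mulVec v) (N.mulVec (N.mulVec v)), isUnit_of_mulVec_eq_zero fun x hx => ?_,
    ?_⟩
  · rw [ofCols_mulVec] at hx
    have h5 := congrArg (fun y => N.mulVec (N.mulVec y)) hx
    simp only [Matrix.mulVec_add, Matrix.mulVec_smul, hNN, smul_zero, add_zero,
      Matrix.mulVec_zero, smul_eq_zero, hv, or_false] at h5
    rw [h5, zero_smul, zero_add] at hx
    have h6 := congrArg N.mulVec hx
    simp only [Matrix.mulVec_add, Matrix.mulVec_smul, hNN, smul_zero, add_zero,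
      Matrix.mulVec_zero, smul_eq_zero, hv, or_false] at h6
    rw [h6, zero_smul, zero_add, smul_eq_zero_iff_left hv] at hx
    funext i
    fin_cases i <;> assumption
  · refine eq_of_mulVec_eq fun x => ?_
    rw [← Matrix.mulVec_mulVec, ← Matrix.mulVec_mulVec, ofCols_mulVec, ofCols_mulVec]
    simp only [Matrix.mulVec_add, Matrix.mulVec_smul, hNN]
    simp [shift, Matrix.mulVec, dotProduct, Fin.sum_univ_three]

/-- An eigenvector of `ad A` for a non-zero eigenvalue is nilpotent: its powers are eigenvectors
for infinitely many eigenvalues. -/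
lemma pow_three_eq_zero_of_commutator {A N : Mat} {l : ℂ} (hl : l ≠ 0)
    (h : A * N - N * A = l • N) : N * N * N = 0 := by
  have hpow : ∀ k : ℕ, A * N ^ k - N ^ k * A = (k * l) • N ^ k := by
    intro k
    induction k with
    | zero => simp
    | succ k ih =>
      have e : A * N ^ (k + 1) - N ^ (k + 1) * A =
          (A * N ^ k - N ^ k * A) * N + N ^ k * (A * N - N * A) := by
        rw [pow_succ]
        noncomm_ring
      rw [e, ih, h, pow_succ]
      simp only [smul_mul_assoc, mul_smul_comm, ← add_smul]
      congr 1
      push_cast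
      ring
  have hnil : IsNilpotent N := by
    by_contra hn
    have hne : ∀ k, N ^ k ≠ 0 := fun k hk => hn ⟨k, hk⟩
    let T : Module.End ℂ Mat := LinearMap.mulLeft ℂ A - LinearMap.mulRight ℂ A
    have hinf : Set.Infinite {μ | T.HasEigenvalue μ} := by
      refine Set.infinite_of_injective_forall_mem (f := fun k : ℕ => (k : ℂ) * l) ?_ ?_
      · intro a b hab
        exact_mod_cast mul_right_cancel₀ hl hab
      · intro k
        exact Module.End.hasEigenvalue_of_hasEigenvector
          (Module.End.hasEigenvector_iff.2 ⟨Module.End.mem_eigenspace_iff.2 (hpow k), hne k⟩)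
    exact hinf (Module.End.finite_hasEigenvalue T)
  have hc : N.charpoly = Polynomial.X ^ 3 := by
    have := (Matrix.isNilpotent_charpoly_sub_pow_of_isNilpotent hnil).eq_zero
    simpa using sub_eq_zero.1 this
  have := Matrix.aeval_self_charpoly N
  rw [hc, map_pow, Polynomial.aeval_X] at this
  rw [← this, pow_succ, pow_two]

lemma exists_common_eigenvector {A B : Mat} (h : A * B = B * A) :
    ∃ v : Fin 3 → ℂ, v ≠ 0 ∧ ∃ a b : ℂ, A.mulVec v = a • v ∧ B.mulVec v = b • v := by
  obtain ⟨a, ha⟩ := Module.End.exists_eigenvalue A.mulVecLin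
  have : Nontrivial (Module.End.eigenspace A.mulVecLin a) :=
    Submodule.nontrivial_iff_ne_bot.2 ha
  have hmaps : ∀ x ∈ Module.End.eigenspace A.mulVecLin a,
      B.mulVecLin x ∈ Module.End.eigenspace A.mulVecLin a := by
    intro x hx
    rw [Module.End.mem_eigenspace_iff, Matrix.mulVecLin_apply] at hx ⊢
    rw [Matrix.mulVecLin_apply, Matrix.mulVec_mulVec, h, ← Matrix.mulVec_mulVec, hx,
      Matrix.mulVec_smul]
  obtain ⟨b, hb⟩ := Module.End.exists_eigenvalue (B.mulVecLin.restrict hmaps)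
  obtain ⟨v, hv⟩ := hb.exists_hasEigenvector
  refine ⟨v, fun h0 => hv.2 (Subtype.ext h0), a, b, ?_, ?_⟩
  · simpa using Module.End.mem_eigenspace_iff.1 v.2
  · have := congrArg Subtype.val hv.apply_eq_smul
    simpa using this

lemma exists_isUnit_col {e : Fin 3 → ℂ} (he : e ≠ 0) :
    ∃ P : Mat, IsUnit P ∧ P.mulVec ![0, 0, 1] = e := by
  have main : ∀ P : Mat, P.det ≠ 0 → (∀ i, P i 2 = e i) →
      ∃ P : Mat, IsUnit P ∧ P.mulVec ![0, 0, 1] = e := by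
    intro P hP h
    refine ⟨P, (Matrix.isUnit_iff_isUnit_det P).2 (isUnit_iff_ne_zero.2 hP), ?_⟩
    funext i
    simp [Matrix.mulVec, dotProduct, Fin.sum_univ_three, h i]
  by_cases h2 : e 2 = 0
  · by_cases h1 : e 1 = 0
    · have h0 : e 0 ≠ 0 := fun h0 => he (by funext i; fin_cases i <;> assumption)
      refine main !![0, 0, e 0; 1, 0, e 1; 0, 1, e 2] ?_ ?_
      · simpa [Matrix.det_fin_three] using h0
      · intro i
        fin_cases i <;> simp
    · refine main !![1, 0, e 0; 0, 0, e 1; 0, 1, e 2] ?_ ?_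
      · simpa [Matrix.det_fin_three] using h1
      · intro i
        fin_cases i <;> simp
  · refine main !![1, 0, e 0; 0, 1, e 1; 0, 0, e 2] ?_ ?_
    · simpa [Matrix.det_fin_three] using h2
    · intro i
      fin_cases i <;> simp

/-! ### Proportional polynomials -/

/-- Two polynomials with the same logarithmic derivatives are proportional. -/
lemma exists_eq_C_mul_of_wronskian {p q : Poly} (hq : q ≠ 0)
    (h : ∀ i, q * pderiv i p = p * pderiv i q) : ∃ c : ℂ, p = C c * q := by
  let O : MonomialOrder (Fin 3) := MonomialOrder.lex
  set m := O.degree q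
  have hm : coeff m q ≠ 0 := O.coeff_degree_ne_zero_iff.2 hq
  -- subtract a multiple of `q` to make the coefficient at the leading monomial of `q` vanish
  set r := p - C (coeff m p / coeff m q) * q with hr
  have hrm : coeff m r = 0 := by
    rw [hr, coeff_sub, coeff_C_mul, div_mul_cancel₀ _ hm, sub_self]
  have hr' : ∀ i, q * (X i * pderiv i r) = r * (X i * pderiv i q) := by
    intro i
    rw [hr, map_sub, pderiv_C_mul]
    linear_combination X i * h i
  suffices hr0 : r = 0 from ⟨_, sub_eq_zero.1 hr0⟩
  by_contra hr0
  set n := O.degree r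
  have hn : coeff n r ≠ 0 := O.coeff_degree_ne_zero_iff.2 hr0
  have hle : ∀ (s : Poly) i, O.toSyn (O.degree (X i * pderiv i s)) ≤ O.toSyn (O.degree s) := by
    intro s i
    refine O.degree_le_iff.2 fun c hc => O.le_degree ?_
    rw [mem_support_iff, coeff_X_mul_pderiv] at hc
    exact mem_support_iff.2 (right_ne_zero_of_mul hc)
  have hnm : n = m := by
    ext i
    have e1 := O.coeff_mul_of_add_of_degree_le (le_refl (O.toSyn m)) (hle r i)
    have e2 := O.coeff_mul_of_add_of_degree_le (le_refl (O.toSyn n)) (hle q i)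
    rw [hr' i, add_comm] at e1
    rw [e1, coeff_X_mul_pderiv, coeff_X_mul_pderiv] at e2
    have : coeff m q * coeff n r * ((n i : ℂ) - m i) = 0 := by linear_combination e2
    exact_mod_cast sub_eq_zero.1 ((mul_eq_zero.1 this).resolve_left (mul_ne_zero hm hn))
  exact hn (hnm ▸ hrm)

/-! ### Elimination of nilpotents of rank two -/

/-- The polynomials annihilated by `x ∂/∂y + y ∂/∂z` contain only even powers of `y`. -/
lemma coeff_eq_zero_of_odd {p : Poly} (h : vf shift p = 0) (n : ℕ) :
    ∀ m : Fin 3 →₀ ℕ, m 1 = 2 * n + 1 → coeff m p = 0 := by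
  have h' : X 0 * pderiv 1 p + X 1 * pderiv 2 p = 0 := by
    rw [← h]
    simp [vf_apply, linForm, shift, Fin.sum_univ_three]
  induction n with
  | zero =>
    intro m hm
    have := congrArg (coeff (m - Finsupp.single 1 1 + Finsupp.single 0 1)) h'
    have e : m - Finsupp.single 1 1 + Finsupp.single 1 1 = m :=
      tsub_add_cancel_of_le (Finsupp.single_le_iff.2 (by omega))
    rw [coeff_add, mul_comm, coeff_mul_X, coeff_X_mul', if_neg (by simp [hm]), coeff_pderiv, e,
      coeff_zero, add_zero] at this
    refine (mul_eq_zero.1 this).resolve_right ?_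
    exact Nat.cast_add_one_ne_zero _
  | succ n ih =>
    intro m hm
    have := congrArg (coeff (m - Finsupp.single 1 1 + Finsupp.single 0 1)) h'
    have e : m - Finsupp.single 1 1 + Finsupp.single 1 1 = m :=
      tsub_add_cancel_of_le (Finsupp.single_le_iff.2 (by omega))
    rw [coeff_add, mul_comm, coeff_mul_X, coeff_X_mul',
      if_pos (by simp [hm]), coeff_pderiv, e,
      coeff_pderiv,
      ih (m - Finsupp.single 1 1 + Finsupp.single 0 1 - Finsupp.single 1 1 + Finsupp.single 2 1)
        (by simp [hm]; omega), coeff_zero, zero_mul, add_zero] at this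
    refine (mul_eq_zero.1 this).resolve_right ?_
    exact Nat.cast_add_one_ne_zero _

lemma weight_of_coeff_ne_zero {n : ℕ} {p : Poly} (hp : p.IsHomogeneous n) {a l s : ℂ}
    (h : vf !![a, 0, 0; 0, a + l, 0; 0, 0, a + 2 * l] p = C s * p) {m : Fin 3 →₀ ℕ}
    (hm : coeff m p ≠ 0) : a * n + l * (m 1 + 2 * m 2) = s := by
  have h' : C a * (X 0 * pderiv 0 p) + C (a + l) * (X 1 * pderiv 1 p) +
      C (a + 2 * l) * (X 2 * pderiv 2 p) = C s * p := by
    rw [← h]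
    simp [vf_apply, linForm, Fin.sum_univ_three, mul_assoc]
  have h1 := congrArg (coeff m) h'
  simp only [coeff_add, coeff_C_mul, coeff_X_mul_pderiv] at h1
  have h2 : (m 0 : ℂ) + m 1 + m 2 = n := by exact_mod_cast sum_eq_of_coeff_ne_zero hp hm
  rw [← h2]
  exact mul_right_cancel₀ hm (by linear_combination h1)

/-- A saturated form of degree at least two is not annihilated by both `x ∂/∂y + y ∂/∂z` and a
diagonal field normalizing it: for parity reasons, either the contraction with the first field or
the component `ω 2` would vanish. -/
lemma not_shift_and_diagonal_mem_annih {d : ℕ} (hd : 2 ≤ d) {ω : Fin 3 → Poly}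
    (hω : ω ∈ formSpace d) (hs : Saturated ω) (hN : shift ∈ annih ω) {a l : ℂ} (hl : l ≠ 0)
    (hA : !![a, 0, 0; 0, a + l, 0; 0, 0, a + 2 * l] ∈ annih ω) : False := by
  set D : Mat := !![a, 0, 0; 0, a + l, 0; 0, 0, a + 2 * l] with hD
  have hNne : shift ≠ 0 := fun h => by simpa [shift] using congrFun (congrFun h 1) 0
  have hf0 := con_ne_zero hd hω hs hN hNne
  have hfN : vf shift (con shift ω) = 0 := by
    rw [vf_con hN, sub_self]
    simp [con, linForm]
  have hfD : vf D (con shift ω) = C (-l) * con shift ω := by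
    rw [vf_con hA, ← con_smul]
    congr 1
    ext i j
    fin_cases i <;> fin_cases j <;> simp [shift, hD]
    ring
  obtain ⟨m, hm⟩ := ne_zero_iff.1 hf0
  have h1 := weight_of_coeff_ne_zero (con_isHomogeneous shift hω) hfD hm
  have hm1 : ∀ n, m 1 ≠ 2 * n + 1 := fun n h => hm (coeff_eq_zero_of_odd hfN n m h)
  have hN2 : vf shift (ω 2) = 0 := by
    have := congrFun (mem_annih.1 hN) 2
    simpa [lie, shift, Fin.sum_univ_three] using this
  have hD2 : vf D (ω 2) = C (-(a + 2 * l)) * ω 2 := by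
    have := congrFun (mem_annih.1 hA) 2
    simp only [lie, hD, Fin.sum_univ_three, Pi.zero_apply] at this
    simp at this
    simp only [C_neg, C_add, C_mul]
    linear_combination this
  by_cases h20 : ω 2 = 0
  · have he : X 0 * ω 0 + X 1 * ω 1 = 0 := by
      simpa [Fin.sum_univ_three, h20] using hω.2
    have hdvd : (X 0 : Poly) ∣ ω 1 := by
      have : (X 0 : Poly) ∣ X 1 * ω 1 := ⟨-ω 0, by linear_combination he⟩
      refine ((X_prime (R := ℂ) (i := (0 : Fin 3))).dvd_or_dvd this).resolve_left fun h => ?_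
      exact absurd (X_dvd_X.1 h) (by decide)
    obtain ⟨q, hq⟩ := hdvd
    have hq0 : ω 0 = -(X 1 * q) :=
      mul_left_cancel₀ (X_ne_zero (R := ℂ) (0 : Fin 3)) (by linear_combination he - X 1 * hq)
    have hu : IsUnit q := hs q fun i => by
      fin_cases i
      · exact ⟨-X 1, by change ω 0 = _; rw [hq0]; ring⟩
      · exact ⟨X 0, by change ω 1 = _; rw [hq]; ring⟩
      · exact ⟨0, by change ω 2 = _; rw [h20]; ring⟩
    have hqh : q.IsHomogeneous d := isHomogeneous_of_mul_X 0 (by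
      rw [mul_comm, ← hq]
      exact hω.1 1)
    obtain ⟨r, hr⟩ := hu.exists_right_inv
    have h2 := totalDegree_le_of_dvd_of_isDomain ⟨r, hr.symm⟩ (one_ne_zero (α := Poly))
    rw [totalDegree_one, hqh.totalDegree hu.ne_zero] at h2
    omega
  · obtain ⟨m', hm'⟩ := ne_zero_iff.1 h20
    have h2 := weight_of_coeff_ne_zero (hω.1 2) hD2 hm'
    have h3 : l * ((m 1 + 2 * m 2 : ℂ) + 1 - (m' 1 + 2 * m' 2 + 2)) = 0 := by
      push_cast at h1 h2
      linear_combination h1 - h2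
    have h4 : m 1 + 2 * m 2 + 1 = m' 1 + 2 * m' 2 + 2 := by
      exact_mod_cast sub_eq_zero.1 ((mul_eq_zero.1 h3).resolve_left hl)
    have h5 := hm1 (m 1 / 2)
    have h6 : ∀ n, m' 1 ≠ 2 * n + 1 := fun n h => hm' (coeff_eq_zero_of_odd hN2 n m' h)
    have h7 := h6 (m' 1 / 2)
    omega

lemma Saturated.pullFun_of_isUnit {P : Mat} (hP : IsUnit P) {ω : Fin 3 → Poly}
    (hs : Saturated ω) : Saturated (PlaneFoliation.pullFun P ω) := by
  obtain ⟨P, rfl⟩ := hP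
  exact hs.pullFun P

/-- Conjugation by an invertible matrix preserves a relation `A N - N A = l N`. -/
lemma commutator_conj {P A A' N N' : Mat} (hP : IsUnit P) (hA : P * A' = A * P)
    (hN : P * N' = N * P) {l : ℂ} (h : A * N - N * A = l • N) : A' * N' - N' * A' = l • N' := by
  refine hP.mul_left_cancel ?_
  calc P * (A' * N' - N' * A') = (P * A') * N' - (P * N') * A' := by noncomm_ring
    _ = A * (P * N') - N * (P * A') := by rw [hA, hN, mul_assoc, mul_assoc, hA, hN]
    _ = (A * N - N * A) * P := by rw [hA, hN]; noncomm_ring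
    _ = P * (l • N') := by rw [h, Matrix.mul_smul, hN, Matrix.smul_mul]

/-- The classification when the annihilator contains a nilpotent field of rank one and a second
field normalizing it: for `N = lowerLeft` the relation `[A, N] = l N` makes `A` lower triangular. -/
lemma isConjModel_of_nilpotent {d : ℕ} (hd : 2 ≤ d) {ω : Fin 3 → Poly} (hω : ω ∈ formSpace d)
    (hs : Saturated ω) {A N : Mat} (hA : A ∈ annih ω) (hN : N ∈ annih ω) (hN0 : N ≠ 0)
    (hN2 : N * N = 0) (hne : ∀ t : ℂ, A ≠ t • N) {l : ℂ} (h : A * N - N * A = l • N) :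
    IsConjModel d ω := by
  obtain ⟨P, hP, hPN⟩ := exists_conj_lowerLeft hN0 hN2
  obtain ⟨A', hA'⟩ := exists_conj hP A
  have hc := commutator_conj hP hA' hPN h
  refine IsConjModel.of_pullFun hP (isConjModel_of_lowerLeft hd (pullFun_mem P hω)
    (hs.pullFun_of_isUnit hP) (mem_annih_pullFun hPN hN) (mem_annih_pullFun hA' hA) ?_ ?_ ?_ ?_)
  · simpa [lowerLeft, Matrix.mul_apply, Matrix.vecMul, dotProduct, Fin.sum_univ_three] using
      congrFun (congrFun hc 2) 1
  · simpa [lowerLeft, Matrix.mul_apply, Matrix.vecMul, dotProduct, Fin.sum_univ_three] using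
      congrFun (congrFun hc 2) 2
  · simpa [lowerLeft, Matrix.mul_apply, Matrix.vecMul, dotProduct, Fin.sum_univ_three] using
      congrFun (congrFun hc 1) 0
  · rintro t rfl
    refine hne t (hP.mul_right_cancel ?_)
    rw [← hA', Matrix.mul_smul, hPN, Matrix.smul_mul]

/-- An eigenvector `N`, for a non-zero eigenvalue, of `ad A` with `A` in the annihilator, is not in
the annihilator unless its square is zero. -/
lemma not_mem_annih_of_sq_ne_zero {d : ℕ} (hd : 2 ≤ d) {ω : Fin 3 → Poly} (hω : ω ∈ formSpace d)
    (hs : Saturated ω) {A N : Mat} (hA : A ∈ annih ω) (hN : N ∈ annih ω) (hN2 : N * N ≠ 0) {l : ℂ}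
    (hl : l ≠ 0) (h : A * N - N * A = l • N) : False := by
  obtain ⟨P, hP, hPN⟩ := exists_conj_shift hN2 (pow_three_eq_zero_of_commutator hl h)
  obtain ⟨B, hB⟩ := exists_conj hP A
  have hc := commutator_conj hP hB hPN h
  have e : ∀ i j, (B * shift - shift * B) i j = l * shift i j := fun i j => by rw [hc]; rfl
  have e00 := e 0 0
  have e01 := e 0 1
  have e10 := e 1 0
  have e20 := e 2 0
  have e21 := e 2 1
  have e11 := e 1 1
  simp [shift, Matrix.mul_apply, Matrix.vecMul, dotProduct,
    Fin.sum_univ_three] at e00 e01 e10 e20 e21 e11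
  -- now `B` is lower triangular; a unipotent conjugation commuting with `shift` makes
  -- `B - B 1 0 • shift` diagonal
  set s := -(B 2 0) / (2 * l) with hs'
  have hsl : s * (2 * l) = -(B 2 0) := div_mul_cancel₀ _ (mul_ne_zero two_ne_zero hl)
  set R : Mat := !![1, 0, 0; 0, 1, 0; s, 0, 1] with hR
  have hRu : IsUnit R := by
    rw [Matrix.isUnit_iff_isUnit_det]
    simp [hR, Matrix.det_fin_three]
  have hNP := mem_annih_pullFun hPN hN
  have hBP := sub_smul_mem_annih (mem_annih_pullFun hB hA) hNP (B 1 0)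
  refine not_shift_and_diagonal_mem_annih hd (pullFun_mem R (pullFun_mem P hω))
    ((hs.pullFun_of_isUnit hP).pullFun_of_isUnit hRu) (a := B 0 0) (l := l)
    (mem_annih_pullFun ?_ hNP) hl (mem_annih_pullFun ?_ hBP)
  · ext i j
    fin_cases i <;> fin_cases j <;> simp [hR, shift]
  · have b11 : B 1 1 = B 0 0 + l := by linear_combination e10
    have b22 : B 2 2 = B 0 0 + 2 * l := by linear_combination e21 + e10
    have b21 : B 2 1 = B 1 0 := by linear_combination e20
    have b12 : B 1 2 = 0 := by linear_combination e11 + e00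
    ext i j
    fin_cases i <;> fin_cases j <;>
      simp [hR, shift, Matrix.mul_apply, Fin.sum_univ_three, b11, b22, b21, b12, e00, e01]
    linear_combination -hsl

/-- The operator `lie N` is nilpotent for `N * N = 0`, and `lie 1` is the scalar `d + 2`, so that
`lie (c • 1 + N)` is injective on forms of degree `d` if `c ≠ 0`. -/
lemma eq_zero_of_smul_one_add_mem_annih {d : ℕ} {ω : Fin 3 → Poly} (hω : ω ∈ formSpace d)
    (h0 : ω ≠ 0) {N : Mat} (hN2 : N * N = 0) {c : ℂ} (h : c • (1 : Mat) + N ∈ annih ω) : c = 0 := by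
  by_cases hN0 : N = 0
  · rw [hN0, add_zero] at h
    exact eq_zero_of_smul_one_mem_annih hω h0 h
  obtain ⟨P, hP, hPN⟩ := exists_conj_lowerLeft hN0 hN2
  have h1 : c • (1 : Mat) + lowerLeft ∈ annih (pullFun P ω) :=
    mem_annih_pullFun (by rw [mul_add, add_mul, hPN, Matrix.mul_smul, Matrix.smul_mul, mul_one,
      one_mul]) h
  have hη := pullFun_mem P hω
  have hη0 : pullFun P ω ≠ 0 := by
    obtain ⟨P, rfl⟩ := hP
    intro h2
    apply h0
    rw [← pullFun_one ω, ← Units.val_one, ← mul_inv_cancel P, Units.val_mul, pullFun_mul, h2,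
      pullFun_zero]
  set η := pullFun P ω
  by_contra hc
  rw [mem_annih, lie_add_left, lie_smul_left, lie_one hη, lie_lowerLeft] at h1
  have hc' : c * ((d : ℂ) + 2) ≠ 0 := mul_ne_zero hc (by exact_mod_cast (by omega : d + 2 ≠ 0))
  have e : ∀ j, C (c * ((d : ℂ) + 2)) * η j + ![η 2 + X 0 * pderiv 2 (η 0), X 0 * pderiv 2 (η 1),
      X 0 * pderiv 2 (η 2)] j = 0 := fun j => by
    have := congrFun h1 j
    rwa [Pi.add_apply, smul_smul, Pi.smul_apply, smul_eq_C_mul] at this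
  have z : ∀ p : Poly, C (c * ((d : ℂ) + 2)) * p + X 0 * pderiv 2 p = 0 → p = 0 := fun p hp =>
    eq_zero_of_add_X_mul_pderiv (i := 0) (j := 2) (by decide) hc' (b := 1) (by simpa using hp)
  have e1 := z _ (e 1)
  have e2 := z _ (e 2)
  have e0 := z (η 0) (by simpa [e2] using e 0)
  apply hη0
  funext j
  fin_cases j
  · exact e0
  · exact e1
  · exact e2

/-! ### Commuting fields in the annihilator -/

/-- Two commuting fields of the annihilator are everywhere linearly dependent with the radial field:
otherwise the ratio of the contractions would be invariant under three generically independent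
fields, hence constant, and a combination of the two fields would have zero contraction. -/
lemma det_eq_zero_of_commute {d : ℕ} (hd : 2 ≤ d) {ω : Fin 3 → Poly} (hω : ω ∈ formSpace d)
    (hs : Saturated ω) {A B : Mat} (hA : A ∈ annih ω) (hB : B ∈ annih ω) (hB0 : B ≠ 0)
    (hne : ∀ t : ℂ, A ≠ t • B) (hAB : A * B = B * A) :
    Matrix.det !![X 0, X 1, X 2; linForm A 0, linForm A 1, linForm A 2;
      linForm B 0, linForm B 1, linForm B 2] = 0 := by
  by_contra hQ
  rw [Matrix.det_fin_three] at hQ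
  simp only [Matrix.of_apply, Matrix.cons_val] at hQ
  set p := con A ω
  set q := con B ω with hq
  have con_zero : con 0 ω = 0 := by simp [con, linForm]
  have hq0 : q ≠ 0 := con_ne_zero hd hω hs hB hB0
  have hv : ∀ {D E : Mat}, D ∈ annih ω → E * D = D * E →
      ∑ k, linForm D k * pderiv k (con E ω) = 0 := fun hD h => by
    rw [← vf_apply, vf_con hD, h, sub_self, con_zero]
  have a1 := hv hA (E := A) rfl
  have a2 := hv hA hAB.symm
  have b1 := hv hB hAB
  have b2 := hv hB (E := B) rfl
  have r1 := (con_isHomogeneous A hω).sum_X_mul_pderiv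
  have r2 := (con_isHomogeneous B hω).sum_X_mul_pderiv
  rw [nsmul_eq_mul] at r1 r2
  rw [Fin.sum_univ_three] at a1 a2 b1 b2 r1 r2
  obtain ⟨c, hc⟩ := exists_eq_C_mul_of_wronskian (p := p) hq0 fun i => by
    -- Cramer's rule
    refine sub_eq_zero.1 ((mul_eq_zero.1 ?_).resolve_left hQ)
    fin_cases i <;> simp only [Fin.zero_eta, Fin.mk_one, Fin.reduceFinMk, Fin.isValue]
    · linear_combination
        (linForm A 1 * linForm B 2 - linForm A 2 * linForm B 1) * (q * r1 - p * r2) -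
        (X 1 * linForm B 2 - X 2 * linForm B 1) * (q * a1 - p * a2) +
        (X 1 * linForm A 2 - X 2 * linForm A 1) * (q * b1 - p * b2)
    · linear_combination
        -(linForm A 0 * linForm B 2 - linForm A 2 * linForm B 0) * (q * r1 - p * r2) +
        (X 0 * linForm B 2 - X 2 * linForm B 0) * (q * a1 - p * a2) -
        (X 0 * linForm A 2 - X 2 * linForm A 0) * (q * b1 - p * b2)
    · linear_combination
        (linForm A 0 * linForm B 1 - linForm A 1 * linForm B 0) * (q * r1 - p * r2) -
        (X 0 * linForm B 1 - X 1 * linForm B 0) * (q * a1 - p * a2) +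
        (X 0 * linForm A 1 - X 1 * linForm A 0) * (q * b1 - p * b2)
  refine con_ne_zero hd hω hs (sub_smul_mem_annih hA hB c) (sub_ne_zero.2 (hne c)) ?_
  rw [con_sub_smul, ← hq, ← hc, sub_self]

/-- Two commuting `2 × 2` matrices, with rows `a, b`, `c, e` and `a', b'`, `c', e'`, are linearly
dependent if their values are parallel at `(1, 0)`, `(0, 1)` and `(1, 1)`, which is `h1`, `h2`,
`h3`. -/
lemma exists_smul_add_smul_eq_zero {a b c e a' b' c' e' : ℂ}
    (h1 : a * c' = c * a') (h2 : b * e' = e * b')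
    (h3 : (a + b) * (c' + e') = (c + e) * (a' + b')) (k1 : b * c' = b' * c)
    (k2 : a * b' + b * e' = a' * b + b' * e) (k3 : c * a' + e * c' = c' * a + e' * c) :
    ∃ s t : ℂ, (s ≠ 0 ∨ t ≠ 0) ∧ s * a + t * a' = 0 ∧ s * b + t * b' = 0 ∧
      s * c + t * c' = 0 ∧ s * e + t * e' = 0 := by
  have m1 : a * e' = a' * e := by linear_combination h3 - h1 - h2 - k1
  have m2 : a * b' = a' * b := by linear_combination k2 - h2
  have m3 : c * e' = c' * e := by linear_combination -k3 - h1
  by_cases ha : a = 0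
  · by_cases hb : b = 0
    · by_cases hc : c = 0
      · by_cases he : e = 0
        · exact ⟨1, 0, Or.inl one_ne_zero, by simp [*]⟩
        · exact ⟨-e', e, Or.inr he, by linear_combination -m1, by linear_combination -h2,
            by linear_combination -m3, by ring⟩
      · exact ⟨-c', c, Or.inr hc, by linear_combination -h1, by linear_combination -k1,
          by ring, by linear_combination m3⟩
    · exact ⟨-b', b, Or.inr hb, by linear_combination -m2, by ring, by linear_combination k1,
        by linear_combination h2⟩
  · exact ⟨-a', a, Or.inr ha, by ring, by linear_combination m2, by linear_combination h1,
      by linear_combination m1⟩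

/-- The classification when the annihilator contains two commuting fields. In coordinates where the
last basis vector is a common eigenvector, with eigenvalues `a`, `b`, the matrices `A - a` and
`B - b` act on the quotient of `ℂ³` by it with everywhere parallel values, so that a combination of
them is nilpotent of rank one. -/
lemma isConjModel_of_commute {d : ℕ} (hd : 2 ≤ d) {ω : Fin 3 → Poly} (hω : ω ∈ formSpace d)
    (hs : Saturated ω) {A B : Mat} (hA : A ∈ annih ω) (hB : B ∈ annih ω) (hB0 : B ≠ 0)
    (hne : ∀ t : ℂ, A ≠ t • B) (hAB : A * B = B * A) : IsConjModel d ω := by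
  obtain ⟨v, hv0, a, b, hav, hbv⟩ := exists_common_eigenvector hAB
  obtain ⟨P, hP, hPv⟩ := exists_isUnit_col hv0
  obtain ⟨A', hA'⟩ := exists_conj hP A
  obtain ⟨B', hB'⟩ := exists_conj hP B
  refine IsConjModel.of_pullFun hP ?_
  replace hA := mem_annih_pullFun hA' hA
  replace hB := mem_annih_pullFun hB' hB
  replace hs := hs.pullFun_of_isUnit hP
  replace hω := pullFun_mem P hω
  have hne' : ∀ t : ℂ, A' ≠ t • B' := by
    rintro t rfl
    refine hne t (hP.mul_right_cancel ?_)
    rw [← hA', Matrix.mul_smul, hB', Matrix.smul_mul]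
  have hB0' : B' ≠ 0 := by
    rintro rfl
    exact hB0 (hP.mul_right_cancel (by rw [← hB', mul_zero, zero_mul]))
  have hAB' : A' * B' = B' * A' := by
    have := commutator_conj hP hA' hB' (l := 0) (by rw [hAB, sub_self, zero_smul])
    rwa [zero_smul, sub_eq_zero] at this
  -- the last column of `A'` and of `B'` is an eigenvector
  have hcol : ∀ {M M' : Mat} {c : ℂ}, P * M' = M * P → M.mulVec v = c • v →
      M' 0 2 = 0 ∧ M' 1 2 = 0 ∧ M' 2 2 = c := by
    intro M M' c hM hc
    have h1 : P.mulVec (M'.mulVec ![0, 0, 1]) = P.mulVec (c • ![0, 0, 1]) := by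
      rw [Matrix.mulVec_mulVec, hM, ← Matrix.mulVec_mulVec, hPv, hc, Matrix.mulVec_smul, hPv]
    have h2 := Matrix.mulVec_injective_iff_isUnit.2 hP h1
    have e0 := congrFun h2 0
    have e1 := congrFun h2 1
    have e2 := congrFun h2 2
    simp [Matrix.mulVec, dotProduct, Fin.sum_univ_three] at e0 e1 e2
    exact ⟨e0, e1, e2⟩
  obtain ⟨a02, a12, a22⟩ := hcol hA' hav
  obtain ⟨b02, b12, b22⟩ := hcol hB' hbv
  have hdet := det_eq_zero_of_commute hd hω hs hA hB hB0' hne' hAB'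
  have ev : ∀ x y z : ℂ, eval ![x, y, z] (Matrix.det !![X 0, X 1, X 2;
      linForm A' 0, linForm A' 1, linForm A' 2; linForm B' 0, linForm B' 1, linForm B' 2]) = 0 :=
    fun x y z => by rw [hdet, map_zero]
  simp only [Matrix.det_fin_three, Matrix.of_apply, Matrix.cons_val, map_sub, map_add, map_mul,
    eval_X, eval_linForm, Fin.sum_univ_three, a02, a12, a22, b02, b12, b22] at ev
  have hc : ∀ i j, (A' * B') i j = (B' * A') i j := fun i j => by rw [hAB']
  have c00 := hc 0 0
  have c01 := hc 0 1
  have c10 := hc 1 0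
  simp only [Matrix.mul_apply, Fin.sum_univ_three, a02, a12, b02, b12] at c00 c01 c10
  obtain ⟨s, t, hst, h1, h2, h3, h4⟩ := exists_smul_add_smul_eq_zero
    (a := A' 0 0 - a) (b := A' 0 1) (c := A' 1 0) (e := A' 1 1 - a)
    (a' := B' 0 0 - b) (b' := B' 0 1) (c' := B' 1 0) (e' := B' 1 1 - b)
    (by linear_combination ev 1 0 1 - ev 1 0 0) (by linear_combination ev 0 1 1 - ev 0 1 0)
    (by linear_combination ev 1 1 1 - ev 1 1 0) (by linear_combination c00)
    (by linear_combination c01) (by linear_combination c10)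
  -- `s A' + t B'` is the sum of a scalar matrix and of a matrix of square zero
  set N := s • A' + t • B' - (s * a + t * b) • (1 : Mat) with hN
  have hNe : N = !![0, 0, 0; 0, 0, 0; N 2 0, N 2 1, 0] := by
    ext i j
    fin_cases i <;> fin_cases j <;>
      simp [hN, a02, a12, a22, b02, b12, b22, h2, h3]
    · linear_combination h1
    · linear_combination h4
  have hN2 : N * N = 0 := by
    rw [hNe]
    ext i j
    fin_cases i <;> fin_cases j <;> simp
  have hmem : s • A' + t • B' ∈ annih (pullFun P ω) :=
    add_mem (Submodule.smul_mem _ _ hA) (Submodule.smul_mem _ _ hB)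
  have hc0 : s * a + t * b = 0 := eq_zero_of_smul_one_add_mem_annih hω hs.ne_zero' hN2 (by
    rwa [hN, add_sub_cancel])
  rw [hc0, zero_smul, sub_zero] at hN
  rw [← hN] at hmem
  have hNA : N * A' = A' * N := by
    rw [hN, add_mul, mul_add, Matrix.smul_mul, Matrix.smul_mul, Matrix.mul_smul, Matrix.mul_smul,
      hAB']
  have hNB : N * B' = B' * N := by
    rw [hN, add_mul, mul_add, Matrix.smul_mul, Matrix.smul_mul, Matrix.mul_smul, Matrix.mul_smul,
      hAB']
  by_cases hs0 : s = 0
  · -- then `N` is a non-zero multiple of `B'`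
    have ht0 : t ≠ 0 := hst.resolve_left (not_not.2 hs0)
    rw [hs0, zero_smul, zero_add] at hN
    refine isConjModel_of_nilpotent hd hω hs hA hmem ?_ hN2 ?_ (l := 0)
      (by rw [hNA, sub_self, zero_smul])
    · rw [hN]
      exact smul_ne_zero ht0 hB0'
    · intro u hu
      exact hne' (u * t) (by rw [hu, hN, smul_smul])
  · have hAN : A' = s⁻¹ • (N - t • B') := by
      rw [hN, add_sub_cancel_right, smul_smul, inv_mul_cancel₀ hs0, one_smul]
    have hN0 : N ≠ 0 := by
      intro h0
      refine hne' (-(s⁻¹ * t)) ?_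
      rw [hAN, h0, zero_sub, smul_neg, smul_smul, neg_smul]
    refine isConjModel_of_nilpotent hd hω hs hB hmem hN0 hN2 ?_ (l := 0)
      (by rw [hNB, sub_self, zero_smul])
    intro u hu
    have hu0 : u ≠ 0 := by
      rintro rfl
      exact hB0' (by rw [hu, zero_smul])
    refine hne' (s⁻¹ * (u⁻¹ - t)) ?_
    have : N = u⁻¹ • B' := by rw [hu, smul_smul, inv_mul_cancel₀ hu0, one_smul]
    rw [hAN, this, ← sub_smul, smul_smul]

/-- The classification: a saturated form of degree at least `2` whose annihilator has dimension at
least `2` is linearly conjugate to a multiple of one of the two models. -/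
theorem isConjModel_of_two_le_finrank {d : ℕ} (hd : 2 ≤ d) {ω : Fin 3 → Poly}
    (hω : ω ∈ formSpace d) (hs : Saturated ω) (h2 : 2 ≤ Module.finrank ℂ (annih ω)) :
    IsConjModel d ω := by
  have hnt : Nontrivial (annih ω) := Module.nontrivial_of_finrank_pos (R := ℂ) (by omega)
  obtain ⟨A, hA0⟩ := exists_ne (0 : annih ω)
  -- an eigenvector of `ad A` modulo `A` spans with `A` a subalgebra of dimension two
  let T : annih ω →ₗ[ℂ] annih ω :=
    LinearMap.restrict (LinearMap.mulLeft ℂ A.1 - LinearMap.mulRight ℂ A.1)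
      fun B hB => commutator_mem_annih A.2 hB
  have hT : ∀ B : annih ω, (T B : Mat) = A.1 * B.1 - B.1 * A.1 := fun B => rfl
  let S := Submodule.span ℂ {A}
  have hTS : S ≤ S.comap T := by
    rw [Submodule.span_singleton_le_iff_mem]
    have : T A = 0 := Subtype.ext (by rw [hT, sub_self]; rfl)
    rw [Submodule.mem_comap, this]
    exact zero_mem _
  have hq : Nontrivial (annih ω ⧸ S) := by
    refine Module.nontrivial_of_finrank_pos (R := ℂ) ?_
    have := Submodule.finrank_quotient_add_finrank S
    rw [finrank_span_singleton hA0] at this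
    omega
  obtain ⟨l, hl⟩ := Module.End.exists_eigenvalue (S.mapQ S T hTS)
  obtain ⟨v, hv⟩ := hl.exists_hasEigenvector
  obtain ⟨B, rfl⟩ := Submodule.mkQ_surjective S v
  have hBS : B ∉ S := fun h => hv.2 ((Submodule.Quotient.mk_eq_zero S).2 h)
  have h3 : T B - l • B ∈ S := by
    have := hv.apply_eq_smul
    rw [Submodule.mkQ_apply, Submodule.mapQ_apply, ← Submodule.Quotient.mk_smul,
      Submodule.Quotient.eq] at this
    exact this
  obtain ⟨u, hu⟩ := Submodule.mem_span_singleton.1 h3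
  have hcomm : A.1 * B.1 - B.1 * A.1 = l • B.1 + u • A.1 := by
    have h4 : T B = l • B + u • A := by rw [hu, add_sub_cancel]
    rw [← hT, h4]
    rfl
  have hBA : ∀ t : ℂ, B.1 ≠ t • A.1 := fun t ht =>
    hBS (Submodule.mem_span_singleton.2 ⟨t, Subtype.ext ht.symm⟩)
  have hA0' : A.1 ≠ 0 := fun h => hA0 (Subtype.ext h)
  -- reduction to a pair `D`, `N` with `[D, N]` a multiple of `N`
  have main : ∀ (D N : Mat), D ∈ annih ω → N ∈ annih ω → N ≠ 0 → (∀ t : ℂ, D ≠ t • N) →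
      ∀ l : ℂ, D * N - N * D = l • N → IsConjModel d ω := by
    intro D N hD hN hN0 hDN l h
    by_cases hl : l = 0
    · rw [hl, zero_smul, sub_eq_zero] at h
      exact isConjModel_of_commute hd hω hs hD hN hN0 hDN h
    · by_cases hN2 : N * N = 0
      · exact isConjModel_of_nilpotent hd hω hs hD hN hN0 hN2 hDN h
      · exact (not_mem_annih_of_sq_ne_zero hd hω hs hD hN hN2 hl h).elim
  by_cases hl0 : l = 0
  · rw [hl0, zero_smul, zero_add] at hcomm
    refine main B A B.2 A.2 hA0' hBA (-u) ?_
    rw [neg_smul, ← hcomm, neg_sub]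
  · refine main A (B.1 + (u / l) • A.1) A.2 (add_mem B.2 (Submodule.smul_mem _ _ A.2)) ?_ ?_ l ?_
    · intro h0
      exact hBA (-(u / l)) (by rw [neg_smul]; exact eq_neg_of_add_eq_zero_left h0)
    · intro t ht
      have ht0 : t ≠ 0 := by
        rintro rfl
        exact hA0' (by rw [ht, zero_smul])
      refine hBA (t⁻¹ - u / l) ?_
      have : B.1 + (u / l) • A.1 = t⁻¹ • A.1 := by
        conv_rhs => rw [ht]
        rw [smul_smul, inv_mul_cancel₀ ht0, one_smul]
      rw [sub_smul, ← this, add_sub_cancel_right]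
    · rw [mul_add, add_mul, Matrix.mul_smul, Matrix.smul_mul, add_sub_add_right_eq_sub, hcomm,
        smul_add, smul_smul, mul_div_cancel₀ _ hl0]

/-! ### The annihilators of the two model forms -/

lemma eval_lie (A : Mat) (ω : Fin 3 → Poly) (j : Fin 3) (v : Fin 3 → ℂ) :
    eval v (lie A ω j) = ∑ i, A i j * eval v (ω i) +
      ∑ k, (∑ l, A k l * v l) * eval v (pderiv k (ω j)) := by
  simp [lie, vf_apply, eval_linForm]

/-- The infinitesimal generator of the torus in the isotropy group of `form₁ d`. -/
def weight₁ (d : ℕ) : Mat := !![1, 0, 0; 0, -((d : ℂ) + 1), 0; 0, 0, (d : ℂ) ^ 2 + d - 1]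

/-- The infinitesimal generator of the torus in the isotropy group of `form₂ d`. -/
def weight₂ (d : ℕ) : Mat := !![(d : ℂ) + 1, 0, 0; 0, -1, 0; 0, 0, -((d : ℂ) + 1) ^ 2]

lemma weight₁_mem_annih {d : ℕ} (hd : 2 ≤ d) : weight₁ d ∈ annih (form₁ d : Fin 3 → Poly) := by
  obtain ⟨e, rfl⟩ : ∃ e, d = e + 2 := ⟨d - 2, by omega⟩
  rw [mem_annih]
  funext j
  fin_cases j <;>
    simp [lie, vf_apply, linForm, weight₁, form₁, Fin.sum_univ_three, pderiv_X,
      Derivation.leibniz_pow, show (C 2 : Poly) = 2 from map_ofNat C 2] <;>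
    ring

lemma weight₂_mem_annih {d : ℕ} (hd : 2 ≤ d) : weight₂ d ∈ annih (form₂ d : Fin 3 → Poly) := by
  obtain ⟨e, rfl⟩ : ∃ e, d = e + 2 := ⟨d - 2, by omega⟩
  rw [mem_annih]
  funext j
  fin_cases j <;>
    simp [lie, vf_apply, linForm, weight₂, form₂, Fin.sum_univ_three, pderiv_X,
      Derivation.leibniz_pow, show (C 2 : Poly) = 2 from map_ofNat C 2] <;>
    ring

lemma lowerLeft_mem_annih_form₁ (d : ℕ) : lowerLeft ∈ annih (form₁ d : Fin 3 → Poly) := by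
  rw [mem_annih, lie_lowerLeft]
  funext j
  fin_cases j <;> simp [form₁, pderiv_X, Derivation.leibniz_pow, mul_comm]

lemma lowerLeft_mem_annih_form₂ (d : ℕ) : lowerLeft ∈ annih (form₂ d : Fin 3 → Poly) := by
  rw [mem_annih, lie_lowerLeft]
  funext j
  fin_cases j <;> simp [form₂, pderiv_X, Derivation.leibniz_pow, mul_comm]

/-- The entries of `A` are determined by evaluating the coefficients of `lie A (form₁ d)` at a few
points. These have coordinates `0`, `1`, `2`, whence the powers of `2` in the linear combinations.
-/
lemma mem_annih_form₁_iff {d : ℕ} (hd : 2 ≤ d) {A : Mat} :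
    A ∈ annih (form₁ d : Fin 3 → Poly) ↔ ∃ t s : ℂ, A = t • weight₁ d + s • lowerLeft := by
  constructor
  · intro h
    have hv : ∀ (j : Fin 3) (x y z : ℂ), eval ![x, y, z] (lie A (form₁ d) j) = 0 := by
      intro j x y z
      rw [mem_annih.1 h]
      simp
    simp only [eval_lie] at hv
    obtain ⟨e, rfl⟩ : ∃ e, d = e + 2 := ⟨d - 2, by omega⟩
    have h1 := hv 1 1 0 0
    have h2 := hv 1 1 0 1
    have h3 := hv 1 1 1 0
    have h4 := hv 1 2 1 0
    have h5 := hv 2 1 1 0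
    have h6 := hv 2 1 1 1
    have h7 := hv 2 2 1 0
    simp [form₁, Fin.sum_univ_three, pderiv_X, Derivation.leibniz_pow] at h1 h2 h3 h4 h5 h6 h7
    have he2 : ((e : ℂ) + 2) ≠ 0 := by exact_mod_cast (by omega : e + 2 ≠ 0)
    have he3 : ((e : ℂ) + 3) ≠ 0 := by exact_mod_cast (by omega : e + 3 ≠ 0)
    have hT : (2 : ℂ) ^ (e + 1) - 1 ≠ 0 :=
      sub_ne_zero.2 (by exact_mod_cast (Nat.one_lt_two_pow (by omega : e + 1 ≠ 0)).ne')
    have a02 : A 0 2 = 0 := (mul_eq_zero_iff_right he3).1 (by linear_combination h2 - h1)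
    have a01 : A 0 1 = 0 := (mul_eq_zero_iff_right (mul_ne_zero he2 hT)).1 (by
      linear_combination h4 / 2 - h3 - (2 * 2 ^ (e + 1) - 1) * h1)
    have a21 : A 2 1 = 0 := by linear_combination (e + 2) * a01 - h3 + h1
    have a12 : A 1 2 = 0 := (mul_eq_zero_iff_right he2).1 (by linear_combination h5 - h6)
    have a10 : A 1 0 = 0 := (mul_eq_zero_iff_right he2).1 (by
      linear_combination h5 - h7 / 2 + a02 - a12 + a01 / 2 - 2 ^ (e + 1) * a02 +
        2 * 2 ^ (e + 1) * a12)
    refine ⟨A 0 0, A 2 0, ?_⟩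
    have a11 : A 1 1 = -(A 0 0 * (e + 3)) := by linear_combination h1
    have a22 : A 2 2 = A 0 0 * ((e + 2) ^ 2 + (e + 2) - 1) := by
      linear_combination -h5 - a02 + a12 - a01 - (e + 2) * a10 - (e + 2) * a11
    ext i j
    fin_cases i <;> fin_cases j <;>
      simp [weight₁, lowerLeft, a02, a01, a21, a12, a10, a11, a22]
    ring
  · rintro ⟨t, s, rfl⟩
    exact add_mem ((annih _).smul_mem t (weight₁_mem_annih hd))
      ((annih _).smul_mem s (lowerLeft_mem_annih_form₁ d))

/-- As for `form₁ d`, the entries of `A` are determined by evaluation at points with coordinates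
`0`, `1`, `2`. -/
lemma mem_annih_form₂_iff {d : ℕ} (hd : 2 ≤ d) {A : Mat} :
    A ∈ annih (form₂ d : Fin 3 → Poly) ↔ ∃ t s : ℂ, A = t • weight₂ d + s • lowerLeft := by
  constructor
  · intro h
    have hv : ∀ (j : Fin 3) (x y z : ℂ), eval ![x, y, z] (lie A (form₂ d) j) = 0 := by
      intro j x y z
      rw [mem_annih.1 h]
      simp
    simp only [eval_lie] at hv
    obtain ⟨e, rfl⟩ : ∃ e, d = e + 2 := ⟨d - 2, by omega⟩
    have h1 := hv 2 0 1 0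
    have h2 := hv 2 1 0 0
    have h3 := hv 2 1 1 0
    have h4 := hv 2 1 2 0
    have h5 := hv 1 1 0 0
    have h6 := hv 1 1 1 0
    have h7 := hv 1 2 1 0
    simp [form₂, Fin.sum_univ_three, pderiv_X, Derivation.leibniz_pow] at h1 h2 h3 h4 h5 h6 h7
    have he2 : ((e : ℂ) + 2) ≠ 0 := by exact_mod_cast (by omega : e + 2 ≠ 0)
    have he3 : ((e : ℂ) + 3) ≠ 0 := by exact_mod_cast (by omega : e + 3 ≠ 0)
    have hT : (2 : ℂ) ^ (e + 1) - 1 ≠ 0 :=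
      sub_ne_zero.2 (by exact_mod_cast (Nat.one_lt_two_pow (by omega : e + 1 ≠ 0)).ne')
    have a12 : A 1 2 = 0 := (mul_eq_zero_iff_right hT).1 (by
      linear_combination h4 / 2 - h3 + h2 / 2 + 2 ^ (e + 2) * h1 - h1)
    have a01 : A 0 1 = 0 := (mul_eq_zero_iff_right he3).1 (by
      linear_combination h2 - h3 - h1 + a12)
    have a10 : A 1 0 = 0 := (mul_eq_zero_iff_right he2).1 (by
      linear_combination h7 / 2 - h6 + 2 ^ (e + 2) * h5 - h5)
    refine ⟨-A 1 1, A 2 0, ?_⟩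
    have a00 : A 0 0 = -(A 1 1 * (e + 3)) := by linear_combination h6 + h5 - (e + 2) * a10
    have a22 : A 2 2 = A 1 1 * (e + 3) ^ 2 := by
      linear_combination -h2 - (e + 3) * a00
    ext i j
    fin_cases i <;> fin_cases j <;>
      simp [weight₂, lowerLeft, h1, h5, a01, a12, a10, a00, a22] <;> first | ring1 | (left; ring1)
  · rintro ⟨t, s, rfl⟩
    exact add_mem ((annih _).smul_mem t (weight₂_mem_annih hd))
      ((annih _).smul_mem s (lowerLeft_mem_annih_form₂ d))

/-! ### Orbits and isotropy groups in terms of forms -/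

lemma mk_smul_ofForm_eq_iff {d : ℕ} (g : GL (Fin 3) ℂ) {ω η : formSpace d}
    (hω : Saturated (ω : Fin 3 → Poly)) (hη : Saturated (η : Fin 3 → Poly)) :
    Matrix.ProjGenLinGroup.mk g • Foliation.ofForm ω hω = Foliation.ofForm η hη ↔
      ∃ c : ℂ, c ≠ 0 ∧ pullFun (g⁻¹).1 ω = c • (η : Fin 3 → Poly) := by
  have h1 : (Matrix.ProjGenLinGroup.mk g • Foliation.ofForm ω hω).1 =
      g • Projectivization.mk ℂ ω hω.ne_zero := rfl
  refine (Subtype.ext_iff (p := IsFol)).trans ?_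
  rw [h1]
  change _ = Projectivization.mk ℂ η hη.ne_zero ↔ _
  rw [Projectivization.smul_mk, Projectivization.mk_eq_mk_iff]
  constructor
  · rintro ⟨a, ha⟩
    exact ⟨a, a.ne_zero, (congrArg Subtype.val ha).symm⟩
  · rintro ⟨c, hc, h⟩
    exact ⟨Units.mk0 c hc, Subtype.ext h.symm⟩

lemma exists_eq_ofForm {d : ℕ} (F : Foliation d) :
    ∃ (ω : formSpace d) (h : Saturated (ω : Fin 3 → Poly)), F = Foliation.ofForm ω h := by
  refine ⟨F.1.rep, F.2, Subtype.ext ?_⟩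
  exact (Projectivization.mk_rep _).symm

/-- Although the action is by `g⁻¹`, an element is in the isotropy group if and only if its inverse
is, so that no inverse appears. -/
lemma mk_mem_Iso_iff {d : ℕ} (g : GL (Fin 3) ℂ) {ω : formSpace d}
    (hω : Saturated (ω : Fin 3 → Poly)) :
    Matrix.ProjGenLinGroup.mk g ∈ Iso (Foliation.ofForm ω hω) ↔
      ∃ c : ℂ, c ≠ 0 ∧ pullFun g.1 ω = c • (ω : Fin 3 → Poly) := by
  rw [← inv_mem_iff, MulAction.mem_stabilizer_iff, ← map_inv, mk_smul_ofForm_eq_iff, inv_inv]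

/-- `ω` is a non-zero multiple of the pullback of `η` under a linear automorphism of `ℂ³`. -/
def IsLinConj (η ω : Fin 3 → Poly) : Prop :=
  ∃ (P : Mat) (c : ℂ), IsUnit P ∧ c ≠ 0 ∧ ω = c • pullFun P η

lemma ofForm_mem_orbit_iff {d : ℕ} {ω η : formSpace d} (hω : Saturated (ω : Fin 3 → Poly))
    (hη : Saturated (η : Fin 3 → Poly)) :
    Foliation.ofForm ω hω ∈ orbit (Foliation.ofForm η hη) ↔ IsLinConj η ω := by
  constructor
  · rintro ⟨φ, hφ⟩
    obtain ⟨g, rfl⟩ := Matrix.ProjGenLinGroup.mk_surjective φ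
    obtain ⟨c, hc, h⟩ := (mk_smul_ofForm_eq_iff g hη hω).1 hφ
    exact ⟨(g⁻¹).1, c⁻¹, (g⁻¹).isUnit, inv_ne_zero hc, by rw [h, inv_smul_smul₀ hc]⟩
  · rintro ⟨P, c, ⟨g, rfl⟩, hc, h⟩
    exact ⟨Matrix.ProjGenLinGroup.mk g⁻¹, (mk_smul_ofForm_eq_iff _ hη hω).2
      ⟨c⁻¹, inv_ne_zero hc, by rw [inv_inv, h, inv_smul_smul₀ hc]⟩⟩

lemma isConjModel_iff {d : ℕ} {ω : Fin 3 → Poly} :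
    IsConjModel d ω ↔ IsLinConj (form₁ d) ω ∨ IsLinConj (form₂ d) ω := by
  constructor
  · rintro ⟨P, c, hP, hc, h | h⟩
    exacts [Or.inl ⟨P, c, hP, hc, h⟩, Or.inr ⟨P, c, hP, hc, h⟩]
  · rintro (⟨P, c, hP, hc, h⟩ | ⟨P, c, hP, hc, h⟩)
    exacts [⟨P, c, hP, hc, Or.inl h⟩, ⟨P, c, hP, hc, Or.inr h⟩]

/-! ### Dimension of the annihilator -/

lemma finrank_annih_pullFun_le {P : Mat} (hP : IsUnit P) (ω : Fin 3 → Poly) :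
    Module.finrank ℂ (annih (pullFun P ω)) ≤ Module.finrank ℂ (annih ω) := by
  obtain ⟨P, rfl⟩ := hP
  let f : Mat →ₗ[ℂ] Mat := LinearMap.mulLeft ℂ P.1 ∘ₗ LinearMap.mulRight ℂ (P⁻¹).1
  have hf : ∀ A, P.1 * A = f A * P.1 := fun A => by simp [f, mul_assoc]
  have hmem : ∀ A ∈ annih (pullFun P.1 ω), f A ∈ annih ω := fun A hA =>
    (mem_annih_pullFun_iff P.isUnit (hf A)).1 hA
  refine LinearMap.finrank_le_finrank_of_injective (f := f.restrict hmem) fun A B h => ?_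
  have h1 : f A = f B := congrArg Subtype.val h
  refine Subtype.ext (P.isUnit.mul_left_cancel ?_)
  rw [hf, hf, h1]

lemma finrank_annih_pullFun {P : Mat} (hP : IsUnit P) (ω : Fin 3 → Poly) :
    Module.finrank ℂ (annih (pullFun P ω)) = Module.finrank ℂ (annih ω) := by
  refine le_antisymm (finrank_annih_pullFun_le hP ω) ?_
  obtain ⟨P, rfl⟩ := hP
  have := finrank_annih_pullFun_le (P⁻¹).isUnit (pullFun P.1 ω)
  rwa [← pullFun_mul, ← Units.val_mul, mul_inv_cancel, Units.val_one, pullFun_one] at this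

lemma finrank_span_weight_lowerLeft {W : Mat} (h0 : W 0 0 ≠ 0) :
    Module.finrank ℂ (Submodule.span ℂ {W, lowerLeft}) = 2 := by
  have h : LinearIndependent ℂ ![W, lowerLeft] := by
    refine LinearIndependent.pair_iff.2 fun s t h => ?_
    have e0 := congrFun (congrFun h 0) 0
    have e2 := congrFun (congrFun h 2) 0
    simp [lowerLeft, h0] at e0 e2
    exact ⟨e0, by simpa [e0] using e2⟩
  have h2 := finrank_span_eq_card h
  rwa [Matrix.range_cons_cons_empty] at h2

lemma annih_form₁ {d : ℕ} (hd : 2 ≤ d) :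
    annih (form₁ d : Fin 3 → Poly) = Submodule.span ℂ {weight₁ d, lowerLeft} := by
  ext A
  simp only [mem_annih_form₁_iff hd, Submodule.mem_span_pair, eq_comm]

lemma annih_form₂ {d : ℕ} (hd : 2 ≤ d) :
    annih (form₂ d : Fin 3 → Poly) = Submodule.span ℂ {weight₂ d, lowerLeft} := by
  ext A
  simp only [mem_annih_form₂_iff hd, Submodule.mem_span_pair, eq_comm]

lemma IsConjModel.finrank_annih {d : ℕ} (hd : 2 ≤ d) {ω : Fin 3 → Poly} (h : IsConjModel d ω) :
    Module.finrank ℂ (annih ω) = 2 := by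
  obtain ⟨P, c, hP, hc, rfl | rfl⟩ := h
  · rw [annih_smul hc, finrank_annih_pullFun hP, annih_form₁ hd]
    exact finrank_span_weight_lowerLeft (by simp [weight₁])
  · rw [annih_smul hc, finrank_annih_pullFun hP, annih_form₂ hd]
    exact finrank_span_weight_lowerLeft (by
      simp only [weight₂, Matrix.of_apply, Matrix.cons_val_zero, Matrix.cons_val', ne_eq]
      exact_mod_cast (by omega : d + 1 ≠ 0))

/-! ### The isotropy groups of the model foliations -/

lemma trace_eq_of_conj {M : Mat} (hM : IsUnit M) {A B : Mat} (h : M * A = B * M) :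
    A.trace = B.trace := by
  obtain ⟨M, rfl⟩ := hM
  have : B = M.1 * A * (M⁻¹).1 := by rw [h]; simp [mul_assoc]
  rw [this, Matrix.trace_mul_comm, ← mul_assoc]
  simp

/-- The shape of a matrix `M` normalizing, under conjugation, the span of a diagonal matrix and of
`lowerLeft`. Comparison of traces shows that conjugation maps the diagonal matrix to itself plus a
multiple of `lowerLeft`, and `lowerLeft` to a multiple of itself. -/
lemma entries_of_normalizes {w₀ w₁ w₂ : ℂ} (h01 : w₀ ≠ w₁) (h12 : w₁ ≠ w₂) (htr : w₀ + w₁ + w₂ ≠ 0)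
    {M : Mat} (hM : IsUnit M) {t s t' s' : ℂ}
    (hW : M * (t • !![w₀, 0, 0; 0, w₁, 0; 0, 0, w₂] + s • lowerLeft) =
      !![w₀, 0, 0; 0, w₁, 0; 0, 0, w₂] * M)
    (hL : M * (t' • !![w₀, 0, 0; 0, w₁, 0; 0, 0, w₂] + s' • lowerLeft) = lowerLeft * M) :
    M = !![M 0 0, 0, 0; 0, M 1 1, 0; M 2 0, 0, M 2 2] := by
  have hM0 : lowerLeft * M ≠ 0 := fun h => by
    rw [hM.mul_left_eq_zero] at h
    simpa [lowerLeft] using congrFun (congrFun h 2) 0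
  have ht := trace_eq_of_conj hM hW
  have ht' := trace_eq_of_conj hM hL
  simp [Matrix.trace_fin_three, lowerLeft] at ht ht'
  have et' : t' = 0 := (mul_eq_zero_iff_right htr).1 (by linear_combination ht')
  have et : t = 1 := sub_eq_zero.1 ((mul_eq_zero_iff_right htr).1 (by linear_combination ht))
  subst et' et
  have hs' : s' ≠ 0 := by
    rintro rfl
    exact hM0 (by rw [← hL]; simp)
  have eL : ∀ i j, _ := fun i j => congrFun (congrFun hL i) j
  have eW : ∀ i j, _ := fun i j => congrFun (congrFun hW i) j
  have l21 := eL 2 1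
  have l22 := eL 2 2
  have l10 := eL 1 0
  have w10 := eW 1 0
  have w21 := eW 2 1
  simp [lowerLeft, Matrix.mul_apply, Fin.sum_univ_three, hs'] at l21 l22 l10 w10 w21
  have m10 : M 1 0 = 0 := (mul_eq_zero_iff_right (sub_ne_zero.2 h01)).1 (by
    linear_combination w10 - s * l10)
  have m21 : M 2 1 = 0 := (mul_eq_zero_iff_right (sub_ne_zero.2 h12)).1 (by
    linear_combination w21)
  ext i j
  fin_cases i <;> fin_cases j <;> simp [← l21, ← l22, l10, m10, m21]

/-- A linear automorphism preserving the line of `ω` normalizes the annihilator of `ω`. -/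
lemma entries_of_pullFun_eq {ω : Fin 3 → Poly} {w₀ w₁ w₂ : ℂ} (h01 : w₀ ≠ w₁) (h12 : w₁ ≠ w₂)
    (htr : w₀ + w₁ + w₂ ≠ 0) (hω : ∀ A : Mat, A ∈ annih ω ↔
      ∃ t s : ℂ, A = t • !![w₀, 0, 0; 0, w₁, 0; 0, 0, w₂] + s • lowerLeft)
    {M : Mat} (hM : IsUnit M) {c : ℂ} (hc : c ≠ 0) (h : pullFun M ω = c • ω) :
    M = !![M 0 0, 0, 0; 0, M 1 1, 0; M 2 0, 0, M 2 2] := by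
  have key : ∀ t s : ℂ, ∃ t' s' : ℂ,
      M * (t' • !![w₀, 0, 0; 0, w₁, 0; 0, 0, w₂] + s' • lowerLeft) =
        (t • !![w₀, 0, 0; 0, w₁, 0; 0, 0, w₂] + s • lowerLeft) * M := fun t s => by
    obtain ⟨A', hA'⟩ := exists_conj hM (t • !![w₀, 0, 0; 0, w₁, 0; 0, 0, w₂] + s • lowerLeft)
    have h1 := mem_annih_pullFun hA' ((hω _).2 ⟨t, s, rfl⟩)
    rw [h, annih_smul hc, hω] at h1
    obtain ⟨t', s', rfl⟩ := h1
    exact ⟨t', s', hA'⟩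
  obtain ⟨t, s, hW⟩ := key 1 0
  obtain ⟨t', s', hL⟩ := key 0 1
  simp only [one_smul, zero_smul, add_zero, zero_add] at hW hL
  exact entries_of_normalizes h01 h12 htr hM hW hL

/-- The matrix of the projective transformation `(x, y) ↦ (a x / (1 + β x), b y / (1 + β x))`. -/
def affineMat (a b β : ℂ) : Mat := !![a, 0, 0; 0, b, 0; β, 0, 1]

lemma isUnit_affineMat {a b : ℂ} (ha : a ≠ 0) (hb : b ≠ 0) (β : ℂ) : IsUnit (affineMat a b β) := by
  rw [Matrix.isUnit_iff_isUnit_det]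
  simp [affineMat, Matrix.det_fin_three, ha, hb]

/-- The lower right entry is normalized to `1` by a scalar, which does not change the class in
`PGL(3, ℂ)`. -/
lemma isAffineMap_mk {g : GL (Fin 3) ℂ} (h : (g : Mat) =
      !![g.1 0 0, 0, 0; 0, g.1 1 1, 0; g.1 2 0, 0, g.1 2 2]) :
    (g.1 0 0 ≠ 0 ∧ g.1 1 1 ≠ 0 ∧ g.1 2 2 ≠ 0) ∧ IsAffineMap (Matrix.ProjGenLinGroup.mk g)
      (g.1 0 0 / g.1 2 2) (g.1 1 1 / g.1 2 2) (g.1 2 0 / g.1 2 2) := by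
  have hu := g.isUnit
  rw [Matrix.isUnit_iff_isUnit_det, h] at hu
  simp [Matrix.det_fin_three, not_or] at hu
  obtain ⟨⟨h0, h1⟩, h2⟩ := hu
  refine ⟨⟨h0, h1, h2⟩, g * Matrix.GeneralLinearGroup.scalar (Fin 3) (Units.mk0 _ h2)⁻¹, ?_, ?_⟩
  · rw [Units.val_mul, Matrix.GeneralLinearGroup.coe_scalar]
    nth_rewrite 1 [h]
    ext i j
    fin_cases i <;> fin_cases j <;>
      simp [Matrix.mul_apply, Fin.sum_univ_three, h2, div_eq_mul_inv]
  · exact Matrix.ProjGenLinGroup.mk_eq_mk_iff.2 ⟨_, rfl⟩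

lemma eval_pullFun (M : Mat) (ω : Fin 3 → Poly) (j : Fin 3) (v : Fin 3 → ℂ) :
    eval v (pullFun M ω j) = ∑ i, M i j * eval (M.mulVec v) (ω i) := by
  have h : ∀ p : Poly, eval v (subst M p) = eval (M.mulVec v) p := fun p => by
    induction p using MvPolynomial.induction_on with
    | C c => simp
    | add p q hp hq => simp [hp, hq]
    | mul_X p i hp => simp [hp, subst_X, Matrix.mulVec, dotProduct]
  simp [pullFun, h]

lemma pullFun_affineMat_form₁ (d : ℕ) {a b : ℂ} (h : a ^ d = b ^ (d - 1)) (hd : 2 ≤ d) (β : ℂ) :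
    pullFun (affineMat a b β) (form₁ d : Fin 3 → Poly) =
      (a * b ^ d) • (form₁ d : Fin 3 → Poly) := by
  obtain ⟨e, rfl⟩ : ∃ e, d = e + 2 := ⟨d - 2, by omega⟩
  have h' : (C a ^ (e + 2) : Poly) = C b ^ (e + 1) := by
    rw [← C_pow, ← C_pow]
    exact congrArg C h
  funext j
  rw [Pi.smul_apply, smul_eq_C_mul]
  fin_cases j <;>
    simp only [pullFun, form₁, affineMat, Fin.sum_univ_three, map_sub, map_mul, map_pow, map_neg,
      subst_X, Matrix.cons_val, C_0, C_1, Matrix.of_apply, Fin.zero_eta, Fin.mk_one,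
      Fin.reduceFinMk]
  · linear_combination (-(C a * C b * X 0 ^ (e + 2) * X 1)) * h'
  · linear_combination (C a * C b * X 0 ^ (e + 3)) * h'
  · ring

lemma pullFun_affineMat_form₂ (d : ℕ) {a b : ℂ} (h : a ^ d = b ^ (d + 1)) (β : ℂ) :
    pullFun (affineMat a b β) (form₂ d : Fin 3 → Poly) =
      (a ^ (d + 1)) • (form₂ d : Fin 3 → Poly) := by
  have h' : (C a ^ d : Poly) = C b ^ (d + 1) := by
    rw [← C_pow, ← C_pow]
    exact congrArg C h
  funext j
  rw [Pi.smul_apply, smul_eq_C_mul]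
  fin_cases j <;>
    simp only [pullFun, form₂, affineMat, Fin.sum_univ_three, map_sub, map_mul, map_pow, map_neg,
      subst_X, Matrix.cons_val, C_0, C_1, Matrix.of_apply, Fin.zero_eta, Fin.mk_one,
      Fin.reduceFinMk]
  · linear_combination (C a * X 1 ^ (d + 1)) * h'
  · linear_combination (-C a * X 0 * X 1 ^ d) * h'
  · ring

/-- The isotropy group of `F₁ d`. For a matrix with diagonal `a`, `b`, `c` the parameter is
`α = b / a`. -/
lemma mem_Iso_F₁_iff {d : ℕ} (hd : 2 ≤ d) (φ : PGL(3, ℂ)) : φ ∈ Iso (F₁ d) ↔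
    ∃ α β : ℂ, α ≠ 0 ∧ IsAffineMap φ (α ^ (d - 1)) (α ^ d) β := by
  have hd1 : (d : ℂ) + 2 ≠ 0 := by exact_mod_cast (by omega : d + 2 ≠ 0)
  have hd0 : (d : ℂ) ≠ 0 := by exact_mod_cast (by omega : d ≠ 0)
  have hd2 : (d : ℂ) + 1 ≠ 0 := by exact_mod_cast (by omega : d + 1 ≠ 0)
  have hd3 : (d : ℂ) - 1 ≠ 0 := sub_ne_zero.2 (by exact_mod_cast (by omega : d ≠ 1))
  constructor
  · intro hφ
    obtain ⟨g, rfl⟩ := Matrix.ProjGenLinGroup.mk_surjective φ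
    obtain ⟨c, hc, h⟩ := (mk_mem_Iso_iff g _).1 hφ
    have hg := entries_of_pullFun_eq (w₀ := 1) (w₁ := -((d : ℂ) + 1)) (w₂ := (d : ℂ) ^ 2 + d - 1)
      (fun e => hd1 (by linear_combination e))
      (fun e => mul_ne_zero hd0 hd1 (by linear_combination -e))
      (fun e => mul_ne_zero hd2 hd3 (by linear_combination e)) (fun A => mem_annih_form₁_iff hd)
      g.isUnit hc h
    obtain ⟨⟨h0, h1, h2⟩, hA⟩ := isAffineMap_mk hg
    have e1 := congrArg (eval ![1, 0, 0]) (congrFun h 1)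
    have e2 := congrArg (eval ![1, 1, 0]) (congrFun h 2)
    rw [eval_pullFun, hg] at e1 e2
    simp [form₁, Fin.sum_univ_three] at e1 e2
    refine ⟨g.1 1 1 / g.1 0 0, g.1 2 0 / g.1 2 2, div_ne_zero h1 h0, ?_⟩
    have e3 : g.1 0 0 ^ d = g.1 2 2 * g.1 1 1 ^ (d - 1) :=
      mul_left_cancel₀ (mul_ne_zero h0 h1) (by
        rw [← mul_pow_sub_one (by omega : d ≠ 0) (g.1 1 1)] at e2
        linear_combination e1 - e2)
    convert hA using 1
    · rw [div_pow, div_eq_div_iff (pow_ne_zero _ h0) h2, mul_pow_sub_one (by omega)]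
      linear_combination -e3
    · rw [div_pow, div_eq_div_iff (pow_ne_zero _ h0) h2, e3,
        ← mul_pow_sub_one (by omega : d ≠ 0) (g.1 1 1)]
      ring
  · rintro ⟨α, β, hα, g, hg, rfl⟩
    refine (mk_mem_Iso_iff g _).2 ⟨_, ?_,
      (congrArg (pullFun · _) hg).trans (pullFun_affineMat_form₁ d ?_ hd β)⟩
    · exact mul_ne_zero (pow_ne_zero _ hα) (pow_ne_zero _ (pow_ne_zero _ hα))
    · rw [← pow_mul, ← pow_mul, mul_comm]

/-- The isotropy group of `F₂ d`. For a matrix with diagonal `a`, `b`, `c` the parameter is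
`α = a / b`. -/
lemma mem_Iso_F₂_iff {d : ℕ} (hd : 2 ≤ d) (φ : PGL(3, ℂ)) : φ ∈ Iso (F₂ d) ↔
    ∃ α β : ℂ, α ≠ 0 ∧ IsAffineMap φ (α ^ (d + 1)) (α ^ d) β := by
  have hd1 : (d : ℂ) + 2 ≠ 0 := by exact_mod_cast (by omega : d + 2 ≠ 0)
  have hd0 : (d : ℂ) ≠ 0 := by exact_mod_cast (by omega : d ≠ 0)
  have hd2 : (d : ℂ) ^ 2 + d + 1 ≠ 0 := by exact_mod_cast (by positivity : d ^ 2 + d + 1 ≠ 0)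
  constructor
  · intro hφ
    obtain ⟨g, rfl⟩ := Matrix.ProjGenLinGroup.mk_surjective φ
    obtain ⟨c, hc, h⟩ := (mk_mem_Iso_iff g _).1 hφ
    have hg := entries_of_pullFun_eq (w₀ := (d : ℂ) + 1) (w₁ := -1) (w₂ := -((d : ℂ) + 1) ^ 2)
      (fun e => hd1 (by linear_combination e))
      (fun e => mul_ne_zero hd0 hd1 (by linear_combination e))
      (fun e => hd2 (by linear_combination -e)) (fun A => mem_annih_form₂_iff hd) g.isUnit hc h
    obtain ⟨⟨h0, h1, h2⟩, hA⟩ := isAffineMap_mk hg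
    have e1 := congrArg (eval ![1, 1, 0]) (congrFun h 1)
    have e2 := congrArg (eval ![1, 0, 0]) (congrFun h 2)
    rw [eval_pullFun, hg] at e1 e2
    simp [form₂, Fin.sum_univ_three] at e1 e2
    refine ⟨g.1 0 0 / g.1 1 1, g.1 2 0 / g.1 2 2, div_ne_zero h0 h1, ?_⟩
    have e3 : g.1 1 1 ^ (d + 1) = g.1 2 2 * g.1 0 0 ^ d :=
      mul_left_cancel₀ h0 (by linear_combination e1 - e2)
    convert hA using 1
    · rw [div_pow, div_eq_div_iff (pow_ne_zero _ h1) h2, e3]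
      ring
    · rw [div_pow, div_eq_div_iff (pow_ne_zero _ h1) h2]
      linear_combination -e3
  · rintro ⟨α, β, hα, g, hg, rfl⟩
    refine (mk_mem_Iso_iff g _).2 ⟨_, ?_,
      (congrArg (pullFun · _) hg).trans (pullFun_affineMat_form₂ d ?_ β)⟩
    · exact pow_ne_zero _ (pow_ne_zero _ hα)
    · rw [← pow_mul, ← pow_mul, mul_comm]

/-! ### The isotropy groups are not conjugate -/

lemma det_smul_one_sub_eq {P A B : Mat} (hP : IsUnit P) (h : P * A = B * P) (x : ℂ) :
    (x • (1 : Mat) - A).det = (x • (1 : Mat) - B).det := by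
  have h1 : P * (x • (1 : Mat) - A) = (x • (1 : Mat) - B) * P := by
    rw [mul_sub, sub_mul, h, Matrix.mul_smul, Matrix.smul_mul, mul_one, one_mul]
  have h2 := congrArg Matrix.det h1
  rw [Matrix.det_mul, Matrix.det_mul, mul_comm] at h2
  exact mul_right_cancel₀ ((Matrix.isUnit_iff_isUnit_det _).1 hP).ne_zero h2

/-- The eigenvalues `α ^ (d - 1)`, `α ^ d`, `1` of an element of the isotropy group of `F₁ d` are
not proportional to the eigenvalues `1`, `ζ`, `1` of the element `diag(1, ζ, 1)` of the isotropy
group of `F₂ d`, where `ζ` is a primitive root of unity of order `d + 1`. The factor `u` takes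
account of the scalars in `PGL(3, ℂ)`. -/
lemma eigenvalues_ne {d : ℕ} (hd : 2 ≤ d) {ζ α u : ℂ} (hζ : IsPrimitiveRoot ζ (d + 1))
    (h : ∀ x : ℂ, (x - α ^ (d - 1)) * (x - α ^ d) * (x - 1) = (x - u) * (x - u * ζ) * (x - u)) :
    False := by
  have hpow : ∀ k : ℕ, 0 < k → k < d + 1 → ζ ^ k ≠ 1 := fun k h1 h2 h3 =>
    absurd (Nat.le_of_dvd h1 ((hζ.pow_eq_one_iff_dvd k).1 h3)) (by omega)
  have hζ1 : ζ ≠ 1 := by simpa using hpow 1 one_pos (by omega)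
  have hζ2 : ζ ^ 2 ≠ 1 := hpow 2 two_pos (by omega)
  have hdet : α ^ (d - 1) * α ^ d = u ^ 3 * ζ := by linear_combination -h 0
  have hα : α * α ^ (d - 1) = α ^ d := mul_pow_sub_one (by omega) α
  have root : ∀ x : ℂ, (x - α ^ (d - 1)) * (x - α ^ d) * (x - 1) = 0 → x = u ∨ x = u * ζ := by
    intro x hx
    rw [h x, mul_eq_zero, mul_eq_zero, sub_eq_zero, sub_eq_zero] at hx
    tauto
  have ra := root (α ^ (d - 1)) (by ring)
  have rb := root (α ^ d) (by ring)
  rcases root 1 (by ring) with r1 | r1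
  · subst r1
    rw [one_mul] at ra rb
    rw [one_pow, one_mul] at hdet
    rcases ra with ra | ra <;> rcases rb with rb | rb <;> rw [ra, rb] at hdet hα
    · exact hζ1 (by simpa using hdet.symm)
    · rw [mul_one] at hα
      exact hpow (d - 1) (by omega) (by omega) (hα ▸ ra)
    · refine hpow d (by omega) (by omega) ?_
      have := congrArg (· ^ d) hα
      simpa [mul_pow, rb] using this
    · refine hζ1 (mul_left_cancel₀ (hζ.ne_zero (by omega)) (by rw [hdet, mul_one]))
  · have hu : u ≠ 0 := by
      rintro rfl
      simp at r1
    have hdet' : α ^ (d - 1) * α ^ d = u ^ 2 := by rw [hdet]; linear_combination -u ^ 2 * r1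
    rw [← r1] at ra rb
    rcases ra with ra | ra <;> rcases rb with rb | rb <;> rw [ra, rb] at hdet' hα
    · have h1 : α = 1 := mul_right_cancel₀ hu (by rw [hα, one_mul])
      rw [h1, one_pow] at ra
      exact hζ1 (by rw [← ra, one_mul] at r1; exact r1.symm)
    · have h1 : u = 1 := mul_left_cancel₀ hu (by linear_combination -hdet')
      exact hζ1 (by rw [h1, one_mul] at r1; exact r1.symm)
    · have h1 : u = 1 := mul_left_cancel₀ hu (by linear_combination -hdet')
      exact hζ1 (by rw [h1, one_mul] at r1; exact r1.symm)
    · exact hζ2 (by linear_combination (-(u * ζ) - 1) * r1 + ζ ^ 2 * hdet')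

lemma not_conj_Iso {d : ℕ} (hd : 2 ≤ d) :
    ¬ ∃ φ : PGL(3, ℂ), (Iso (F₁ d)).map (MulAut.conj φ).toMonoidHom = Iso (F₂ d) := by
  rintro ⟨φ, hφ⟩
  have hζ : IsPrimitiveRoot (Complex.exp (2 * Real.pi * Complex.I / ((d + 1 : ℕ) : ℂ))) (d + 1) :=
    Complex.isPrimitiveRoot_exp (d + 1) (by omega)
  set ζ := Complex.exp (2 * Real.pi * Complex.I / ((d + 1 : ℕ) : ℂ))
  have hζ0 : ζ ≠ 0 := hζ.ne_zero (by omega)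
  obtain ⟨D, hD⟩ := isUnit_affineMat (one_ne_zero : (1 : ℂ) ≠ 0) hζ0 0
  have hmem : Matrix.ProjGenLinGroup.mk D ∈ Iso (F₂ d) := by
    refine (mem_Iso_F₂_iff hd _).2 ⟨ζ⁻¹, 0, inv_ne_zero hζ0, D, ?_, rfl⟩
    have h1 : (ζ⁻¹) ^ (d + 1) = 1 := by rw [inv_pow, hζ.pow_eq_one, inv_one]
    have h2 : (ζ⁻¹) ^ d = ζ := by
      refine mul_right_cancel₀ (inv_ne_zero hζ0) ?_
      rw [← pow_succ, h1, mul_inv_cancel₀ hζ0]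
    rw [h1, h2]
    exact hD
  rw [← hφ] at hmem
  obtain ⟨χ, hχ, h⟩ := hmem
  obtain ⟨α, β, hα, g, hg, rfl⟩ := (mem_Iso_F₁_iff hd χ).1 hχ
  obtain ⟨P, rfl⟩ := Matrix.ProjGenLinGroup.mk_surjective φ
  have h1 : Matrix.ProjGenLinGroup.mk (D * P) = Matrix.ProjGenLinGroup.mk (P * g) := by
    rw [map_mul, map_mul, ← h]
    simp
  obtain ⟨u, hu⟩ := Matrix.ProjGenLinGroup.mk_eq_mk_iff.1 h1
  have h2 : P.1 * g.1 = ((u : ℂ) • D.1) * P.1 := by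
    have := congrArg Units.val hu
    rw [Units.val_mul, Units.val_mul, Units.val_mul, Matrix.GeneralLinearGroup.coe_scalar] at this
    rw [← this, Matrix.smul_mul, Matrix.scalar_apply, ← Matrix.smul_one_eq_diagonal,
      Matrix.mul_smul, mul_one]
  refine eigenvalues_ne hd hζ (α := α) (u := u) fun x => ?_
  have h3 := det_smul_one_sub_eq P.isUnit h2 x
  rw [hg, hD] at h3
  simp [affineMat, Matrix.det_fin_three] at h3
  linear_combination h3

lemma orbit_F₁_ne {d : ℕ} (hd : 2 ≤ d) : orbit (F₁ d) ≠ orbit (F₂ d) := by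
  intro h
  have hmem : F₂ d ∈ orbit (F₁ d) := h ▸ MulAction.mem_orbit_self _
  obtain ⟨φ, hφ⟩ := hmem
  refine not_conj_Iso hd ⟨φ, ?_⟩
  rw [Iso, ← MulAction.stabilizer_smul_eq_stabilizer_map_conj]
  exact congrArg Iso hφ

/-! ### The rank of the infinitesimal action -/

/-- The infinitesimal action `A ↦ lie A ω` at `ω`, as a map into the space of forms. -/
def lieForm {d : ℕ} (ω : formSpace d) : Mat →ₗ[ℂ] formSpace d :=
  (lieLeft (ω : Fin 3 → Poly)).codRestrict (formSpace d) fun A => lie_mem A ω.2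

lemma coe_lieForm {d : ℕ} (ω : formSpace d) (A : Mat) :
    (lieForm ω A : Fin 3 → Poly) = lie A ω := rfl

/-- The infinitesimal action of a fixed matrix `A`, as a linear map in the form: `lieOn d A ω` is
`lieForm ω A`. -/
def lieOn (d : ℕ) (A : Mat) : formSpace d →ₗ[ℂ] formSpace d :=
  (lieRight A).restrict fun _ hω => lie_mem A hω

lemma lieForm_eq_zero_iff {d : ℕ} {ω : formSpace d} {A : Mat} :
    lieForm ω A = 0 ↔ A ∈ annih (ω : Fin 3 → Poly) := by
  rw [mem_annih, ← coe_lieForm, Submodule.coe_eq_zero]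

lemma finrank_range_lieForm {d : ℕ} (ω : formSpace d) :
    Module.finrank ℂ (LinearMap.range (lieForm ω)) +
      Module.finrank ℂ (annih (ω : Fin 3 → Poly)) = 9 := by
  have h := LinearMap.finrank_range_add_finrank_ker (lieForm ω)
  have hk : LinearMap.ker (lieForm ω) = annih (ω : Fin 3 → Poly) := by
    ext A
    rw [LinearMap.mem_ker, lieForm_eq_zero_iff]
  rw [hk] at h
  simpa [Module.finrank_matrix] using h

/-- A linear map of rank at least `k` has the identity matrix of size `k` as a submatrix, for
suitable vectors and linear forms. -/
lemma exists_dual_family {V W : Type*} [AddCommGroup V] [Module ℂ V] [AddCommGroup W] [Module ℂ W]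
    (f : V →ₗ[ℂ] W) {k : ℕ} (hk : k ≤ Module.finrank ℂ (LinearMap.range f)) :
    ∃ (A : Fin k → V) (ℓ : Fin k → Module.Dual ℂ W),
      ∀ a b, ℓ a (f (A b)) = (1 : Matrix (Fin k) (Fin k) ℂ) a b := by
  obtain ⟨w, hw⟩ := exists_linearIndependent_of_le_finrank hk
  choose A hA using fun b => (w b).2
  have hw' : LinearIndependent ℂ fun b => (w b : W) :=
    hw.map' (LinearMap.range f).subtype (Submodule.ker_subtype _)
  obtain ⟨g, hg⟩ := LinearMap.exists_leftInverse_of_injective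
    (Fintype.linearCombination ℂ fun b => (w b : W))
    (LinearMap.ker_eq_bot.2 hw'.fintypeLinearCombination_injective)
  refine ⟨A, fun a => LinearMap.proj a ∘ₗ g, fun a b => ?_⟩
  have h := LinearMap.congr_fun hg (Pi.single b 1)
  simp only [LinearMap.comp_apply, Fintype.linearCombination_apply_single, one_smul,
    LinearMap.id_apply] at h
  rw [LinearMap.comp_apply, hA, h, LinearMap.proj_apply, Pi.single_apply, Matrix.one_apply]

/-- The matrix of the values of linear forms `ℓ a` on the vectors `lie (A b) ω`. -/
def lieMatrix {d m n : ℕ} (ℓ : Fin m → Module.Dual ℂ (formSpace d)) (A : Fin n → Mat)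
    (ω : formSpace d) : Matrix (Fin m) (Fin n) ℂ := Matrix.of fun a b => ℓ a (lieForm ω (A b))

/-- The annihilator of `ω` is at least two-dimensional if and only if all minors of size `8` of the
infinitesimal action at `ω` vanish. -/
lemma two_le_finrank_annih_iff {d : ℕ} (ω : formSpace d) :
    2 ≤ Module.finrank ℂ (annih (ω : Fin 3 → Poly)) ↔
      ∀ (ℓ : Fin 8 → Module.Dual ℂ (formSpace d)) (A : Fin 8 → Mat), (lieMatrix ℓ A ω).det = 0 := by
  have h9 := finrank_range_lieForm ω
  constructor
  · intro h ℓ A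
    have hdep : ¬ LinearIndependent ℂ fun b => lieForm ω (A b) := fun hi => by
      have h1 : LinearIndependent ℂ ((lieForm ω).rangeRestrict ∘ A) :=
        LinearIndependent.of_comp (LinearMap.range (lieForm ω)).subtype hi
      have := h1.fintype_card_le_finrank
      rw [Fintype.card_fin] at this
      omega
    obtain ⟨c, hc, b, hb⟩ := Fintype.not_linearIndependent_iff.1 hdep
    refine Matrix.exists_mulVec_eq_zero_iff.1 ⟨c, fun h => hb (congrFun h b), ?_⟩
    funext a
    have := congrArg (ℓ a) hc
    simpa [lieMatrix, Matrix.mulVec, dotProduct, mul_comm] using this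
  · intro h
    by_contra hlt
    obtain ⟨A, ℓ, hA⟩ := exists_dual_family (lieForm ω) (k := 8) (by omega)
    have h1 : lieMatrix ℓ A ω = 1 := by
      ext a b
      exact hA a b
    simpa [h1] using h ℓ A

/-- Cramer's rule for elements of the annihilator: the combination of the `A b` whose coefficients
are the signed maximal minors of the `7 × 8` matrix `lieMatrix ℓ A ω`. Its entries are homogeneous
polynomials of degree `7` in `ω`. -/
def cramerMat {d : ℕ} (ℓ : Fin 7 → Module.Dual ℂ (formSpace d)) (A : Fin 8 → Mat)
    (ω : formSpace d) : Mat :=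
  ∑ b : Fin 8, ((-1) ^ (b : ℕ) * (lieMatrix ℓ (fun b' => A (b.succAbove b')) ω).det) • A b

/-- A linear form `ℓ'` on `lie (cramerMat ℓ A ω) ω` is the expansion along the first row of a minor
of size `8`, which vanishes. -/
lemma cramerMat_mem_annih {d : ℕ} {ω : formSpace d}
    (h : 2 ≤ Module.finrank ℂ (annih (ω : Fin 3 → Poly)))
    (ℓ : Fin 7 → Module.Dual ℂ (formSpace d)) (A : Fin 8 → Mat) :
    cramerMat ℓ A ω ∈ annih (ω : Fin 3 → Poly) := by
  rw [← lieForm_eq_zero_iff, ← Module.forall_dual_apply_eq_zero_iff ℂ]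
  intro ℓ'
  have h0 := (two_le_finrank_annih_iff ω).1 h (Fin.cons ℓ' ℓ) A
  rw [Matrix.det_succ_row_zero] at h0
  rw [← h0, cramerMat, map_sum, map_sum]
  refine Finset.sum_congr rfl fun b _ => ?_
  rw [map_smul, map_smul, smul_eq_mul, mul_right_comm]
  rfl

/-- If the rank of the infinitesimal action is exactly `7`, Cramer's rule gives all elements `B` of
the annihilator: extend `B` by seven matrices on which the linear forms `ℓ` are the identity. -/
lemma exists_cramerMat_eq {d : ℕ} {ω : formSpace d}
    (h : Module.finrank ℂ (annih (ω : Fin 3 → Poly)) = 2) {B : Mat}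
    (hB : B ∈ annih (ω : Fin 3 → Poly)) :
    ∃ (ℓ : Fin 7 → Module.Dual ℂ (formSpace d)) (A : Fin 8 → Mat), cramerMat ℓ A ω = B := by
  have h9 := finrank_range_lieForm ω
  obtain ⟨A, ℓ, hA⟩ := exists_dual_family (lieForm ω) (k := 7) (by omega)
  refine ⟨ℓ, Fin.cons B A, ?_⟩
  rw [cramerMat, Fin.sum_univ_succ, Finset.sum_eq_zero]
  · have h1 : lieMatrix ℓ A ω = 1 := by
      ext a b
      exact hA a b
    simp [h1]
  · intro b _
    rw [Matrix.det_eq_zero_of_column_eq_zero 0, mul_zero, zero_smul]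
    intro a
    simp only [lieMatrix, Matrix.of_apply, Fin.succ_succAbove_zero, Fin.cons_zero]
    rw [lieForm_eq_zero_iff.2 hB, map_zero]

/-! ### Homogeneous polynomial functions -/

section

variable {E : Type*} [AddCommGroup E] [Module ℂ E]

/-- `f` is given by a homogeneous polynomial of degree `n` in the linear forms on `E`. -/
def IsHomFun (n : ℕ) (f : E → ℂ) : Prop :=
  ∃ P : MvPolynomial (Module.Dual ℂ E) ℂ, P.IsHomogeneous n ∧
    ∀ e, eval (fun ℓ : Module.Dual ℂ E => ℓ e) P = f e

lemma IsHomFun.dual (ℓ : Module.Dual ℂ E) : IsHomFun 1 fun e => ℓ e :=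
  ⟨X ℓ, isHomogeneous_X _ _, fun e => by simp⟩

lemma IsHomFun.const (c : ℂ) : IsHomFun 0 fun _ : E => c :=
  ⟨C c, isHomogeneous_C _ _, fun e => by simp⟩

lemma IsHomFun.mul {m n : ℕ} {f g : E → ℂ} (hf : IsHomFun m f) (hg : IsHomFun n g) :
    IsHomFun (m + n) fun e => f e * g e := by
  obtain ⟨P, hP, hPe⟩ := hf
  obtain ⟨Q, hQ, hQe⟩ := hg
  exact ⟨P * Q, hP.mul hQ, fun e => by rw [map_mul, hPe, hQe]⟩

lemma IsHomFun.const_mul {n : ℕ} {f : E → ℂ} (hf : IsHomFun n f) (c : ℂ) :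
    IsHomFun n fun e => c * f e := by
  simpa using (IsHomFun.const c).mul hf

lemma IsHomFun.sum {ι : Type*} (s : Finset ι) {n : ℕ} {f : ι → E → ℂ} (h : ∀ i, IsHomFun n (f i)) :
    IsHomFun n fun e => ∑ i ∈ s, f i e := by
  choose P hP hPe using h
  exact ⟨∑ i ∈ s, P i, IsHomogeneous.sum _ _ _ fun i _ => hP i, fun e => by simp [hPe]⟩

lemma IsHomFun.sub {n : ℕ} {f g : E → ℂ} (hf : IsHomFun n f) (hg : IsHomFun n g) :
    IsHomFun n fun e => f e - g e := by
  obtain ⟨P, hP, hPe⟩ := hf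
  obtain ⟨Q, hQ, hQe⟩ := hg
  exact ⟨P - Q, hP.sub hQ, fun e => by rw [map_sub, hPe, hQe]⟩

lemma IsHomFun.det {n : ℕ} {M : E → Matrix (Fin n) (Fin n) ℂ}
    (h : ∀ a b, IsHomFun 1 fun e => M e a b) : IsHomFun n fun e => (M e).det := by
  choose P hP hPe using h
  refine ⟨(Matrix.of P).det, ?_, fun e => ?_⟩
  · rw [Matrix.det_apply]
    refine IsHomogeneous.sum _ _ _ fun σ _ => ?_
    have h1 : (∏ i, Matrix.of P (σ i) i).IsHomogeneous (∑ _i : Fin n, 1) :=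
      IsHomogeneous.prod _ _ _ fun i _ => hP _ _
    rw [Finset.sum_const, Finset.card_univ, Fintype.card_fin, smul_eq_mul, mul_one] at h1
    rcases Int.units_eq_one_or (Equiv.Perm.sign σ) with h2 | h2 <;> rw [h2]
    · simpa using h1
    · simpa using h1.neg
  · rw [RingHom.map_det]
    congr 1
    ext a b
    exact hPe a b e

lemma isZariskiClosed_of_isHomFun (T : Set (E → ℂ)) (hT : ∀ f ∈ T, ∃ n, IsHomFun n f) :
    IsZariskiClosed {p : ℙ ℂ E | ∀ f ∈ T, f p.rep = 0} := by
  refine ⟨{P | (∃ n, P.IsHomogeneous n) ∧ (fun e => eval (fun ℓ : Module.Dual ℂ E => ℓ e) P) ∈ T},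
    fun P hP => hP.1, fun p => ⟨fun h P hP => h _ hP.2, fun h f hf => ?_⟩⟩
  obtain ⟨n, P, hP, hPe⟩ := hT f hf
  rw [← hPe]
  refine h P ⟨⟨n, hP⟩, ?_⟩
  rw [funext hPe]
  exact hf

end

/-! ### The orbits of the model foliations are closed -/

/-- A quadratic form, invariant under conjugation and vanishing at `W`. -/
def traceForm (W A : Mat) : ℂ := (A * A).trace * W.trace ^ 2 - (W * W).trace * A.trace ^ 2

lemma traceForm_conj {P A A' : Mat} (hP : IsUnit P) (h : P * A' = A * P) (W : Mat) :
    traceForm W A' = traceForm W A := by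
  have h2 : P * (A' * A') = (A * A) * P := by rw [← mul_assoc, h, mul_assoc, h, mul_assoc]
  rw [traceForm, traceForm, trace_eq_of_conj hP h, trace_eq_of_conj hP h2]

/-- `traceForm W` vanishes on the span of the diagonal matrix `W` and of `lowerLeft`, since
`lowerLeft` does not contribute to the traces. -/
lemma traceForm_self (w₀ w₁ w₂ t s : ℂ) :
    traceForm !![w₀, 0, 0; 0, w₁, 0; 0, 0, w₂]
      (t • !![w₀, 0, 0; 0, w₁, 0; 0, 0, w₂] + s • lowerLeft) = 0 := by
  simp [traceForm, lowerLeft, Matrix.trace_fin_three]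
  ring

/-- Up to sign, this number is the value of `traceForm (weight₁ d)` at `weight₂ d` and of
`traceForm (weight₂ d)` at `weight₁ d`. -/
lemma weights_trace_ne {d : ℕ} (hd : 2 ≤ d) :
    2 * (d : ℂ) ^ 2 * ((d : ℂ) + 2) ^ 2 * ((d : ℂ) ^ 2 + d + 1) ≠ 0 := by
  have h1 : (d : ℂ) ≠ 0 := by exact_mod_cast (by omega : d ≠ 0)
  have h2 : (d : ℂ) + 2 ≠ 0 := by exact_mod_cast (by omega : d + 2 ≠ 0)
  have h3 : (d : ℂ) ^ 2 + d + 1 ≠ 0 := by exact_mod_cast (by positivity : d ^ 2 + d + 1 ≠ 0)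
  simp [h1, h2, h3]

lemma traceForm_weight₁_weight₂ {d : ℕ} (hd : 2 ≤ d) : traceForm (weight₁ d) (weight₂ d) ≠ 0 := by
  refine fun h => weights_trace_ne hd ?_
  simp [traceForm, weight₁, weight₂, Matrix.trace_fin_three] at h
  linear_combination -h

lemma traceForm_weight₂_weight₁ {d : ℕ} (hd : 2 ≤ d) : traceForm (weight₂ d) (weight₁ d) ≠ 0 := by
  refine fun h => weights_trace_ne hd ?_
  simp [traceForm, weight₁, weight₂, Matrix.trace_fin_three] at h
  linear_combination h

lemma isHomFun_lieMatrix_det {d n : ℕ} (ℓ : Fin n → Module.Dual ℂ (formSpace d)) (A : Fin n → Mat) :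
    IsHomFun n fun ω => (lieMatrix ℓ A ω).det :=
  IsHomFun.det fun a b => IsHomFun.dual (ℓ a ∘ₗ lieOn d (A b))

lemma isHomFun_traceForm_cramerMat {d : ℕ} (W : Mat) (ℓ : Fin 7 → Module.Dual ℂ (formSpace d))
    (A : Fin 8 → Mat) : IsHomFun (7 + 7) fun ω => traceForm W (cramerMat ℓ A ω) := by
  have h : ∀ i j, IsHomFun 7 fun ω => cramerMat ℓ A ω i j := fun i j => by
    simp only [cramerMat, Matrix.sum_apply, Matrix.smul_apply, smul_eq_mul]
    refine IsHomFun.sum _ fun b => ?_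
    have := (isHomFun_lieMatrix_det ℓ fun b' => A (b.succAbove b')).const_mul
      ((-1) ^ (b : ℕ) * A b i j)
    simpa only [mul_right_comm] using this
  simp only [traceForm, Matrix.trace, Matrix.diag, Matrix.mul_apply, sq (∑ i, cramerMat ℓ A _ i i)]
  refine IsHomFun.sub ?_ (((IsHomFun.sum _ fun i => h i i).mul
    (IsHomFun.sum _ fun i => h i i)).const_mul _)
  simp only [mul_comm _ ((∑ i, W i i) ^ 2)]
  exact (IsHomFun.sum _ fun i => IsHomFun.sum _ fun j => (h i j).mul (h j i)).const_mul _

/-- If the orbit of `η` is characterized, among the saturated forms, by the vanishing of the minors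
of size `8` and of `traceForm W` at the elements of the annihilator given by Cramer's rule, then it
is closed. -/
lemma isClosedInFol_of_traceForm {d : ℕ} {η : formSpace d} (hη : Saturated (η : Fin 3 → Poly))
    (W : Mat)
    (h : ∀ ω : formSpace d, Saturated (ω : Fin 3 → Poly) → (IsLinConj η ω ↔
      2 ≤ Module.finrank ℂ (annih (ω : Fin 3 → Poly)) ∧
        ∀ (ℓ : Fin 7 → Module.Dual ℂ (formSpace d)) (A : Fin 8 → Mat),
          traceForm W (cramerMat ℓ A ω) = 0)) :
    IsClosedInFol (orbit (Foliation.ofForm η hη)) := by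
  refine ⟨_, isZariskiClosed_of_isHomFun
    {f | (∃ (ℓ : Fin 8 → Module.Dual ℂ (formSpace d)) (A : Fin 8 → Mat),
        f = fun ω => (lieMatrix ℓ A ω).det) ∨
      ∃ (ℓ : Fin 7 → Module.Dual ℂ (formSpace d)) (A : Fin 8 → Mat),
        f = fun ω => traceForm W (cramerMat ℓ A ω)} ?_, fun F => ?_⟩
  · rintro f (⟨ℓ, A, rfl⟩ | ⟨ℓ, A, rfl⟩)
    exacts [⟨_, isHomFun_lieMatrix_det ℓ A⟩, ⟨_, isHomFun_traceForm_cramerMat W ℓ A⟩]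
  · have hF : F = Foliation.ofForm F.1.rep F.2 := Subtype.ext (Projectivization.mk_rep _).symm
    refine (iff_of_eq (congrArg (· ∈ orbit _) hF)).trans ((ofForm_mem_orbit_iff _ _).trans ?_)
    rw [h _ F.2, two_le_finrank_annih_iff]
    constructor
    · rintro ⟨h1, h2⟩ f (⟨ℓ, A, rfl⟩ | ⟨ℓ, A, rfl⟩)
      exacts [h1 ℓ A, h2 ℓ A]
    · exact fun h1 => ⟨fun ℓ A => h1 _ (Or.inl ⟨ℓ, A, rfl⟩), fun ℓ A => h1 _ (Or.inr ⟨ℓ, A, rfl⟩)⟩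

/-- On the annihilator of a form conjugate to `η` the form `traceForm W` takes the same values as on
the annihilator of `η`. -/
lemma IsLinConj.exists_traceForm_eq {η ω : Fin 3 → Poly} (h : IsLinConj η ω) :
    (∀ A ∈ annih ω, ∃ B ∈ annih η, ∀ W, traceForm W A = traceForm W B) ∧
      ∀ B ∈ annih η, ∃ A ∈ annih ω, ∀ W, traceForm W A = traceForm W B := by
  obtain ⟨P, c, hP, hc, rfl⟩ := h
  rw [annih_smul hc]
  constructor
  · intro A hA
    obtain ⟨P, rfl⟩ := hP
    have hB : P.1 * A = (P.1 * A * (P⁻¹).1) * P.1 := by simp [mul_assoc]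
    exact ⟨_, (mem_annih_pullFun_iff P.isUnit hB).1 hA, traceForm_conj P.isUnit hB⟩
  · intro B hB
    obtain ⟨A, hA⟩ := exists_conj hP B
    exact ⟨A, mem_annih_pullFun hA hB, traceForm_conj hP hA⟩

lemma isClosedInFol_orbit_F₁ {d : ℕ} (hd : 2 ≤ d) : IsClosedInFol (orbit (F₁ d)) := by
  refine isClosedInFol_of_traceForm _ (weight₁ d) fun ω hω => ⟨fun h => ?_, fun h => ?_⟩
  · have h2 := (isConjModel_iff.2 (Or.inl h)).finrank_annih hd
    refine ⟨h2.ge, fun ℓ A => ?_⟩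
    obtain ⟨B, hB, hW⟩ := h.exists_traceForm_eq.1 _ (cramerMat_mem_annih h2.ge ℓ A)
    obtain ⟨t, s, rfl⟩ := (mem_annih_form₁_iff hd).1 hB
    rw [hW]
    exact traceForm_self _ _ _ t s
  · have hm := isConjModel_of_two_le_finrank hd ω.2 hω h.1
    refine (isConjModel_iff.1 hm).resolve_right fun h' => ?_
    obtain ⟨A, hA, hW⟩ := h'.exists_traceForm_eq.2 _ (weight₂_mem_annih hd)
    obtain ⟨ℓ, A', rfl⟩ := exists_cramerMat_eq (hm.finrank_annih hd) hA
    exact traceForm_weight₁_weight₂ hd (by rw [← hW, h.2])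

lemma isClosedInFol_orbit_F₂ {d : ℕ} (hd : 2 ≤ d) : IsClosedInFol (orbit (F₂ d)) := by
  refine isClosedInFol_of_traceForm _ (weight₂ d) fun ω hω => ⟨fun h => ?_, fun h => ?_⟩
  · have h2 := (isConjModel_iff.2 (Or.inr h)).finrank_annih hd
    refine ⟨h2.ge, fun ℓ A => ?_⟩
    obtain ⟨B, hB, hW⟩ := h.exists_traceForm_eq.1 _ (cramerMat_mem_annih h2.ge ℓ A)
    obtain ⟨t, s, rfl⟩ := (mem_annih_form₂_iff hd).1 hB
    rw [hW]
    exact traceForm_self _ _ _ t s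
  · have hm := isConjModel_of_two_le_finrank hd ω.2 hω h.1
    refine (isConjModel_iff.1 hm).resolve_left fun h' => ?_
    obtain ⟨A, hA, hW⟩ := h'.exists_traceForm_eq.2 _ (weight₁_mem_annih hd)
    obtain ⟨ℓ, A', rfl⟩ := exists_cramerMat_eq (hm.finrank_annih hd) hA
    exact traceForm_weight₂_weight₁ hd (by rw [← hW, h.2])

/-! ### Differentiating pullbacks -/

instance (d : ℕ) : FiniteDimensional ℂ (formSpace d) := by
  have : FiniteDimensional ℂ (homogeneousSubmodule (Fin 3) ℂ (d + 1)) :=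
    Module.Finite.iff_fg.2 (homogeneousSubmodule_fg _ _ _)
  let f : formSpace d →ₗ[ℂ] (Fin 3 → homogeneousSubmodule (Fin 3) ℂ (d + 1)) :=
    { toFun := fun ω i => ⟨ω.1 i, ω.2.1 i⟩
      map_add' := fun _ _ => rfl
      map_smul' := fun _ _ => rfl }
  refine FiniteDimensional.of_injective f fun ω η h => Subtype.ext (funext fun i => ?_)
  exact congrArg Subtype.val (congrFun h i)

/-- The value at the point `v` of the `j`-th coefficient of a 1-form. -/
def evalForm (d : ℕ) (j : Fin 3) (v : Fin 3 → ℂ) : Module.Dual ℂ (formSpace d) where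
  toFun ω := eval v (ω.1 j)
  map_add' _ _ := by simp
  map_smul' _ _ := by simp

/-- The evaluations span the dual of the space of forms. -/
lemma dual_formSpace_induction {d : ℕ} {p : Module.Dual ℂ (formSpace d) → Prop}
    (hev : ∀ j v, p (evalForm d j v)) (hzero : p 0) (hadd : ∀ ℓ ℓ', p ℓ → p ℓ' → p (ℓ + ℓ'))
    (hsmul : ∀ (c : ℂ) ℓ, p ℓ → p (c • ℓ)) (ℓ : Module.Dual ℂ (formSpace d)) : p ℓ := by
  set S : Submodule ℂ (Module.Dual ℂ (formSpace d)) :=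
    Submodule.span ℂ (Set.range fun x : Fin 3 × (Fin 3 → ℂ) => evalForm d x.1 x.2) with hS
  have h0 : S.dualCoannihilator = ⊥ := by
    rw [eq_bot_iff]
    intro ω hω
    rw [Submodule.mem_dualCoannihilator] at hω
    rw [Submodule.mem_bot]
    refine Subtype.ext (funext fun j => MvPolynomial.funext fun v => ?_)
    rw [Submodule.coe_zero, Pi.zero_apply, map_zero]
    exact hω _ (Submodule.subset_span ⟨(j, v), rfl⟩)
  have h1 : S = ⊤ := by
    rw [← Subspace.dualCoannihilator_dualAnnihilator_eq (W := S), h0,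
      Submodule.dualAnnihilator_bot]
  have h2 : ℓ ∈ S := h1 ▸ Submodule.mem_top
  refine Submodule.span_induction (p := fun ℓ _ => p ℓ) ?_ hzero (fun _ _ _ _ => hadd _ _)
    (fun c _ _ => hsmul c _) h2
  rintro _ ⟨x, rfl⟩
  exact hev _ _

lemma hasDerivAt_eval {w : ℂ → Fin 3 → ℂ} {w' : Fin 3 → ℂ} {t₀ : ℂ}
    (h : ∀ k, HasDerivAt (fun t => w t k) (w' k) t₀) (p : Poly) :
    HasDerivAt (fun t => eval (w t) p) (∑ k, w' k * eval (w t₀) (pderiv k p)) t₀ := by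
  induction p using MvPolynomial.induction_on with
  | C c => simpa using hasDerivAt_const t₀ c
  | add p q hp hq => simpa [mul_add, Finset.sum_add_distrib] using hp.fun_add hq
  | mul_X p i hp =>
    have := hp.mul (h i)
    simp only [map_mul, eval_X]
    refine this.congr_deriv ?_
    simp only [pderiv_mul, pderiv_X, map_add, map_mul, eval_X, mul_add, Finset.sum_add_distrib,
      Finset.sum_mul]
    congr 1
    · exact Finset.sum_congr rfl fun k _ => by ring
    · rw [Finset.sum_eq_single i]
      · simp [mul_comm]
      · intro k _ hk
        simp [hk.symm]
      · simp

/-- The derivative of the pullback `M(t)^* ω` is `M(t₀)^* (lie A ω)` if `M'(t₀) = A M(t₀)`. -/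
lemma hasDerivAt_pull {d : ℕ} (ω : formSpace d) {M : ℂ → Mat} {A : Mat} {t₀ : ℂ}
    (h : ∀ i j, HasDerivAt (fun t => M t i j) ((A * M t₀) i j) t₀)
    (ℓ : Module.Dual ℂ (formSpace d)) :
    HasDerivAt (fun t => ℓ (pull d (M t) ω)) (ℓ (pull d (M t₀) (lieForm ω A))) t₀ := by
  induction ℓ using dual_formSpace_induction with
  | hev j v =>
    have h1 : ∀ t, evalForm d j v (pull d (M t) ω) =
        ∑ i, M t i j * eval ((M t).mulVec v) (ω.1 i) := fun t => eval_pullFun _ _ _ _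
    have h2 : ∀ k, HasDerivAt (fun t => (M t).mulVec v k) ((A * M t₀).mulVec v k) t₀ := fun k => by
      simp only [Matrix.mulVec, dotProduct]
      exact HasDerivAt.fun_sum fun i _ => (h k i).mul_const _
    simp only [h1]
    refine (HasDerivAt.fun_sum fun i _ => (h i j).mul (hasDerivAt_eval h2 (ω.1 i))).congr_deriv ?_
    have h3 : evalForm d j v (pull d (M t₀) (lieForm ω A)) =
      ∑ i, M t₀ i j * eval ((M t₀).mulVec v) (lie A ω i) := eval_pullFun _ _ _ _
    rw [h3]
    simp only [eval_lie, ← Matrix.mulVec_mulVec]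
    simp only [Matrix.mulVec, dotProduct, Matrix.mul_apply, Fin.sum_univ_three]
    ring
  | hzero => simpa using hasDerivAt_const t₀ (0 : ℂ)
  | hadd ℓ ℓ' h1 h2 => exact h1.add h2
  | hsmul c ℓ h1 => exact h1.const_mul c

lemma contDiff_pull {d : ℕ} (ω : formSpace d) {V : Type*} [NormedAddCommGroup V] [NormedSpace ℂ V]
    {M : V → Mat} (h : ∀ i j, ContDiff ℂ 1 fun u => M u i j) (ℓ : Module.Dual ℂ (formSpace d)) :
    ContDiff ℂ 1 fun u => ℓ (pull d (M u) ω) := by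
  induction ℓ using dual_formSpace_induction with
  | hev j v =>
    have h1 : ∀ u, evalForm d j v (pull d (M u) ω) =
        ∑ i, M u i j * eval ((M u).mulVec v) (ω.1 i) := fun u => eval_pullFun _ _ _ _
    have h2 : ∀ p : Poly, ContDiff ℂ 1 fun u => eval ((M u).mulVec v) p := fun p => by
      induction p using MvPolynomial.induction_on with
      | C c => simpa using contDiff_const
      | add p q hp hq => simpa using hp.add hq
      | mul_X p i hp =>
        simp only [map_mul, eval_X]
        refine hp.mul ?_
        simp only [Matrix.mulVec, dotProduct]
        exact ContDiff.sum fun k _ => (h i k).mul contDiff_const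
    simp only [h1]
    exact ContDiff.sum fun i _ => (h i j).mul (h2 _)
  | hzero => simpa using contDiff_const
  | hadd ℓ ℓ' h1 h2 => exact h1.add h2
  | hsmul c ℓ h1 => exact contDiff_const.mul h1

/-! ### Tangent vectors of manifolds in a projective space -/

section

variable {E : Type*} [AddCommGroup E] [Module ℂ E]

/-- The derivative of a map which is differentiable when read through the linear forms. -/
lemma exists_derivative [FiniteDimensional ℂ E] {k : ℕ} {f : (Fin k → ℂ) → E} {u : Fin k → ℂ}
    (h : ∀ ℓ : Module.Dual ℂ E, DifferentiableAt ℂ (fun w => ℓ (f w)) u) :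
    ∃ D : (Fin k → ℂ) →ₗ[ℂ] E, ∀ (ℓ : Module.Dual ℂ E) v,
      ℓ (D v) = fderiv ℂ (fun w => ℓ (f w)) u v := by
  let L : Module.Dual ℂ E →ₗ[ℂ] (Fin k → ℂ) →ₗ[ℂ] ℂ :=
    { toFun := fun ℓ => (fderiv ℂ (fun w => ℓ (f w)) u).toLinearMap
      map_add' := fun ℓ ℓ' => by
        ext1 v
        simp only [LinearMap.add_apply]
        rw [fderiv_fun_add (h ℓ) (h ℓ')]
        rfl
      map_smul' := fun c ℓ => by
        ext1 v
        simp only [LinearMap.smul_apply]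
        rw [fderiv_fun_const_smul (h ℓ)]
        rfl }
  refine ⟨(Module.evalEquiv ℂ E).symm.toLinearMap ∘ₗ L.flip, fun ℓ v => ?_⟩
  exact Module.apply_evalEquiv_symm_apply (R := ℂ) (M := E) ℓ (L.flip v)

lemma hasDerivAt_line {k : ℕ} {f : (Fin k → ℂ) → E} {u : Fin k → ℂ} {ℓ : Module.Dual ℂ E}
    (h : DifferentiableAt ℂ (fun w => ℓ (f w)) u) (v : Fin k → ℂ) :
    HasDerivAt (fun t : ℂ => ℓ (f (u + t • v))) (fderiv ℂ (fun w => ℓ (f w)) u v) 0 :=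
  h.hasFDerivAt.hasLineDerivAt v

lemma eventually_line_mem {k : ℕ} {U : Set (Fin k → ℂ)} (hU : IsOpen U) {u : Fin k → ℂ}
    (hu : u ∈ U) (v : Fin k → ℂ) : ∀ᶠ t : ℂ in nhds 0, u + t • v ∈ U := by
  have hc : Continuous fun t : ℂ => u + t • v := by fun_prop
  exact hc.continuousAt.eventually_mem (hU.mem_nhds (by simpa using hu))

/-- If a linear map is injective modulo the line of `x` and, together with `x`, takes values in `K`,
then `K` is of larger dimension than the source. -/
lemma add_one_le_finrank {k : ℕ} {D : (Fin k → ℂ) →ₗ[ℂ] E} {x : E} (hx : x ≠ 0)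
    (hD : ∀ v (c : ℂ), D v = c • x → v = 0) {K : Submodule ℂ E} [FiniteDimensional ℂ K]
    (hxK : x ∈ K) (hDK : ∀ v, D v ∈ K) : k + 1 ≤ Module.finrank ℂ K := by
  let Φ : (Fin k → ℂ) × ℂ →ₗ[ℂ] K :=
    (D.coprod (LinearMap.toSpanSingleton ℂ E x)).codRestrict K fun p =>
      K.add_mem (hDK _) (K.smul_mem _ hxK)
  have hΦ : Function.Injective Φ := by
    rw [← LinearMap.ker_eq_bot, LinearMap.ker_eq_bot']
    rintro ⟨v, c⟩ h
    have h1 : D v + c • x = 0 := congrArg Subtype.val h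
    have h2 : v = 0 := hD v (-c) (by rw [neg_smul]; exact eq_neg_of_add_eq_zero_left h1)
    subst h2
    rw [map_zero, zero_add, smul_eq_zero_iff_left hx] at h1
    rw [h1]
    rfl
  have := LinearMap.finrank_le_finrank_of_injective hΦ
  simpa using this

/-- A vector is in a subspace if all linear forms vanishing on the subspace vanish at it. -/
lemma mem_of_dual {K : Submodule ℂ E} {x : E}
    (h : ∀ ℓ : Module.Dual ℂ E, (∀ y ∈ K, ℓ y = 0) → ℓ x = 0) : x ∈ K := by
  rw [← Submodule.Quotient.mk_eq_zero, ← Module.forall_dual_apply_eq_zero_iff ℂ]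
  intro φ
  refine h (φ ∘ₗ K.mkQ) fun y hy => ?_
  rw [LinearMap.comp_apply, Submodule.mkQ_apply, (Submodule.Quotient.mk_eq_zero K).2 hy, map_zero]

end

/-- The matrices whose infinitesimal action fixes the line of `ω`. -/
def lineStab {d : ℕ} (ω : formSpace d) : Submodule ℂ Mat := (Submodule.span ℂ {ω}).comap (lieForm ω)

lemma lieForm_one {d : ℕ} (ω : formSpace d) : lieForm ω 1 = ((d : ℂ) + 2) • ω :=
  Subtype.ext (lie_one ω.2)

/-- The radial field preserves the line of `ω` and is, for `ω ≠ 0`, not in the annihilator. -/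
lemma finrank_lineStab_le {d : ℕ} (ω : formSpace d) :
    Module.finrank ℂ (lineStab ω) ≤ Module.finrank ℂ (annih (ω : Fin 3 → Poly)) + 1 := by
  have h2 : (d : ℂ) + 2 ≠ 0 := by exact_mod_cast (by omega : d + 2 ≠ 0)
  have h : lineStab ω ≤ annih (ω : Fin 3 → Poly) ⊔ Submodule.span ℂ {1} := by
    intro A hA
    obtain ⟨c, hc⟩ := Submodule.mem_span_singleton.1 (Submodule.mem_comap.1 hA)
    have h3 : A - (c / (d + 2)) • (1 : Mat) ∈ annih (ω : Fin 3 → Poly) := by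
      rw [← lieForm_eq_zero_iff, map_sub, map_smul, lieForm_one, smul_smul, div_mul_cancel₀ _ h2,
        hc, sub_self]
    rw [← sub_add_cancel A ((c / (d + 2)) • (1 : Mat))]
    exact Submodule.add_mem_sup h3 (Submodule.smul_mem _ _ (Submodule.mem_span_singleton_self _))
  refine (Submodule.finrank_mono h).trans
    ((Submodule.finrank_add_le_finrank_add_finrank _ _).trans (Nat.add_le_add_left ?_ _))
  simpa using finrank_span_le_card ({1} : Set Mat)

/-! ### The dimension of isotropy groups -/

/-- A manifold `u ↦ [f u]` in the isotropy group has dimension at most `dim (annih ω)`: if `D` is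
the derivative of `f` at `u`, the vectors `D v * (f u)⁻¹` preserve the line of `ω`, and they are
independent modulo the scalars because `[f u]` is an immersion. -/
lemma le_finrank_annih_of_containsManifold {d : ℕ} {ω : formSpace d}
    (hω : Saturated (ω : Fin 3 → Poly)) {k : ℕ}
    (h : ContainsManifold {p : ℙ ℂ Mat | ∃ g : GL (Fin 3) ℂ,
      Matrix.ProjGenLinGroup.mk g ∈ Iso (Foliation.ofForm ω hω) ∧
        p = Projectivization.mk ℂ (g : Mat) g.ne_zero} k) :
    k ≤ Module.finrank ℂ (annih (ω : Fin 3 → Poly)) := by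
  obtain ⟨U, f, hU, ⟨u, hu⟩, hdiff, hS, himm⟩ := h
  have hdu : ∀ ℓ : Module.Dual ℂ Mat, DifferentiableAt ℂ (fun w => ℓ (f w)) u := fun ℓ =>
    (hdiff ℓ).differentiableAt (hU.mem_nhds hu)
  have hf : ∀ w ∈ U, IsUnit (f w) ∧ ∃ c : ℂ, pull d (f w) ω = c • ω := by
    intro w hw
    obtain ⟨h0, g, hg, hmk⟩ := hS w hw
    obtain ⟨a, ha⟩ := (Projectivization.mk_eq_mk_iff ℂ _ _ _ _).1 hmk
    have hfw : f w = (g * Matrix.GeneralLinearGroup.scalar (Fin 3) a : GL (Fin 3) ℂ).1 := by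
      rw [Units.val_mul, Matrix.GeneralLinearGroup.coe_scalar, ← ha, Matrix.scalar_apply,
        ← Matrix.smul_one_eq_diagonal, Matrix.mul_smul, mul_one]
      rfl
    have hg' : Matrix.ProjGenLinGroup.mk (g * Matrix.GeneralLinearGroup.scalar (Fin 3) a) ∈
        Iso (Foliation.ofForm ω hω) := by
      rwa [← Matrix.ProjGenLinGroup.mk_eq_mk_iff.2 ⟨a, rfl⟩]
    obtain ⟨c, -, hc⟩ := (mk_mem_Iso_iff _ hω).1 hg'
    rw [hfw]
    exact ⟨Units.isUnit _, c, Subtype.ext hc⟩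
  obtain ⟨D, hD⟩ := exists_derivative hdu
  obtain ⟨⟨P, hP⟩, c₀, hc₀⟩ := hf u hu
  have hc0 : c₀ ≠ 0 := by
    rintro rfl
    rw [zero_smul] at hc₀
    have h1 : pullFun (P * P⁻¹ : GL (Fin 3) ℂ).1 (ω : Fin 3 → Poly) = 0 := by
      rw [Units.val_mul, pullFun_mul, hP]
      have h2 : pullFun (f u) (ω : Fin 3 → Poly) = 0 := congrArg Subtype.val hc₀
      rw [h2, pullFun_zero]
    rw [mul_inv_cancel, Units.val_one, pullFun_one] at h1
    exact hω.ne_zero (Subtype.ext h1)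
  have himm' : ∀ v (c : ℂ), D v = c • f u → v = 0 := fun v c h =>
    himm u hu v c fun ℓ => by rw [← hD, h, map_smul, smul_eq_mul]
  refine Nat.le_of_add_le_add_right (b := 1) (le_trans ?_ (finrank_lineStab_le ω))
  refine add_one_le_finrank (D := LinearMap.mulRight ℂ (P⁻¹).1 ∘ₗ D) (one_ne_zero : (1 : Mat) ≠ 0)
    (fun v c h => himm' v c ?_) ?_ fun v => ?_
  · have h1 : D v * (P⁻¹).1 = c • 1 := h
    rw [← hP]
    calc D v = D v * (P⁻¹).1 * P.1 := by rw [mul_assoc, Units.inv_mul, mul_one]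
      _ = c • P.1 := by rw [h1, Matrix.smul_mul, one_mul]
  · rw [lineStab, Submodule.mem_comap, lieForm_one]
    exact Submodule.smul_mem _ _ (Submodule.mem_span_singleton_self _)
  · set A : Mat := D v * (P⁻¹).1 with hA
    have hAf : A * f u = D v := by rw [hA, ← hP, mul_assoc, Units.inv_mul, mul_one]
    have key : pull d (f u) (lieForm ω A) ∈ Submodule.span ℂ {ω} := by
      refine mem_of_dual fun ℓ hℓ => ?_
      have hℓ0 : ℓ ω = 0 := hℓ _ (Submodule.mem_span_singleton_self _)
      have h1 : HasDerivAt (fun t : ℂ => ℓ (pull d (f (u + t • v)) ω))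
          (ℓ (pull d (f (u + (0 : ℂ) • v)) (lieForm ω A))) 0 := by
        refine hasDerivAt_pull ω (fun i j => ?_) ℓ
        have h2 := hasDerivAt_line (hdu (Matrix.entryLinearMap ℂ ℂ i j)) v
        rw [← hD] at h2
        rw [zero_smul, add_zero, hAf]
        exact h2
      have h3 : (fun t : ℂ => ℓ (pull d (f (u + t • v)) ω)) =ᶠ[nhds 0] fun _ => 0 := by
        filter_upwards [eventually_line_mem hU hu v] with t ht
        obtain ⟨-, c, hc⟩ := hf _ ht
        rw [hc, map_smul, hℓ0, smul_zero]
      have h4 := h1.unique ((hasDerivAt_const (0 : ℂ) (0 : ℂ)).congr_of_eventuallyEq h3)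
      rwa [zero_smul, add_zero] at h4
    obtain ⟨c, hc⟩ := Submodule.mem_span_singleton.1 key
    have h5 : pull d (f u) (lieForm ω A - (c / c₀) • ω) = 0 := by
      rw [map_sub, map_smul, hc₀, smul_smul, div_mul_cancel₀ _ hc0, hc, sub_self]
    have h6 : lieForm ω A - (c / c₀) • ω = 0 := by
      have h7 : pullFun (P * P⁻¹ : GL (Fin 3) ℂ).1
          ((lieForm ω A - (c / c₀) • ω : formSpace d) : Fin 3 → Poly) = 0 := by
        rw [Units.val_mul, pullFun_mul, hP]
        have h8 : pullFun (f u) ((lieForm ω A - (c / c₀) • ω : formSpace d) : Fin 3 → Poly) = 0 :=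
          congrArg Subtype.val h5
        rw [h8, pullFun_zero]
      rw [mul_inv_cancel, Units.val_one, pullFun_one] at h7
      exact Subtype.ext h7
    change lieForm ω A ∈ Submodule.span ℂ {ω}
    rw [sub_eq_zero.1 h6]
    exact Submodule.smul_mem _ _ (Submodule.mem_span_singleton_self _)

lemma two_le_finrank_annih_of_groupDim {d : ℕ} {ω : formSpace d}
    (hω : Saturated (ω : Fin 3 → Poly)) (h : groupDim (Iso (Foliation.ofForm ω hω)) = 2) :
    2 ≤ Module.finrank ℂ (annih (ω : Fin 3 → Poly)) := by
  by_contra hlt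
  have h1 : groupDim (Iso (Foliation.ofForm ω hω)) ≤ 1 := by
    refine iSup₂_le fun k hk => ?_
    have := le_finrank_annih_of_containsManifold hω hk
    exact_mod_cast (by omega : k ≤ 1)
  rw [h] at h1
  exact absurd h1 (by norm_num)

/-! ### Lower bounds for the dimension of orbits -/

/-- Matrices `A b` whose infinitesimal actions at `ω` are independent modulo the line of `ω`,
together with linear forms `ℓ a` on the quotient by this line dual to them. -/
lemma exists_orbit_chart {d : ℕ} {ω : formSpace d} {k : ℕ}
    (hk : k + Module.finrank ℂ (annih (ω : Fin 3 → Poly)) ≤ 8) :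
    ∃ (A : Fin k → Mat) (ℓ : Fin k → Module.Dual ℂ (formSpace d)),
      (∀ a, ℓ a ω = 0) ∧ ∀ a b, ℓ a (lieForm ω (A b)) = (1 : Matrix (Fin k) (Fin k) ℂ) a b := by
  set f := (Submodule.span ℂ {ω}).mkQ ∘ₗ lieForm ω with hf
  have hker : LinearMap.ker f = lineStab ω := by
    rw [hf, LinearMap.ker_comp, Submodule.ker_mkQ, lineStab]
  have h1 := LinearMap.finrank_range_add_finrank_ker f
  rw [hker] at h1
  have h2 := finrank_lineStab_le ω
  have h3 : Module.finrank ℂ Mat = 9 := by simp [Module.finrank_matrix]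
  obtain ⟨A, ℓ, h⟩ := exists_dual_family f (k := k) (by omega)
  refine ⟨A, fun a => ℓ a ∘ₗ (Submodule.span ℂ {ω}).mkQ, fun a => ?_, h⟩
  rw [LinearMap.comp_apply, Submodule.mkQ_apply,
    (Submodule.Quotient.mk_eq_zero _).2 (Submodule.mem_span_singleton_self _), map_zero]

/-- The map `u ↦ [M(u)^* ω]` with `M(u) = 1 + ∑ b, u b • A b` is an immersion near `0`: the Jacobian
matrix of the affine coordinates `ℓ a / ℓ₀` is the identity at `0`, up to a non-zero factor. -/
lemma containsManifold_orbit {d : ℕ} {ω : formSpace d} (hω : Saturated (ω : Fin 3 → Poly)) {k : ℕ}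
    (hk : k + Module.finrank ℂ (annih (ω : Fin 3 → Poly)) ≤ 8) :
    ContainsManifold {p | ∃ G ∈ orbit (Foliation.ofForm ω hω), G.1 = p} k := by
  obtain ⟨A, ℓ, hℓ, hA⟩ := exists_orbit_chart hk
  obtain ⟨ℓ₀, hℓ₀⟩ : ∃ ℓ₀ : Module.Dual ℂ (formSpace d), ℓ₀ ω ≠ 0 := by
    by_contra! h
    exact hω.ne_zero ((Module.forall_dual_apply_eq_zero_iff ℂ ω).1 h)
  set M : (Fin k → ℂ) → Mat := fun u => 1 + ∑ b, u b • A b with hM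
  have hM0 : M 0 = 1 := by simp [hM]
  have hMd : ∀ i j, ContDiff ℂ 1 fun u => M u i j := fun i j => by
    simp only [hM, Matrix.add_apply, Matrix.sum_apply, Matrix.smul_apply, smul_eq_mul]
    fun_prop
  set f : (Fin k → ℂ) → formSpace d := fun u => pull d (M u) ω with hf
  have hf0 : f 0 = ω := Subtype.ext (by
    change pullFun (M 0) (ω : Fin 3 → Poly) = ω
    rw [hM0, pullFun_one])
  have hfd : ∀ ℓ' : Module.Dual ℂ (formSpace d), ContDiff ℂ 1 fun u => ℓ' (f u) :=
    fun ℓ' => contDiff_pull ω hMd ℓ'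
  -- the numerators of the derivatives of the quotients of `ℓ a (f u)` by `ℓ₀ (f u)`
  set N : (Fin k → ℂ) → Matrix (Fin k) (Fin k) ℂ := fun u => Matrix.of fun a b =>
    fderiv ℂ (fun w => ℓ a (f w)) u (Pi.single b 1) * ℓ₀ (f u) -
      ℓ a (f u) * fderiv ℂ (fun w => ℓ₀ (f w)) u (Pi.single b 1) with hN
  have hfc : ∀ ℓ' : Module.Dual ℂ (formSpace d), Continuous fun u => ℓ' (f u) :=
    fun ℓ' => (hfd ℓ').continuous
  have hfd' : ∀ (ℓ' : Module.Dual ℂ (formSpace d)) (v : Fin k → ℂ),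
      Continuous fun u => fderiv ℂ (fun w => ℓ' (f w)) u v := fun ℓ' v =>
    ((hfd ℓ').continuous_fderiv one_ne_zero).clm_apply continuous_const
  have hNc : Continuous N := continuous_matrix fun a b =>
    ((hfd' _ _).mul (hfc _)).sub ((hfc _).mul (hfd' _ _))
  have hMc : Continuous M := continuous_matrix fun i j => (hMd i j).continuous
  have hN0 : N 0 = ℓ₀ ω • (1 : Matrix (Fin k) (Fin k) ℂ) := by
    ext a b
    have h1 := hasDerivAt_line ((hfd (ℓ a)).differentiable one_ne_zero 0) (Pi.single b 1)
    have h2 : HasDerivAt (fun t : ℂ => ℓ a (f (0 + t • Pi.single b 1)))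
        (ℓ a (pull d (M (0 + (0 : ℂ) • Pi.single b 1)) (lieForm ω (A b)))) 0 := by
      refine hasDerivAt_pull ω (fun i j => ?_) (ℓ a)
      have h3 : ∀ t : ℂ, M (0 + t • Pi.single b 1) i j = (1 : Mat) i j + t * A b i j := fun t => by
        simp only [hM, zero_add, Matrix.add_apply, Matrix.sum_apply, Matrix.smul_apply,
          Pi.smul_apply, smul_eq_mul, Pi.single_apply, mul_ite, mul_one, mul_zero, ite_mul,
          zero_mul, Finset.sum_ite_eq', Finset.mem_univ, if_true]
      simp only [h3]
      rw [zero_smul, add_zero, hM0, mul_one]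
      simpa using ((hasDerivAt_id (0 : ℂ)).mul_const (A b i j)).const_add ((1 : Mat) i j)
    rw [zero_smul, add_zero, hM0] at h2
    have h4 : pull d 1 (lieForm ω (A b)) = lieForm ω (A b) := Subtype.ext (pullFun_one _)
    rw [h4, hA] at h2
    simp only [hN, Matrix.of_apply, hf0, hℓ, zero_mul, sub_zero]
    rw [h1.unique h2, Matrix.smul_apply, smul_eq_mul, mul_comm]
  refine ⟨{u | ℓ₀ (f u) ≠ 0 ∧ (M u).det ≠ 0 ∧ (N u).det ≠ 0}, f, ?_, ⟨0, ?_⟩,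
    fun ℓ' => ((hfd ℓ').differentiable one_ne_zero).differentiableOn, ?_, ?_⟩
  · exact (isOpen_ne_fun (hfc _) continuous_const).inter
      ((isOpen_ne_fun hMc.matrix_det continuous_const).inter
        (isOpen_ne_fun hNc.matrix_det continuous_const))
  · refine ⟨by rwa [hf0], by rw [hM0, Matrix.det_one]; exact one_ne_zero, ?_⟩
    rw [hN0, Matrix.det_smul, Matrix.det_one, mul_one]
    exact pow_ne_zero _ hℓ₀
  · rintro u ⟨-, hu, -⟩
    have hMu : IsUnit (M u) := (Matrix.isUnit_iff_isUnit_det _).2 hu.isUnit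
    have hs : Saturated (f u : Fin 3 → Poly) := hω.pullFun_of_isUnit hMu
    exact ⟨hs.ne_zero, Foliation.ofForm (f u) hs,
      (ofForm_mem_orbit_iff hs hω).2 ⟨M u, 1, hMu, one_ne_zero, (one_smul _ _).symm⟩, rfl⟩
  · rintro u ⟨-, -, hu⟩ v c hv
    refine Matrix.eq_zero_of_mulVec_eq_zero hu (funext fun a => ?_)
    have hsum : ∀ L : (Fin k → ℂ) →L[ℂ] ℂ, ∑ b, L (Pi.single b 1) * v b = L v := fun L => by
      conv_rhs => rw [← Finset.univ_sum_single v, map_sum]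
      refine Finset.sum_congr rfl fun b _ => ?_
      rw [mul_comm, ← smul_eq_mul, ← map_smul, ← Pi.single_smul', smul_eq_mul, mul_one]
    simp only [Matrix.mulVec, dotProduct, hN, Matrix.of_apply, sub_mul, Finset.sum_sub_distrib,
      Pi.zero_apply]
    have e1 := hsum (fderiv ℂ (fun w => ℓ a (f w)) u)
    have e2 := hsum (fderiv ℂ (fun w => ℓ₀ (f w)) u)
    rw [hv] at e1 e2
    simp only [mul_right_comm _ (ℓ₀ (f u)), mul_assoc (ℓ a (f u)), ← Finset.sum_mul,
      ← Finset.mul_sum, e1, e2]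
    ring

lemma le_orbitDim {d : ℕ} {ω : formSpace d} (hω : Saturated (ω : Fin 3 → Poly)) {k : ℕ}
    (hk : k + Module.finrank ℂ (annih (ω : Fin 3 → Poly)) ≤ 8) :
    (k : ℕ∞) ≤ orbitDim (Foliation.ofForm ω hω) :=
  le_iSup₂_of_le (f := fun (k : ℕ) (_ : ContainsManifold _ k) => (k : ℕ∞)) k
    (containsManifold_orbit hω hk) le_rfl

/-! ### Tangent vectors of orbits -/

/-- Differentiating the minors of size `8` of the infinitesimal action, which vanish along the curve
`φ`, shows that the tangent vector `η` is infinitesimally fixed, modulo the tangent space of the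
orbit, by the annihilator. -/
lemma lieForm_mem_range_of_curve {d : ℕ} {φ : ℂ → formSpace d} {η : formSpace d}
    (hφ : ∀ ℓ : Module.Dual ℂ (formSpace d), HasDerivAt (fun t => ℓ (φ t)) (ℓ η) 0)
    (h2 : ∀ᶠ t in nhds 0, 2 ≤ Module.finrank ℂ (annih (φ t : Fin 3 → Poly)))
    (h0 : Module.finrank ℂ (annih (φ 0 : Fin 3 → Poly)) = 2) {B : Mat}
    (hB : B ∈ annih (φ 0 : Fin 3 → Poly)) :
    lieForm η B ∈ LinearMap.range (lieForm (φ 0)) := by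
  refine mem_of_dual fun ℓ₀ hℓ₀ => ?_
  have h9 := finrank_range_lieForm (φ 0)
  obtain ⟨A, ℓ, hA⟩ := exists_dual_family (lieForm (φ 0)) (k := 7) (by omega)
  set L : Fin 8 → Module.Dual ℂ (formSpace d) := Fin.cons ℓ₀ ℓ with hL
  have hdet : ∀ t, (lieMatrix L (Fin.cons B A) (φ t)).det = ∑ i : Fin 8, (-1) ^ (i : ℕ) *
      L i (lieForm (φ t) B) * (lieMatrix (fun a => L (i.succAbove a)) A (φ t)).det := fun t =>
    Matrix.det_succ_column_zero _
  have hentry : ∀ (ℓ' : Module.Dual ℂ (formSpace d)) (C : Mat),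
      HasDerivAt (fun t => ℓ' (lieForm (φ t) C)) (ℓ' (lieForm η C)) 0 := fun ℓ' C =>
    hφ (ℓ' ∘ₗ lieOn d C)
  have hminor : ∀ ℓ' : Fin 7 → Module.Dual ℂ (formSpace d),
      DifferentiableAt ℂ (fun t => (lieMatrix ℓ' A (φ t)).det) 0 := fun ℓ' => by
    simp only [Matrix.det_apply]
    refine DifferentiableAt.fun_sum fun σ _ => DifferentiableAt.const_smul ?_ _
    exact DifferentiableAt.fun_finsetProd fun i _ => (hentry _ _).differentiableAt
  have hder : HasDerivAt (fun t => (lieMatrix L (Fin.cons B A) (φ t)).det)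
      (ℓ₀ (lieForm η B)) 0 := by
    simp only [hdet]
    refine (HasDerivAt.fun_sum fun i _ => ((hentry (L i) B).const_mul ((-1) ^ (i : ℕ))).mul
      (hminor fun a => L (i.succAbove a)).hasDerivAt).congr_deriv ?_
    rw [Fin.sum_univ_succ, Finset.sum_eq_zero]
    · have h1 : lieMatrix (fun a => L (Fin.succAbove 0 a)) A (φ 0) = 1 := by
        ext a b
        exact hA a b
      rw [h1, lieForm_eq_zero_iff.2 hB]
      simp [hL]
    · intro i _
      rw [lieForm_eq_zero_iff.2 hB, Matrix.det_eq_zero_of_row_eq_zero 0]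
      · simp
      · intro b
        simp only [lieMatrix, Matrix.of_apply, Fin.succ_succAbove_zero, hL, Fin.cons_zero]
        exact hℓ₀ _ (LinearMap.mem_range_self _ _)
  refine hder.unique ((hasDerivAt_const (0 : ℂ) (0 : ℂ)).congr_of_eventuallyEq ?_)
  filter_upwards [h2] with t ht
  exact (two_le_finrank_annih_iff _).1 ht _ _

/-- Rigidity of `ω`: every form `η` which is infinitesimally fixed by the annihilator of `ω`, modulo
the tangent space `{lie A ω}` of the orbit of `ω`, belongs to this tangent space. -/
def IsRigid {d : ℕ} (ω : formSpace d) : Prop :=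
  ∀ η : formSpace d, (∀ B ∈ annih (ω : Fin 3 → Poly), lieForm η B ∈ LinearMap.range (lieForm ω)) →
    η ∈ LinearMap.range (lieForm ω)

lemma lieForm_pull {d : ℕ} {P A A' : Mat} (h : P * A' = A * P) (ω : formSpace d) :
    lieForm (pull d P ω) A' = pull d P (lieForm ω A) := Subtype.ext (lie_pullFun h ω)

lemma range_lieForm_smul {d : ℕ} {c : ℂ} (hc : c ≠ 0) (ω : formSpace d) :
    LinearMap.range (lieForm (c • ω)) = LinearMap.range (lieForm ω) := by
  have h : lieForm (c • ω) = c • lieForm ω := by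
    ext1 A
    exact map_smul (lieOn d A) c ω
  rw [h, LinearMap.range_smul _ _ hc]

/-- Rigidity is invariant under linear automorphisms and non-zero factors. -/
lemma IsRigid.pull {d : ℕ} {ω : formSpace d} (h : IsRigid ω) {P : Mat} (hP : IsUnit P) {c : ℂ}
    (hc : c ≠ 0) : IsRigid (c • pull d P ω) := by
  intro η hη
  rw [Submodule.coe_smul, annih_smul hc, range_lieForm_smul hc] at *
  obtain ⟨P, rfl⟩ := hP
  obtain ⟨ζ, rfl⟩ : ∃ ζ, η = PlaneFoliation.pull d P.1 ζ := by
    refine ⟨PlaneFoliation.pull d (P⁻¹).1 η, Subtype.ext ?_⟩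
    change (η : Fin 3 → Poly) = pullFun P.1 (pullFun (P⁻¹).1 η)
    rw [← pullFun_mul, Units.inv_mul, pullFun_one]
  have hinj : Function.Injective (PlaneFoliation.pull d P.1) := by
    intro α β h1
    have h2 : pullFun (P⁻¹).1 (pullFun P.1 (α : Fin 3 → Poly)) =
        pullFun (P⁻¹).1 (pullFun P.1 (β : Fin 3 → Poly)) := congrArg _ (congrArg Subtype.val h1)
    rw [← pullFun_mul, ← pullFun_mul, Units.mul_inv, pullFun_one, pullFun_one] at h2
    exact Subtype.ext h2
  obtain ⟨A, hA⟩ := h ζ fun B hB => by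
    obtain ⟨B', hB'⟩ := exists_conj P.isUnit B
    obtain ⟨A', hA'⟩ := hη B' (mem_annih_pullFun hB' hB)
    have hA : P.1 * A' = (P.1 * A' * (P⁻¹).1) * P.1 := by simp [mul_assoc]
    rw [lieForm_pull hA, lieForm_pull hB'] at hA'
    exact ⟨_, hinj hA'⟩
  obtain ⟨A', hA'⟩ := exists_conj P.isUnit A
  exact ⟨A', by rw [lieForm_pull hA', hA]⟩

/-- All tangent vectors of a manifold in the orbit, at the point of a form `f u`, are in
`{lie A (f u)}`. This space has dimension `9 - 2` and contains `f u` by Euler's relation, so that it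
gives a tangent space of dimension `6` in the projective space. -/
lemma orbitDim_le_six {d : ℕ} {ω : formSpace d} (hω : Saturated (ω : Fin 3 → Poly))
    (h2 : Module.finrank ℂ (annih (ω : Fin 3 → Poly)) = 2) (hr : IsRigid ω) :
    orbitDim (Foliation.ofForm ω hω) ≤ 6 := by
  refine iSup₂_le fun k hk => ?_
  obtain ⟨U, f, hU, ⟨u, hu⟩, hdiff, hS, himm⟩ := hk
  have hdu : ∀ ℓ : Module.Dual ℂ (formSpace d), DifferentiableAt ℂ (fun w => ℓ (f w)) u := fun ℓ =>
    (hdiff ℓ).differentiableAt (hU.mem_nhds hu)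
  have hconj : ∀ w ∈ U, IsLinConj ω (f w) := fun w hw => by
    obtain ⟨h0, G, hG, hmk⟩ := hS w hw
    have hs : Saturated (f w : Fin 3 → Poly) := (isFol_mk h0).1 (hmk ▸ G.2)
    have hG' : G = Foliation.ofForm (f w) hs := Subtype.ext hmk
    rw [hG'] at hG
    exact (ofForm_mem_orbit_iff hs hω).1 hG
  have hann : ∀ w ∈ U, Module.finrank ℂ (annih (f w : Fin 3 → Poly)) = 2 := fun w hw => by
    obtain ⟨P, c, hP, hc, h⟩ := hconj w hw
    rw [h, annih_smul hc, finrank_annih_pullFun hP, h2]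
  have hrig : IsRigid (f u) := by
    obtain ⟨P, c, hP, hc, h⟩ := hconj u hu
    have h' : f u = c • pull d P ω := Subtype.ext h
    rw [h']
    exact hr.pull hP hc
  obtain ⟨h0, -⟩ := hS u hu
  obtain ⟨D, hD⟩ := exists_derivative hdu
  have himm' : ∀ v (c : ℂ), D v = c • f u → v = 0 := fun v c h =>
    himm u hu v c fun ℓ => by rw [← hD, h, map_smul, smul_eq_mul]
  have h9 := finrank_range_lieForm (f u)
  rw [hann u hu] at h9
  have hd2 : (d : ℂ) + 2 ≠ 0 := by exact_mod_cast (by omega : d + 2 ≠ 0)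
  have := add_one_le_finrank h0 himm' (K := LinearMap.range (lieForm (f u)))
    ⟨((d : ℂ) + 2)⁻¹ • 1, by rw [map_smul, lieForm_one, inv_smul_smul₀ hd2]⟩ fun v => by
      refine hrig _ fun B hB => ?_
      have hu0 : f (u + (0 : ℂ) • v) = f u := by rw [zero_smul, add_zero]
      rw [← hu0] at hB ⊢
      refine lieForm_mem_range_of_curve (φ := fun t => f (u + t • v)) (fun ℓ => ?_) ?_ ?_ hB
      · rw [hD]
        exact hasDerivAt_line (hdu ℓ) v
      · filter_upwards [eventually_line_mem hU hu v] with t ht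
        exact (hann _ ht).ge
      · exact (congrArg (fun x : formSpace d => Module.finrank ℂ (annih (x : Fin 3 → Poly)))
          hu0).trans (hann u hu)
  exact_mod_cast (by omega : k ≤ 6)

/-! ### Rigidity of the model forms -/

lemma coeff_lie_diagonal (w : Fin 3 → ℂ) (η : Fin 3 → Poly) (j : Fin 3) (m : Fin 3 →₀ ℕ) :
    coeff m (lie (Matrix.diagonal w) η j) = (w j + ∑ i, w i * m i) * coeff m (η j) := by
  have h1 : ∑ i, C (Matrix.diagonal w i j) * η i = C (w j) * η j := by
    rw [Finset.sum_eq_single j]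
    · rw [Matrix.diagonal_apply_eq]
    · intro i _ hi
      rw [Matrix.diagonal_apply_ne _ hi, C_0, zero_mul]
    · simp
  have h2 : vf (Matrix.diagonal w) (η j) = ∑ i, C (w i) * (X i * pderiv i (η j)) := by
    rw [vf_apply]
    refine Finset.sum_congr rfl fun i _ => ?_
    rw [linForm, Finset.sum_eq_single i]
    · rw [Matrix.diagonal_apply_eq, mul_assoc]
    · intro l _ hl
      rw [Matrix.diagonal_apply_ne _ hl.symm, C_0, zero_mul]
    · simp
  rw [lie, h1, h2, coeff_add, coeff_C_mul, coeff_sum, add_mul, Finset.sum_mul]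
  congr 1
  refine Finset.sum_congr rfl fun i _ => ?_
  rw [coeff_C_mul, coeff_X_mul_pderiv, mul_assoc]

/-- If the diagonal field `w` with distinct entries annihilates `ω` and maps `η` into the tangent
space of the orbit of `ω`, then `η` is of weight zero modulo this tangent space. -/
lemma exists_weight_eq_zero {d : ℕ} {ω η : formSpace d} {w : Fin 3 → ℂ}
    (hw : Function.Injective w) (hω : Matrix.diagonal w ∈ annih (ω : Fin 3 → Poly))
    (hη : lieForm η (Matrix.diagonal w) ∈ LinearMap.range (lieForm ω)) :
    ∃ A : Mat, ∀ (j : Fin 3) (m : Fin 3 →₀ ℕ),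
      coeff m ((η - lieForm ω A : formSpace d).1 j) ≠ 0 → w j + ∑ i, w i * m i = 0 := by
  obtain ⟨B, hB⟩ := hη
  rw [mem_annih] at hω
  set W : Mat := Matrix.diagonal w with hW
  -- `A W - W A` is the off-diagonal part of `B`
  set A : Mat := Matrix.of fun i j => B i j / (w j - w i) with hA
  set D : Mat := Matrix.diagonal fun i => B i i with hD
  have hAW : A * W - W * A = B - D := by
    ext i j
    rw [Matrix.sub_apply, Matrix.sub_apply, hW, Matrix.mul_diagonal, Matrix.diagonal_mul, hA,
      Matrix.of_apply, hD]
    by_cases hij : i = j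
    · subst hij
      rw [Matrix.diagonal_apply_eq]
      ring
    · have : w j - w i ≠ 0 := sub_ne_zero.2 fun h => hij (hw h).symm
      rw [Matrix.diagonal_apply_ne _ hij]
      field_simp
      ring
  have h1 : lie W (lie A (ω : Fin 3 → Poly)) = lie B ω - lie D ω := by
    have h2 := lie_comm W A (ω : Fin 3 → Poly)
    rw [hω, lie_zero, sub_zero, hAW] at h2
    rw [h2]
    exact (lieLeft (ω : Fin 3 → Poly)).map_sub B D
  have h2 : lie W ((η - lieForm ω A : formSpace d) : Fin 3 → Poly) = lie D ω := by
    have h3 : lie B (ω : Fin 3 → Poly) = lie W η := congrArg Subtype.val hB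
    have h4 : lie W ((η - lieForm ω A : formSpace d) : Fin 3 → Poly) =
        lie W η - lie W (lie A ω) := (lieRight W).map_sub _ _
    rw [h4, h1, h3]
    abel
  have h3 : lie W (lie D (ω : Fin 3 → Poly)) = 0 := by
    have h4 := lie_comm W D (ω : Fin 3 → Poly)
    have h5 : D * W - W * D = 0 := by
      rw [hD, hW, Matrix.diagonal_mul_diagonal, Matrix.diagonal_mul_diagonal, sub_eq_zero]
      congr 1
      funext i
      exact mul_comm _ _
    rw [hω, lie_zero, sub_zero, h5] at h4
    rw [h4]
    exact (lieLeft (ω : Fin 3 → Poly)).map_zero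
  refine ⟨A, fun j m hm => ?_⟩
  have h4 : coeff m (lie W (lie W ((η - lieForm ω A : formSpace d) : Fin 3 → Poly)) j) = 0 := by
    rw [h2, h3, Pi.zero_apply, coeff_zero]
  rw [coeff_lie_diagonal, coeff_lie_diagonal, ← mul_assoc] at h4
  exact mul_self_eq_zero.1 ((mul_eq_zero.1 h4).resolve_right hm)

lemma exists_eq_two_monomials {p : Poly} {a b : Fin 3 → ℕ}
    (h : ∀ m, coeff m p ≠ 0 → (∀ i, m i = a i) ∨ ∀ i, m i = b i) :
    ∃ s t : ℂ, p = C s * (X 0 ^ a 0 * X 1 ^ a 1 * X 2 ^ a 2) +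
      C t * (X 0 ^ b 0 * X 1 ^ b 1 * X 2 ^ b 2) := by
  classical
  have key : ∀ (a : Fin 3 → ℕ) (s : ℂ), C s * (X 0 ^ a 0 * X 1 ^ a 1 * X 2 ^ a 2 : Poly) =
      monomial (Finsupp.equivFunOnFinite.symm a) s := fun a s => by
    rw [monomial_eq, Finsupp.prod_fintype _ _ (by simp), Fin.prod_univ_three]
    rfl
  set ma := Finsupp.equivFunOnFinite.symm a
  set mb := Finsupp.equivFunOnFinite.symm b
  refine ⟨coeff ma p, if ma = mb then 0 else coeff mb p, ?_⟩
  rw [key, key]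
  ext m
  rw [coeff_add, coeff_monomial, coeff_monomial]
  by_cases h1 : ma = m
  · subst h1
    by_cases h2 : mb = ma
    · simp [ma, mb, h2]
    · simp [ma, mb, h2]
  · by_cases h2 : mb = m
    · subst h2
      simp [ma, mb, h1]
    · rw [if_neg h1, if_neg h2, add_zero]
      by_contra hm
      rcases h m hm with h3 | h3
      · exact h1 (Finsupp.ext fun i => (h3 i).symm)
      · exact h2 (Finsupp.ext fun i => (h3 i).symm)

/-- The monomials of weight zero for `weight₁ d`. A monomial in the coefficient of `dx` is
multiplied by `x` beforehand, and similarly for `dy` and `dz`, which accounts for the degree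
`d + 2`. -/
lemma exponents_of_weight₁ {d i j k : ℕ} (hd : 2 ≤ d) (hs : i + j + k = d + 2)
    (h : (i : ℂ) - (d + 1) * j + (d ^ 2 + d - 1) * k = 0) :
    (i = 1 ∧ j = d ∧ k = 1) ∨ (i = d + 1 ∧ j = 1 ∧ k = 0) := by
  have h' : (i : ℤ) - (d + 1) * j + (d ^ 2 + d - 1) * k = 0 := by exact_mod_cast h
  have hs' : (i : ℤ) + j + k = d + 2 := by exact_mod_cast hs
  have hj : (1 : ℤ) - j + k * (d - 1) = 0 := by
    refine (mul_eq_zero.1 (?_ : ((d : ℤ) + 2) * (1 - j + k * (d - 1)) = 0)).resolve_left (by omega)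
    linear_combination h' - hs'
  have hi : (i : ℤ) = d + 1 - k * d := by linear_combination hs' + hj
  have hk : k ≤ 1 := by
    by_contra hk
    have : (2 : ℤ) * d ≤ k * d := by
      refine mul_le_mul_of_nonneg_right (by exact_mod_cast not_le.1 hk) (by omega)
    omega
  interval_cases k
  · right
    push_cast at hi hj
    omega
  · left
    push_cast at hi hj
    omega

/-- The monomials of weight zero for `weight₂ d`, with the same convention. -/
lemma exponents_of_weight₂ {d i j k : ℕ} (hs : i + j + k = d + 2)
    (h : (d + 1 : ℂ) * i - j - (d + 1) ^ 2 * k = 0) :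
    (i = 1 ∧ j = d + 1 ∧ k = 0) ∨ (i = d + 1 ∧ j = 0 ∧ k = 1) := by
  have h' : (d + 1 : ℤ) * i - j - (d + 1) ^ 2 * k = 0 := by exact_mod_cast h
  have hs' : (i : ℤ) + j + k = d + 2 := by exact_mod_cast hs
  have hi : (i : ℤ) - 1 - k * d = 0 := by
    refine (mul_eq_zero.1 (?_ : ((d : ℤ) + 2) * (i - 1 - k * d) = 0)).resolve_left (by omega)
    linear_combination h' + hs'
  have hj : (j : ℤ) = (d + 1) - k * (d + 1) := by linear_combination hs' - hi
  have hk : k ≤ 1 := by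
    by_contra hk
    have : (2 : ℤ) * (d + 1) ≤ k * (d + 1) := by
      refine mul_le_mul_of_nonneg_right (by exact_mod_cast not_le.1 hk) (by omega)
    omega
  interval_cases k
  · left
    push_cast at hi hj
    omega
  · right
    push_cast at hi hj
    omega

lemma weight₁_eq_diagonal (d : ℕ) :
    weight₁ d = Matrix.diagonal ![1, -((d : ℂ) + 1), (d : ℂ) ^ 2 + d - 1] := by
  ext i j
  fin_cases i <;> fin_cases j <;> rfl

lemma weight₂_eq_diagonal (d : ℕ) :
    weight₂ d = Matrix.diagonal ![(d : ℂ) + 1, -1, -((d : ℂ) + 1) ^ 2] := by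
  ext i j
  fin_cases i <;> fin_cases j <;> rfl

/-- The infinitesimal action of `N`, if `N` annihilates `ω`, preserves the tangent space of the
orbit. -/
lemma lieForm_lieForm_mem_range {d : ℕ} {ω : formSpace d} {N : Mat}
    (hN : N ∈ annih (ω : Fin 3 → Poly)) (A : Mat) :
    lieForm (lieForm ω A) N ∈ LinearMap.range (lieForm ω) := by
  refine ⟨A * N - N * A, Subtype.ext ?_⟩
  have h := lie_comm N A (ω : Fin 3 → Poly)
  rw [mem_annih.1 hN, lie_zero, sub_zero] at h
  exact h.symm

lemma mem_range_of_sub_mem {d : ℕ} {ω η : formSpace d} {A : Mat}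
    (h : η - lieForm ω A ∈ LinearMap.range (lieForm ω)) : η ∈ LinearMap.range (lieForm ω) := by
  have := Submodule.add_mem _ h (LinearMap.mem_range_self (lieForm ω) A)
  rwa [sub_add_cancel] at this

lemma injective_vec_three {a b c : ℂ} (hab : a ≠ b) (hac : a ≠ c) (hbc : b ≠ c) :
    Function.Injective ![a, b, c] := by
  intro i j h
  fin_cases i <;> fin_cases j <;> simp_all

/-- By `exists_weight_eq_zero` it is enough to treat a form `ζ` of weight zero. The few monomials of
weight zero and the Euler condition leave a space of dimension two, which is the image of the
diagonal matrices. -/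
lemma isRigid_form₂ {d : ℕ} (hd : 2 ≤ d) : IsRigid (form₂ d) := by
  intro η hη
  have hW := weight₂_mem_annih hd
  have hηW := hη _ hW
  rw [weight₂_eq_diagonal] at hW hηW
  have hd1 : (d : ℂ) + 1 ≠ 0 := by exact_mod_cast (by omega : d + 1 ≠ 0)
  have hinj : Function.Injective ![(d : ℂ) + 1, -1, -((d : ℂ) + 1) ^ 2] := by
    have hd0 : (d : ℂ) ≠ 0 := by exact_mod_cast (by omega : d ≠ 0)
    have hd2 : (d : ℂ) + 2 ≠ 0 := by exact_mod_cast (by omega : d + 2 ≠ 0)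
    exact injective_vec_three (fun h => hd2 (by linear_combination h))
      (fun h => mul_ne_zero hd1 hd2 (by linear_combination h))
      (fun h => mul_ne_zero hd0 hd2 (by linear_combination h))
  obtain ⟨A, hA⟩ := exists_weight_eq_zero hinj hW hηW
  refine mem_range_of_sub_mem (A := A) ?_
  set ζ := η - lieForm (form₂ d) A with hζ
  have hsum : ∀ (j : Fin 3) (m : Fin 3 →₀ ℕ), coeff m (ζ.1 j) ≠ 0 → m 0 + m 1 + m 2 = d + 1 :=
    fun j m hm => sum_eq_of_coeff_ne_zero (ζ.2.1 j) hm
  obtain ⟨a, b, h0⟩ := exists_eq_two_monomials (p := ζ.1 0) (a := ![0, d + 1, 0]) (b := ![d, 0, 1])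
    fun m hm => by
      have hs := hsum 0 m hm
      have hw := hA 0 m hm
      simp only [Fin.sum_univ_three, Matrix.cons_val] at hw
      have := exponents_of_weight₂ (d := d) (i := m 0 + 1) (j := m 1) (k := m 2) (by omega)
        (by push_cast; linear_combination hw)
      simp [Fin.forall_fin_succ]
      omega
  obtain ⟨c, c', h1⟩ := exists_eq_two_monomials (p := ζ.1 1) (a := ![1, d, 0]) (b := ![1, d, 0])
    fun m hm => by
      have hs := hsum 1 m hm
      have hw := hA 1 m hm
      simp only [Fin.sum_univ_three, Matrix.cons_val] at hw
      have := exponents_of_weight₂ (d := d) (i := m 0) (j := m 1 + 1) (k := m 2) (by omega)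
        (by push_cast; linear_combination hw)
      simp [Fin.forall_fin_succ]
      omega
  obtain ⟨e, e', h2⟩ := exists_eq_two_monomials (p := ζ.1 2) (a := ![d + 1, 0, 0])
    (b := ![d + 1, 0, 0]) fun m hm => by
      have hs := hsum 2 m hm
      have hw := hA 2 m hm
      simp only [Fin.sum_univ_three, Matrix.cons_val] at hw
      have := exponents_of_weight₂ (d := d) (i := m 0) (j := m 1) (k := m 2 + 1) (by omega)
        (by push_cast; linear_combination hw)
      simp [Fin.forall_fin_succ]
      omega
  have hE := ζ.2.2
  rw [Fin.sum_univ_three, h0, h1, h2] at hE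
  have hE1 := congrArg (eval ![1, 1, 0]) hE
  have hE2 := congrArg (eval ![1, 0, 1]) hE
  obtain ⟨f, rfl⟩ : ∃ f, d = f + 2 := ⟨d - 2, by omega⟩
  simp at hE1 hE2
  have ea : a = -(c + c') := by linear_combination hE1
  have ee : e' = -b - e := by linear_combination hE2
  refine ⟨!![0, 0, 0; 0, (c + c') / ((f : ℂ) + 3), 0; 0, 0, b], Subtype.ext (funext fun j => ?_)⟩
  rw [coe_lieForm]
  have hf3 : (f : ℂ) + 3 ≠ 0 := by exact_mod_cast (by omega : f + 3 ≠ 0)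
  have hc : (C ((c + c') / ((f : ℂ) + 3)) : Poly) * ((f : Poly) + 3) = C c + C c' := by
    rw [show ((f : Poly) + 3) = C ((f : ℂ) + 3) by simp [show (C 3 : Poly) = 3 from map_ofNat C 3],
      ← C_mul, div_mul_cancel₀ _ hf3, C_add]
  fin_cases j
  · change _ = ζ.1 0
    rw [h0, ea]
    simp [lie, vf_apply, linForm, form₂, Fin.sum_univ_three, pderiv_X, Derivation.leibniz_pow]
    linear_combination (-(X 1 ^ (f + 3))) * hc
  · change _ = ζ.1 1
    rw [h1]
    simp [lie, vf_apply, linForm, form₂, Fin.sum_univ_three, pderiv_X, Derivation.leibniz_pow]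
    linear_combination (X 0 * X 1 ^ (f + 2)) * hc
  · change _ = ζ.1 2
    rw [h2, ee]
    simp [lie, vf_apply, linForm, form₂, Fin.sum_univ_three, pderiv_X, Derivation.leibniz_pow]
    ring

/-- As for `form₂ d`, it is enough to treat a form `ζ` of weight zero. Here the torus alone is not
sufficient: the forms of weight zero contain `x y ^ (d - 1) z dy`, whose coefficient has to vanish
because `ζ` is also fixed by `lowerLeft`, modulo the tangent space. -/
lemma isRigid_form₁ {d : ℕ} (hd : 2 ≤ d) : IsRigid (form₁ d) := by
  intro η hη
  have hW := weight₁_mem_annih hd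
  have hηW := hη _ hW
  rw [weight₁_eq_diagonal] at hW hηW
  have hinj : Function.Injective ![1, -((d : ℂ) + 1), (d : ℂ) ^ 2 + d - 1] := by
    have hd0 : (d : ℂ) ≠ 0 := by exact_mod_cast (by omega : d ≠ 0)
    have hd2 : (d : ℂ) + 2 ≠ 0 := by exact_mod_cast (by omega : d + 2 ≠ 0)
    have hd1 : (d : ℂ) - 1 ≠ 0 := sub_ne_zero.2 (by exact_mod_cast (by omega : d ≠ 1))
    exact injective_vec_three (fun h => hd2 (by linear_combination h))
      (fun h => mul_ne_zero hd1 hd2 (by linear_combination -h))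
      (fun h => mul_ne_zero hd0 hd2 (by linear_combination -h))
  obtain ⟨A, hA⟩ := exists_weight_eq_zero hinj hW hηW
  refine mem_range_of_sub_mem (A := A) ?_
  set ζ := η - lieForm (form₁ d) A with hζ
  have hL : lieForm ζ lowerLeft ∈ LinearMap.range (lieForm (form₁ d)) := by
    have h1 : lieForm ζ lowerLeft =
        lieForm η lowerLeft - lieForm (lieForm (form₁ d) A) lowerLeft :=
      map_sub (lieOn d lowerLeft) _ _
    rw [h1]
    exact Submodule.sub_mem _ (hη _ (lowerLeft_mem_annih_form₁ d))
      (lieForm_lieForm_mem_range (lowerLeft_mem_annih_form₁ d) A)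
  have hsum : ∀ (j : Fin 3) (m : Fin 3 →₀ ℕ), coeff m (ζ.1 j) ≠ 0 → m 0 + m 1 + m 2 = d + 1 :=
    fun j m hm => sum_eq_of_coeff_ne_zero (ζ.2.1 j) hm
  obtain ⟨a, b, h0⟩ := exists_eq_two_monomials (p := ζ.1 0) (a := ![0, d, 1]) (b := ![d, 1, 0])
    fun m hm => by
      have hs := hsum 0 m hm
      have hw := hA 0 m hm
      simp only [Fin.sum_univ_three, Matrix.cons_val] at hw
      have := exponents_of_weight₁ hd (i := m 0 + 1) (j := m 1) (k := m 2) (by omega)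
        (by push_cast; linear_combination hw)
      simp [Fin.forall_fin_succ]
      omega
  obtain ⟨c, e, h1⟩ := exists_eq_two_monomials (p := ζ.1 1) (a := ![1, d - 1, 1])
    (b := ![d + 1, 0, 0]) fun m hm => by
      have hs := hsum 1 m hm
      have hw := hA 1 m hm
      simp only [Fin.sum_univ_three, Matrix.cons_val] at hw
      have := exponents_of_weight₁ hd (i := m 0) (j := m 1 + 1) (k := m 2) (by omega)
        (by push_cast; linear_combination hw)
      simp [Fin.forall_fin_succ]
      omega
  obtain ⟨g, g', h2⟩ := exists_eq_two_monomials (p := ζ.1 2) (a := ![1, d, 0])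
    (b := ![1, d, 0]) fun m hm => by
      have hs := hsum 2 m hm
      have hw := hA 2 m hm
      simp only [Fin.sum_univ_three, Matrix.cons_val] at hw
      have := exponents_of_weight₁ hd (i := m 0) (j := m 1) (k := m 2 + 1) (by omega)
        (by push_cast; linear_combination hw)
      simp [Fin.forall_fin_succ]
      omega
  have hE := ζ.2.2
  rw [Fin.sum_univ_three, h0, h1, h2] at hE
  have hE1 := congrArg (eval ![1, 1, 0]) hE
  have hE2 := congrArg (eval ![1, 1, 1]) hE
  obtain ⟨f, rfl⟩ : ∃ f, d = f + 2 := ⟨d - 2, by omega⟩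
  rw [show f + 2 - 1 = f + 1 by omega] at h1
  simp at hE1 hE2
  -- the second component of `lie lowerLeft ζ` is `c x² y ^ (d - 1)`
  have hc0 : c = 0 := by
    obtain ⟨B, hB⟩ := hL
    have hv : ∀ x y z : ℂ, eval ![x, y, z] (lie B (form₁ (f + 2)) 1) =
        eval ![x, y, z] (lie lowerLeft (ζ : Fin 3 → Poly) 1) := fun x y z => by
      rw [← coe_lieForm, ← coe_lieForm, hB]
    simp only [eval_lie] at hv
    have v1 := hv 1 0 0
    have v2 := hv 0 1 1
    have v3 := hv 1 1 0
    have v4 := hv 1 2 0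
    simp [h1, form₁, lowerLeft, Fin.sum_univ_three, pderiv_X, Derivation.leibniz_pow] at v1 v2 v3 v4
    refine (mul_eq_zero_iff_right (pow_ne_zero (f + 1) (two_ne_zero (α := ℂ)))).1 ?_
    linear_combination v4 - 2 * 2 ^ (f + 1) * v3 - (1 - 2 * 2 ^ (f + 1)) * v1 -
      (2 * f + 4 - 2 * 2 ^ (f + 1) * (f + 2)) * v2
  subst hc0
  have eb : b = -e := by linear_combination hE1
  have eg : g' = -a - g := by linear_combination hE2 - hE1
  refine ⟨!![0, 0, 0; 0, e, 0; 0, 0, a - (f + 2) * e], Subtype.ext (funext fun j => ?_)⟩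
  rw [coe_lieForm]
  fin_cases j
  · change _ = ζ.1 0
    rw [h0, eb]
    simp [lie, vf_apply, linForm, form₁, Fin.sum_univ_three, pderiv_X,
      Derivation.leibniz_pow, show (C 2 : Poly) = 2 from map_ofNat C 2]
    ring
  · change _ = ζ.1 1
    rw [h1]
    simp [lie, vf_apply, linForm, form₁, Fin.sum_univ_three, pderiv_X, Derivation.leibniz_pow]
    first | ring1 | (left; ring1)
  · change _ = ζ.1 2
    rw [h2, eg]
    simp [lie, vf_apply, linForm, form₁, Fin.sum_univ_three, pderiv_X,
      Derivation.leibniz_pow, show (C 2 : Poly) = 2 from map_ofNat C 2]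
    ring

/-! ### Orbits of dimension six -/

lemma orbitDim_F₁_le {d : ℕ} (hd : 2 ≤ d) : orbitDim (F₁ d) ≤ 6 :=
  orbitDim_le_six _ ((annih_form₁ hd).symm ▸ finrank_span_weight_lowerLeft (by simp [weight₁]))
    (isRigid_form₁ hd)

lemma orbitDim_F₂_le {d : ℕ} (hd : 2 ≤ d) : orbitDim (F₂ d) ≤ 6 :=
  orbitDim_le_six _ ((annih_form₂ hd).symm ▸ finrank_span_weight_lowerLeft (by
    simp only [weight₂, Matrix.of_apply, Matrix.cons_val_zero, Matrix.cons_val', ne_eq]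
    exact_mod_cast (by omega : d + 1 ≠ 0))) (isRigid_form₂ hd)

lemma mem_orbit_of_two_le_finrank {d : ℕ} (hd : 2 ≤ d) {ω : formSpace d}
    (hω : Saturated (ω : Fin 3 → Poly))
    (h : 2 ≤ Module.finrank ℂ (annih (ω : Fin 3 → Poly))) :
    Foliation.ofForm ω hω ∈ orbit (F₁ d) ∨ Foliation.ofForm ω hω ∈ orbit (F₂ d) :=
  (isConjModel_iff.1 (isConjModel_of_two_le_finrank hd ω.2 hω h)).imp
    (ofForm_mem_orbit_iff hω _).2 (ofForm_mem_orbit_iff hω _).2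

lemma six_le_orbitDim {d : ℕ} (hd : 2 ≤ d) (F : Foliation d) : 6 ≤ orbitDim F := by
  obtain ⟨ω, hω, rfl⟩ := exists_eq_ofForm F
  refine le_orbitDim hω (k := 6) ?_
  by_cases h : 2 ≤ Module.finrank ℂ (annih (ω : Fin 3 → Poly))
  · rw [(isConjModel_of_two_le_finrank hd ω.2 hω h).finrank_annih hd]
  · omega

lemma orbitDim_eq_six_iff {d : ℕ} (hd : 2 ≤ d) (F : Foliation d) :
    orbitDim F = 6 ↔ orbit F = orbit (F₁ d) ∨ orbit F = orbit (F₂ d) := by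
  constructor
  · intro h6
    obtain ⟨ω, hω, rfl⟩ := exists_eq_ofForm F
    rw [MulAction.orbit_eq_iff, MulAction.orbit_eq_iff]
    refine mem_orbit_of_two_le_finrank hd hω ?_
    by_contra hlt
    have h7 := le_orbitDim hω (k := 7) (by omega)
    rw [h6] at h7
    exact absurd h7 (by norm_num)
  · intro h
    refine le_antisymm ?_ (six_le_orbitDim hd F)
    rcases h with h | h
    · rw [orbitDim, h]
      exact orbitDim_F₁_le hd
    · rw [orbitDim, h]
      exact orbitDim_F₂_le hd

end PlaneFoliation

end

open PlaneFoliation in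
theorem theoremA (d : ℕ) (hd : 2 ≤ d) :
    (∀ F : Foliation d, groupDim (Iso F) = 2 → F ∈ orbit (F₁ d) ∨ F ∈ orbit (F₂ d)) ∧
    (∀ F : Foliation d, 6 ≤ orbitDim F) ∧
    (∀ F : Foliation d, orbitDim F = 6 ↔ orbit F = orbit (F₁ d) ∨ orbit F = orbit (F₂ d)) ∧
    orbit (F₁ d) ≠ orbit (F₂ d) ∧
    IsClosedInFol (orbit (F₁ d)) ∧
    IsClosedInFol (orbit (F₂ d)) ∧
    (Iso (F₁ d) : Set (PGL(3, ℂ))) =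
      {φ | ∃ α β : ℂ, α ≠ 0 ∧ IsAffineMap φ (α ^ (d - 1)) (α ^ d) β} ∧
    (Iso (F₂ d) : Set (PGL(3, ℂ))) =
      {φ | ∃ α β : ℂ, α ≠ 0 ∧ IsAffineMap φ (α ^ (d + 1)) (α ^ d) β} ∧
    ¬ ∃ φ : PGL(3, ℂ), (Iso (F₁ d)).map (MulAut.conj φ).toMonoidHom = Iso (F₂ d) := by
  refine ⟨fun F hF => ?_, six_le_orbitDim hd, orbitDim_eq_six_iff hd, orbit_F₁_ne hd,
    isClosedInFol_orbit_F₁ hd, isClosedInFol_orbit_F₂ hd, Set.ext (mem_Iso_F₁_iff hd),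
    Set.ext (mem_Iso_F₂_iff hd), not_conj_Iso hd⟩
  obtain ⟨ω, hω, rfl⟩ := exists_eq_ofForm F
  exact mem_orbit_of_two_le_finrank hd hω (two_le_finrank_annih_of_groupDim hω hF)
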